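/- **Setting.** Let $q\ge 5$ be a prime power and $q\equiv\xi\pmod 3$ with $\xi\in\{-1,0,1\}$. In $\mathrm{PG}(3,q)$ let $\mathscr C=\{P(t):t\in\mathbb F_q\cup\{\infty\}\}$ be the twisted cubic, $P(t)=(t^3,t^2,t,1)$, $P(\infty)=(1,0,0,0)$, and let $G_q$ be the group of projectivities of $\mathrm{PG}(3,q)$ fixing $\mathscr C$. The osculating plane at $P(t)$ is $x_0-3tx_1+3t^2x_2-t^3x_3=0$, and at $P(\infty)$ it is $x_3=0$; $\Gamma$ is the set of osculating planes. The tangent at $P(t)$ is the line through $(t^3,t^2,t,1)$ and $(3t^2,2t,1,0)$, and at $P(\infty)$ it is the line through $(1,0,0,0)$ and $(0,1,0,0)$. A real chord is a line through two distinct points of $\mathscr C$; an imaginary chord is a line of $\mathrm{PG}(3,q)$ joining (over $\mathbb F_{q^2}$) the points $P(\alpha),P(\alpha^q)$ for some $\alpha\in\mathbb F_{q^2}\setminus\mathbb F_q$. A $d_{\mathscr C}$-plane is a plane with exactly $d$ points on $\mathscr C$; a $\mu_\Gamma$-point is a point off $\mathscr C$ on exactly $\mu$ osculating planes. Put $\mathscr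 N_1=\Gamma$, $\mathscr N_2=\{2_{\mathscr C}\text{-planes}\}$, $\mathscr N_3=\{3_{\mathscr C}\text{-planes}\}$, $\mathscr N_4=\{1_{\mathscr C}\text{-planes not in }\Gamma\}$, $\mathscr N_5=\{0_{\mathscr C}\text{-planes}\}$, and $\mathscr M_1=\mathscr C$. For $\xi\neq0$ put $\mathscr M_2=\{$points off $\mathscr C$ on a tangent$\}$, $\mathscr M_3=\{3_\Gamma\text{-points}\}$, $\mathscr M_4=\{1_\Gamma\text{-points}\}$, $\mathscr M_5=\{0_\Gamma\text{-points}\}$. For $\xi=0$ put $\mathscr M_2=\{(q+1)_\Gamma\text{-points}\}$, $\mathscr M_3=\{1_\Gamma\text{-points on a tangent}\}$, $\mathscr M_4=\{$points off $\mathscr C$ on a real chord$\}$, $\mathscr M_5=\{$points on an imaginary chord$\}$. Let $\mathcal I_{ij}$ be the $\#\mathscr N_i\times\#\mathscr M_j$ submatrix of the point-plane incidence matrix with rows indexed by $\mathscr N_i$ and columns by $\mathscr M_j$. **Theorem 3.1, part A.** The classes $\mathscr N_1,\dots,\mathscr N_5$ are pairwise distinct and are exactly the orbits of $G_q$ on planes;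 likewise $\mathscr M_1,\dots,\mathscr M_5$ on points. Their sizes are $\#\mathscr N_i=q+1,\ q^2+q,\ \frac{q^3-q}6,\ \frac{q^3-q}2,\ \frac{q^3-q}3$ for $i=1,\dots,5$; $\#\mathscr M_j=\#\mathscr N_j$ if $\xi\ne0$; and $\#\mathscr M_j=q+1,\ q+1,\ q^2-1,\ \frac{q^3-q}2,\ \frac{q^3-q}2$ if $\xi=0$. (i) Each $\mathcal I_{ij}$ is a tactical configuration: every row has the same number $k_{ij}$ of ones, every column the same number $r_{ij}$. These numbers are the following (row $i$, column $j$). For $\xi=\pm1$: $$(k_{ij})=\begin{pmatrix}1&2q&\frac{q^2-q}2&\frac{q^2-q}2&0\\ 2&2q-1&\frac{q^2-3q+2}6&\frac{q^2-q}2&\frac{q^2-1}3\\ 3&q-2&\frac{q^2+\xi q+4}6&\frac{q^2-\xi q}2&\frac{q^2+\xi q-2}3\\ 1&q&\frac{q^2-\xi q}6&\frac{q^2+\xi q}2&\frac{q^2-\xi q}3\\ 0&q+1&\frac{q^2+\xi q-2}6&\frac{q^2-\xi q}2&\frac{q^2+\xi q+1}3\end{pmatrix},$$ $$(r_{ij})=\begin{pmatrix}1&2&3&1&0\\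 2q&2q-1&q-2&q&q+1\\ \frac{q^2-q}2&\frac{q^2-3q+2}6&\frac{q^2+\xi q+4}6&\frac{q^2-\xi q}6&\frac{q^2+\xi q-2}6\\ \frac{q^2-q}2&\frac{q^2-q}2&\frac{q^2-\xi q}2&\frac{q^2+\xi q}2&\frac{q^2-\xi q}2\\ 0&\frac{q^2-1}3&\frac{q^2+\xi q-2}3&\frac{q^2-\xi q}3&\frac{q^2+\xi q+1}3\end{pmatrix}.$$ For $\xi=0$: $$(k_{ij})=\begin{pmatrix}1&q+1&q-1&\frac{q^2-q}2&\frac{q^2-q}2\\ 2&1&2q-2&\frac{q^2-q}2&\frac{q^2-q}2\\ 3&1&q-3&\frac{q^2+q}2&\frac{q^2-q}2\\ 1&1&q-1&\frac{q^2-q}2&\frac{q^2+q}2\\ 0&1&q&\frac{q^2+q}2&\frac{q^2-q}2\end{pmatrix},\qquad (r_{ij})=\begin{pmatrix}1&q+1&1&1&1\\ 2q&q&2q&q&q\\ \frac{q^2-q}2&\frac{q^2-q}6&\frac{q^2-3q}6&\frac{q^2+q}6&\frac{q^2-q}6\\ \frac{q^2-q}2&\frac{q^2-q}2&\frac{q^2-q}2&\frac{q^2-q}2&\frac{q^2+q}2\\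 0&\frac{q^2-q}3&\frac{q^2}3&\frac{q^2+q}3&\frac{q^2-q}3\end{pmatrix}.$$ (ii) Up to rearrangement of rows and columns: if $\xi\ne0$, then $\mathcal I_{ij}^{tr}=\mathcal I_{ji}$, $k_{ij}=r_{ji}$ and $r_{ij}=k_{ji}$ for all $i,j$; if $\xi=0$, then $\mathcal I_{41}^{tr}=\mathcal I_{14}$, $\mathcal I_{41}^{tr}=\mathcal I_{15}$, $\mathcal I_{42}^{tr}=\mathcal I_{14}$, $\mathcal I_{42}^{tr}=\mathcal I_{15}$. Moreover, for each $i=1,\dots,5$, the numbers of rows and columns of $\mathcal I_{i4}$ and its parameters $k_{i4},r_{i4}$ for $\xi=1$ are given by the same polynomials in $q$ as the corresponding numbers of $\mathcal I_{i5}$ for $\xi=0$; and those of $\mathcal I_{i4}$ for $\xi=-1$ are given by the same polynomials in $q$ as those of $\mathcal I_{i4}$ for $\xi=0$. (iii) With columns as points and rows as blocks (repeated blocks allowed), $\mathcal I_{21}$ is a $2$-$(q+1,2,2)$ design, and $\mathcal I_{31}$ is both a $3$-$(q+1,3,1)$ design and a $2$-$(q+1,3,q-1)$ design. Here a $t$-$(v,k,\lambda)$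 design has $v$ points, blocks of $k$ points, and every $t$-set of points lies in exactly $\lambda$ blocks. -/

import Mathlib

open scoped LinearAlgebra.Projectivization Pointwise Matrix

universe u

namespace TwistedCubic

noncomputable section

/-- The points of `PG(3,q)`, where `q` is the cardinality of `F`. -/
abbrev Pt (F : Type u) [Field F] : Type u := ℙ F (Fin 4 → F)

/-- The set of points of the plane with equation `c₀ x₀ + c₁ x₁ + c₂ x₂ + c₃ x₃ = 0`
(the condition does not depend on the representative of the point). -/
def plane {F : Type u} [Field F] (c : Fin 4 → F) : Set (Pt F) :=
  {P | c ⬝ᵥ P.rep = 0}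

/-- Planes of `PG(3,q)`, regarded as sets of points. -/
def IsPlane {F : Type u} [Field F] (π : Set (Pt F)) : Prop :=
  ∃ c : Fin 4 → F, c ≠ 0 ∧ π = plane c

/-- The set of points of `PG(3,q)` on the join of the vectors `v` and `w`. It is a line when `v` and
`w` are linearly independent. -/
def join {F : Type u} [Field F] (v w : Fin 4 → F) : Set (Pt F) :=
  {P | P.rep ∈ Submodule.span F {v, w}}

/-- The coordinate vector `(t³, t², t, 1)`. -/
def affineVec {K : Type u} [Field K] (t : K) : Fin 4 → K := ![t ^ 3, t ^ 2, t, 1]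

/-- Coordinates of `P(t)` for `t ∈ F ∪ {∞}`; `P(∞) = (1, 0, 0, 0)`. -/
def cubicVec {F : Type u} [Field F] : OnePoint F → Fin 4 → F
  | OnePoint.infty => ![1, 0, 0, 0]
  | OnePoint.some t => affineVec t

theorem cubicVec_ne_zero {F : Type u} [Field F] (t : OnePoint F) : cubicVec t ≠ 0 := by
  intro h
  cases t with
  | infty => simpa [cubicVec] using congrFun h 0
  | coe t => simpa [cubicVec, affineVec] using congrFun h 3

/-- The point `P(t)` of the twisted cubic. -/
def cubicPt {F : Type u} [Field F] (t : OnePoint F) : Pt F :=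
  Projectivization.mk F (cubicVec t) (cubicVec_ne_zero t)

/-- The twisted cubic. -/
def cubic (F : Type u) [Field F] : Set (Pt F) := Set.range cubicPt

/-- The group of projectivities of `PG(3,q)` fixing the twisted cubic (as a set). -/
def cubicGroup (F : Type u) [Field F] : Subgroup (Matrix.ProjGenLinGroup (Fin 4) F) :=
  MulAction.stabilizer (Matrix.ProjGenLinGroup (Fin 4) F) (cubic F)

/-- The osculating plane at `P(t)`. -/
def oscPlane {F : Type u} [Field F] : OnePoint F → Set (Pt F)
  | OnePoint.infty => plane ![0, 0, 0, 1]
  | OnePoint.some t => plane ![1, -3 * t, 3 * t ^ 2, -t ^ 3]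

/-- The osculating developable: the set of all osculating planes. -/
def developable (F : Type u) [Field F] : Set (Set (Pt F)) := Set.range oscPlane

/-- A tangent direction at `P(t)`: the derivative of `(t³, t², t, 1)` with respect to `t`; at
infinity, where the cubic is `(1, s, s², s³)` near `s = 0`, the derivative with respect to `s`. -/
def tangentVec {F : Type u} [Field F] : OnePoint F → Fin 4 → F
  | OnePoint.infty => ![0, 1, 0, 0]
  | OnePoint.some t => ![3 * t ^ 2, 2 * t, 1, 0]

/-- The tangent line to the cubic at `P(t)`. -/
def tangent {F : Type u} [Field F] (t : OnePoint F) : Set (Pt F) :=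
  join (cubicVec t) (tangentVec t)

/-- The real chord through `P(s)` and `P(t)` (to be used for `s ≠ t`). -/
def realChord {F : Type u} [Field F] (s t : OnePoint F) : Set (Pt F) :=
  join (cubicVec s) (cubicVec t)

/-- The points of `PG(3,q)` on the line joining the points `P(α)` and `P(α^q)` of the
cubic over an extension field (to be used for `α` in `𝔽_{q²}` but not in `𝔽_q`, when `α` and `α^q`
are conjugate). -/
def imaginaryChord {F : Type u} [Field F] (α : AlgebraicClosure F) : Set (Pt F) :=
  {P | (fun i => algebraMap F (AlgebraicClosure F) (P.rep i)) ∈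
    Submodule.span (AlgebraicClosure F) {affineVec α, affineVec (α ^ Nat.card F)}}

/-! ### Classes of planes -/

/-- The planes with exactly `d` points on the cubic. -/
def planesMeeting (F : Type u) [Field F] (d : ℕ) : Set (Set (Pt F)) :=
  {π | IsPlane π ∧ (π ∩ cubic F).ncard = d}

/-- The five classes `N₁, …, N₅` of planes (with indices shifted to start from `0`). -/
def N (F : Type u) [Field F] : Fin 5 → Set (Set (Pt F)) :=
  ![developable F,
    planesMeeting F 2,
    planesMeeting F 3,
    planesMeeting F 1 \ developable F,
    planesMeeting F 0]

/-! ### Classes of points -/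

/-- The points off the cubic that lie on exactly `μ` osculating planes. -/
def gammaPts (F : Type u) [Field F] (μ : ℕ) : Set (Pt F) :=
  {P | P ∉ cubic F ∧ {π ∈ developable F | P ∈ π}.ncard = μ}

/-- The points off the cubic that lie on a tangent. -/
def tangentPts (F : Type u) [Field F] : Set (Pt F) :=
  {P | P ∉ cubic F ∧ ∃ t, P ∈ tangent t}

/-- The points off the cubic that lie on a tangent and on exactly one osculating plane. -/
def toPts (F : Type u) [Field F] : Set (Pt F) := tangentPts F ∩ gammaPts F 1

/-- The points off the cubic that lie on a real chord. -/
def realChordPts (F : Type u) [Field F] : Set (Pt F) :=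
  {P | P ∉ cubic F ∧ ∃ s t, s ≠ t ∧ P ∈ realChord s t}

/-- The points that lie on an imaginary chord. -/
def imaginaryChordPts (F : Type u) [Field F] : Set (Pt F) :=
  {P | ∃ α : AlgebraicClosure F,
    α ^ (Nat.card F ^ 2) = α ∧ α ∉ Set.range (algebraMap F (AlgebraicClosure F)) ∧
      P ∈ imaginaryChord α}

/-- The five classes `M₁, …, M₅` of points (with indices shifted to start from `0`). -/
def M (F : Type u) [Field F] : Fin 5 → Set (Pt F) :=
  if Nat.card F % 3 = 0 then
    ![cubic F, gammaPts F (Nat.card F + 1), toPts F, realChordPts F, imaginaryChordPts F]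
  else
    ![cubic F, tangentPts F, gammaPts F 3, gammaPts F 1, gammaPts F 0]

/-! ### Incidence matrices -/

open Classical in
/-- The submatrix `I_{ij}` of the point-plane incidence matrix: rows are indexed by the planes of
`N_i`, columns by the points of `M_j`. -/
def block (F : Type u) [Field F] (i j : Fin 5) : Matrix (N F i) (M F j) ℕ :=
  Matrix.of fun π P => if (P : Pt F) ∈ (π : Set (Pt F)) then 1 else 0

/-- The number of ones in the row `a`. -/
def rowOnes {m n : Type*} (A : Matrix m n ℕ) (a : m) : ℕ := {b | A a b = 1}.ncard

/-- The number of ones in the column `b`. -/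
def colOnes {m n : Type*} (A : Matrix m n ℕ) (b : n) : ℕ := {a | A a b = 1}.ncard

/-- A zero-one matrix is a tactical configuration with parameters `k`, `r` if it has `k` ones in
each row and `r` ones in each column. -/
def IsTactical {m n : Type*} (A : Matrix m n ℕ) (k r : ℕ) : Prop :=
  (∀ a b, A a b = 0 ∨ A a b = 1) ∧ (∀ a, rowOnes A a = k) ∧ (∀ b, colOnes A b = r)

/-- Two matrices agree up to rearrangement of rows and columns. -/
def SameUpToRearrangement {m n m' n' : Type*} (A : Matrix m n ℕ) (B : Matrix m' n' ℕ) : Prop :=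
  ∃ (e : m ≃ m') (f : n ≃ n'), Matrix.reindex e f A = B

/-- The zero-one matrix `A` is the incidence matrix of a `t-(v,k,l)` design (repeated blocks
allowed) with one design point for each column and one design block for each row. -/
def IsDesign {m n : Type*} (A : Matrix m n ℕ) (t v k l : ℕ) : Prop :=
  (∀ a b, A a b = 0 ∨ A a b = 1) ∧ Nat.card n = v ∧ (∀ a, rowOnes A a = k) ∧
    ∀ T : Finset n, T.card = t → {a | ∀ b ∈ T, A a b = 1}.ncard = l

/-- `A` is a tactical configuration whose size and parameters are the values at `q` of the
polynomials `a` (number of rows), `b` (number of columns), `k` (ones in each row) and `r` (ones in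
each column). -/
def HasPolyParameters {m n : Type*} (A : Matrix m n ℕ) (q : ℕ) (a b k r : Polynomial ℚ) : Prop :=
  (Nat.card m : ℚ) = a.eval (q : ℚ) ∧ (Nat.card n : ℚ) = b.eval (q : ℚ) ∧
    ∃ k₀ r₀ : ℕ, IsTactical A k₀ r₀ ∧ (k₀ : ℚ) = k.eval (q : ℚ) ∧ (r₀ : ℚ) = r.eval (q : ℚ)

/-! ### The tables -/

/-- The sizes of `N₁, …, N₅`. -/
def sizeN (q : ℚ) : Fin 5 → ℚ :=
  ![q + 1, q ^ 2 + q, (q ^ 3 - q) / 6, (q ^ 3 - q) / 2, (q ^ 3 - q) / 3]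

/-- The sizes of `M₁, …, M₅` for `q ≡ ξ (mod 3)`. -/
def sizeM (q : ℚ) (ξ : ℤ) : Fin 5 → ℚ :=
  if ξ = 0 then
    ![q + 1, q + 1, q ^ 2 - 1, (q ^ 3 - q) / 2, (q ^ 3 - q) / 2]
  else
    ![q + 1, q ^ 2 + q, (q ^ 3 - q) / 6, (q ^ 3 - q) / 2, (q ^ 3 - q) / 3]

/-- The tabulated number of ones in every row of `I_{ij}`, for `q ≡ ξ (mod 3)`. -/
def tableK (q : ℚ) (ξ : ℤ) : Matrix (Fin 5) (Fin 5) ℚ :=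
  if ξ = 0 then
    !![1, q + 1, q - 1, (q ^ 2 - q) / 2, (q ^ 2 - q) / 2;
       2, 1, 2 * q - 2, (q ^ 2 - q) / 2, (q ^ 2 - q) / 2;
       3, 1, q - 3, (q ^ 2 + q) / 2, (q ^ 2 - q) / 2;
       1, 1, q - 1, (q ^ 2 - q) / 2, (q ^ 2 + q) / 2;
       0, 1, q, (q ^ 2 + q) / 2, (q ^ 2 - q) / 2]
  else
    !![1, 2 * q, (q ^ 2 - q) / 2, (q ^ 2 - q) / 2, 0;
       2, 2 * q - 1, (q ^ 2 - 3 * q + 2) / 6, (q ^ 2 - q) / 2, (q ^ 2 - 1) / 3;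
       3, q - 2, (q ^ 2 + ξ * q + 4) / 6, (q ^ 2 - ξ * q) / 2, (q ^ 2 + ξ * q - 2) / 3;
       1, q, (q ^ 2 - ξ * q) / 6, (q ^ 2 + ξ * q) / 2, (q ^ 2 - ξ * q) / 3;
       0, q + 1, (q ^ 2 + ξ * q - 2) / 6, (q ^ 2 - ξ * q) / 2, (q ^ 2 + ξ * q + 1) / 3]

/-- The tabulated number of ones in every column of `I_{ij}`, for `q ≡ ξ (mod 3)`. -/
def tableR (q : ℚ) (ξ : ℤ) : Matrix (Fin 5) (Fin 5) ℚ :=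
  if ξ = 0 then
    !![1, q + 1, 1, 1, 1;
       2 * q, q, 2 * q, q, q;
       (q ^ 2 - q) / 2, (q ^ 2 - q) / 6, (q ^ 2 - 3 * q) / 6, (q ^ 2 + q) / 6, (q ^ 2 - q) / 6;
       (q ^ 2 - q) / 2, (q ^ 2 - q) / 2, (q ^ 2 - q) / 2, (q ^ 2 - q) / 2, (q ^ 2 + q) / 2;
       0, (q ^ 2 - q) / 3, q ^ 2 / 3, (q ^ 2 + q) / 3, (q ^ 2 - q) / 3]
  else
    !![1, 2, 3, 1, 0;
       2 * q, 2 * q - 1, q - 2, q, q + 1;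
       (q ^ 2 - q) / 2, (q ^ 2 - 3 * q + 2) / 6, (q ^ 2 + ξ * q + 4) / 6, (q ^ 2 - ξ * q) / 6,
         (q ^ 2 + ξ * q - 2) / 6;
       (q ^ 2 - q) / 2, (q ^ 2 - q) / 2, (q ^ 2 - ξ * q) / 2, (q ^ 2 + ξ * q) / 2,
         (q ^ 2 - ξ * q) / 2;
       0, (q ^ 2 - 1) / 3, (q ^ 2 + ξ * q - 2) / 3, (q ^ 2 - ξ * q) / 3, (q ^ 2 + ξ * q + 1) / 3]

end

end TwistedCubic

open TwistedCubic

/-!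
The planes of `PG(3,q)` correspond to the binary cubic forms up to scalars: the plane with the
coordinates `c` contains the point of the cubic with the homogeneous parameter `(x, y)` exactly when
`c 0 x³ + c 1 x² y + c 2 x y² + c 3 y³ = 0`. A projectivity of the parameter line acts on the space
through the symmetric cube (`sym3`, `moebius`), and for `q ≥ 5` every projectivity which fixes the
cubic arises in this way (`exists_moebius_eq`): once `P(∞)` and `P(0)` are fixed, the equations of
the cubic become polynomials in the parameter with more zeros than their degree allows, which forces
the matrix to be diagonal. So the orbits on planes are the classes of binary cubic forms under
fractional linear substitutions (`conj_of_mem_N`). If a form has all its roots in the field, triple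
transitivity on the projective line brings it to `y³`, `x y²` or `x² y - x y²`. The forms with an
irreducible factor of degree two or three are treated by `exists_vecMul_sym3_eq_smul`: two such
factors of the same degree have roots in the same extension, and for reasons of dimension one root
is a fractional linear function of the other. Any `k ≤ 4` points of the cubic are independent, which
gives the factorial moments of the number of roots (`sum_descFactorial_numCubic`) and from them the
sizes of the classes (`card_N`).

For `q` prime to three the cubic determines a null polarity which maps `P(t)` to the osculating
plane at `P(t)` and commutes with the group. It exchanges points and planes, and it maps the five
classes of points to the five classes of planes (`mem_M_iff`). This carries over the orbits and the
sizes, and it shows that the block `(j, i)` is the transpose of the block `(i, j)`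
(`sameUpToRearrangement_block`). In characteristic three all osculating planes contain a common line
(`axis`), and the orbits on points are found from normal forms instead (`conj_of_mem_M_of_eq`); the
points which lie neither on the cubic nor on a tangent or real chord are `(1, 0, y, 0)` with a
nonsquare `y`, up to the group, and these are the points of the imaginary chords
(`mem_imaginaryChordPts_iff`).

The row sums of the blocks are the intersection numbers of a plane with the classes of points. They
are determined by linear equations: the total number of points of the plane, its points on the
cubic, on the tangents (`ncard_inter_tangentPts`) and on the real chords
(`ncard_inter_realChordPts`), and its incidences with the osculating planes (`sum_numOsc`), in
characteristic three its points on the axis (`ncard_inter_M_of_ne`, `ncard_inter_M_of_eq`). The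
column sums are constant by transitivity and follow by double counting (`exists_isTactical`). The
transposes in characteristic three concern matrices with a single one in each column and constant
row sums, and such matrices are determined up to rearrangement by their sizes
(`sameUpToRearrangement_of_isTactical_one`). The designs come from the fact that three points of the
cubic span a plane, while two of them lie on `q + 1` planes.
-/


namespace TwistedCubic

/-! ### Binary cubic forms and the points of the cubic -/

section Coordinates

variable {R : Type*} [CommRing R]

/-- The bracket of two vectors of `R²`; it vanishes exactly when they are proportional. -/
def bracket (p q : R × R) : R := p.2 * q.1 - p.1 * q.2

/-- The point `(x³, x²y, xy², y³)` of the cubic with homogeneous parameter `(x, y)`. -/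
def ver (p : R × R) : Fin 4 → R := ![p.1 ^ 3, p.1 ^ 2 * p.2, p.1 * p.2 ^ 2, p.2 ^ 3]

/-- The derivative of `ver` at `p` in the direction `w`. -/
def tan (p w : R × R) : Fin 4 → R :=
  ![3 * p.1 ^ 2 * w.1, 2 * p.1 * p.2 * w.1 + p.1 ^ 2 * w.2,
    p.2 ^ 2 * w.1 + 2 * p.1 * p.2 * w.2, 3 * p.2 ^ 2 * w.2]

/-- The coefficients of the binary cubic form with the roots `p`, `q`, `r`, that is, the coordinates
of the plane which meets the cubic in these three points (counted with multiplicity). -/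
def form3 (p q r : R × R) : Fin 4 → R :=
  ![p.2 * q.2 * r.2, -(p.1 * q.2 * r.2 + p.2 * q.1 * r.2 + p.2 * q.2 * r.1),
    p.1 * q.1 * r.2 + p.1 * q.2 * r.1 + p.2 * q.1 * r.1, -(p.1 * q.1 * r.1)]

theorem dot_four (v w : Fin 4 → R) :
    v ⬝ᵥ w = v 0 * w 0 + v 1 * w 1 + v 2 * w 2 + v 3 * w 3 := by
  simp [dotProduct, Fin.sum_univ_four]

theorem form3_dot_ver (p q r x : R × R) :
    form3 p q r ⬝ᵥ ver x = bracket p x * bracket q x * bracket r x := by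
  simp [form3, ver, bracket]; ring

theorem form3_dot_tan (p q r x w : R × R) :
    form3 p q r ⬝ᵥ tan x w = bracket p w * bracket q x * bracket r x +
      bracket p x * bracket q w * bracket r x + bracket p x * bracket q x * bracket r w := by
  simp [form3, tan, bracket]; ring

end Coordinates

section Parameters

variable {F : Type*} [Field F]

/-- Homogeneous coordinates of a point of the projective line. -/
def hom : OnePoint F → F × F
  | OnePoint.infty => (1, 0)
  | OnePoint.some t => (t, 1)

/-- A vector which forms a basis of `F²` together with `hom t`. -/
def hom' : OnePoint F → F × F
  | OnePoint.infty => (0, 1)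
  | OnePoint.some _ => (1, 0)

@[simp] theorem hom_infty : hom (OnePoint.infty : OnePoint F) = (1, 0) := rfl
@[simp] theorem hom_coe (t : F) : hom (t : OnePoint F) = (t, 1) := rfl
@[simp] theorem hom'_infty : hom' (OnePoint.infty : OnePoint F) = (0, 1) := rfl
@[simp] theorem hom'_coe (t : F) : hom' (t : OnePoint F) = (1, 0) := rfl

theorem bracket_hom_eq_zero {s t : OnePoint F} : bracket (hom s) (hom t) = 0 ↔ s = t := by
  cases s <;> cases t <;> simp [bracket, sub_eq_zero, eq_comm]

theorem bracket_hom_ne_zero {s t : OnePoint F} (h : s ≠ t) : bracket (hom s) (hom t) ≠ 0 :=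
  mt bracket_hom_eq_zero.1 h

theorem bracket_hom_self (s : OnePoint F) : bracket (hom s) (hom s) = 0 :=
  bracket_hom_eq_zero.2 rfl

theorem bracket_hom_hom' (s : OnePoint F) : bracket (hom s) (hom' s) ≠ 0 := by
  cases s <;> simp [bracket]

theorem hom_ne_zero (t : OnePoint F) : hom t ≠ 0 := by
  cases t <;> simp [Prod.ext_iff]

theorem exists_eq_smul_hom {p : F × F} (hp : p ≠ 0) :
    ∃ (a : F) (t : OnePoint F), a ≠ 0 ∧ p = a • hom t := by
  obtain ⟨x, y⟩ := p
  by_cases hy : y = 0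
  · refine ⟨x, OnePoint.infty, ?_, ?_⟩
    · rintro rfl; exact hp (by simp [hy])
    · simp [hy]
  · refine ⟨y, ((x / y : F) : OnePoint F), hy, ?_⟩
    simp; field_simp

theorem cubicVec_eq (t : OnePoint F) : cubicVec t = ver (hom t) := by
  cases t <;> simp [cubicVec, affineVec, ver]

theorem tangentVec_eq (t : OnePoint F) : tangentVec t = tan (hom t) (hom' t) := by
  cases t <;> simp [tangentVec, tan]

theorem affineVec_eq (t : F) : affineVec t = ver (t, 1) := by
  simp [affineVec, ver]

theorem form3_dot_cubicVec (p q r x : OnePoint F) : form3 (hom p) (hom q) (hom r) ⬝ᵥ cubicVec x =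
    bracket (hom p) (hom x) * bracket (hom q) (hom x) * bracket (hom r) (hom x) := by
  rw [cubicVec_eq, form3_dot_ver]

theorem form3_dot_cubicVec_eq_zero {p q r x : OnePoint F} :
    form3 (hom p) (hom q) (hom r) ⬝ᵥ cubicVec x = 0 ↔ p = x ∨ q = x ∨ r = x := by
  rw [form3_dot_cubicVec]; simp [bracket_hom_eq_zero, or_assoc]

theorem form3_dot_tangentVec (p r : OnePoint F) :
    form3 (hom p) (hom p) (hom r) ⬝ᵥ tangentVec p = 0 := by
  rw [tangentVec_eq, form3_dot_tan, bracket_hom_self]; ring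

theorem form3_dot_tangentVec_single {p r x : OnePoint F} (h : r ≠ x) (h' : p ≠ x) :
    form3 (hom x) (hom p) (hom r) ⬝ᵥ tangentVec x ≠ 0 := by
  rw [tangentVec_eq, form3_dot_tan, bracket_hom_self]
  simp [bracket_hom_hom', bracket_hom_ne_zero h, bracket_hom_ne_zero h']

theorem form3_ne_zero (p q r : OnePoint F) : form3 (hom p) (hom q) (hom r) ≠ 0 := by
  intro h
  have h0 := congrFun h 0
  have h1 := congrFun h 1
  have h2 := congrFun h 2
  have h3 := congrFun h 3
  cases p <;> cases q <;> cases r <;> simp [form3] at h0 h1 h2 h3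

end Parameters

theorem card_onePoint (X : Type*) [Finite X] : Nat.card (OnePoint X) = Nat.card X + 1 :=
  Finite.card_option

/-! ### Points, planes and joins in coordinates -/

section Membership

variable {F : Type*} [Field F]

theorem mem_plane {c : Fin 4 → F} {P : Pt F} : P ∈ plane c ↔ c ⬝ᵥ P.rep = 0 := Iff.rfl

theorem exists_smul_rep {v : Fin 4 → F} (hv : v ≠ 0) :
    ∃ a : F, a ≠ 0 ∧ v = a • (Projectivization.mk F v hv).rep := by
  obtain ⟨a, ha⟩ := Projectivization.exists_smul_eq_mk_rep F v hv
  refine ⟨(a⁻¹ : Fˣ), by simp, ?_⟩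
  rw [← ha]; simp [Units.smul_def, smul_smul]

/-- Incidence with a plane may be tested on any coordinate vector of the point, although `plane` is
defined through the chosen representative. -/
theorem mk_mem_plane {c v : Fin 4 → F} (hv : v ≠ 0) :
    Projectivization.mk F v hv ∈ plane c ↔ c ⬝ᵥ v = 0 := by
  obtain ⟨a, ha, h⟩ := exists_smul_rep hv
  rw [mem_plane]
  conv_rhs => rw [h]
  simp [ha]

theorem mk_mem_join {u w v : Fin 4 → F} (hv : v ≠ 0) :
    Projectivization.mk F v hv ∈ join u w ↔ v ∈ Submodule.span F {u, w} := by
  obtain ⟨a, ha, h⟩ := exists_smul_rep hv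
  conv_rhs => rw [h]
  exact (Submodule.smul_mem_iff (Submodule.span F {u, w}) ha).symm

theorem plane_smul {a : F} (ha : a ≠ 0) (c : Fin 4 → F) : plane (a • c) = plane c := by
  ext P; simp [mem_plane, ha]

theorem cubicPt_mem_plane {c : Fin 4 → F} {t : OnePoint F} :
    cubicPt t ∈ plane c ↔ c ⬝ᵥ cubicVec t = 0 := mk_mem_plane _

theorem cubicPt_mem_join {u w : Fin 4 → F} {t : OnePoint F} :
    cubicPt t ∈ join u w ↔ cubicVec t ∈ Submodule.span F {u, w} := mk_mem_join _

theorem oscPlane_eq (t : OnePoint F) : oscPlane t = plane (form3 (hom t) (hom t) (hom t)) := by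
  cases t with
  | infty =>
    rw [← plane_smul (a := -1) (by simp)]; simp [oscPlane, form3]
  | coe t =>
    have : form3 ((t, 1) : F × F) (t, 1) (t, 1) = ![1, -3 * t, 3 * t ^ 2, -t ^ 3] := by
      ext i; fin_cases i <;> simp [form3] <;> ring
    rw [hom_coe, this]; rfl

theorem cubicPt_mem_oscPlane {s t : OnePoint F} : cubicPt s ∈ oscPlane t ↔ t = s := by
  rw [oscPlane_eq, cubicPt_mem_plane, form3_dot_cubicVec_eq_zero]; simp

instance [Finite F] : Finite (OnePoint F) := inferInstanceAs (Finite (Option F))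

theorem oscPlane_injective : Function.Injective (oscPlane : OnePoint F → Set (Pt F)) :=
  fun s t h ↦ (cubicPt_mem_oscPlane.1 (h ▸ cubicPt_mem_oscPlane.2 rfl :
    cubicPt s ∈ oscPlane t)).symm

theorem cubicPt_injective : Function.Injective (cubicPt : OnePoint F → Pt F) :=
  fun s t h ↦ (cubicPt_mem_oscPlane.1 (h ▸ cubicPt_mem_oscPlane.2 rfl :
    cubicPt t ∈ oscPlane s))

theorem isPlane_oscPlane (t : OnePoint F) : IsPlane (oscPlane t) :=
  ⟨_, form3_ne_zero t t t, oscPlane_eq t⟩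

end Membership

/-! ### Counting the points of subspaces -/

section Counting

variable {F : Type*} [Field F]

/-- The points of a projective subspace of dimension `n - 1` are `1 + q + ⋯ + q ^ (n - 1)`. -/
theorem ncard_rep_mem [Finite F] (S : Submodule F (Fin 4 → F)) :
    {P : Pt F | P.rep ∈ S}.ncard =
      ∑ i ∈ Finset.range (Module.finrank F S), Nat.card F ^ i := by
  rw [← Projectivization.card_of_finrank F S rfl, ← Nat.card_coe_set_eq]
  refine (Nat.card_congr (Equiv.ofBijective
    (fun P : ℙ F S ↦ (⟨P.map S.subtype S.injective_subtype, ?_⟩ : {P : Pt F | P.rep ∈ S}))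
    ⟨?_, ?_⟩)).symm
  · induction P using Projectivization.ind with | h v hv =>
    have hv' : S.subtype v ≠ 0 := by simpa using hv
    obtain ⟨a, ha, h⟩ := exists_smul_rep hv'
    rw [Set.mem_ofPred_eq, Projectivization.map_mk, ← Submodule.smul_mem_iff S ha, ← h]
    exact v.2
  · intro P Q h
    exact Projectivization.map_injective _ _ (by simpa using h)
  · rintro ⟨P, hP⟩
    refine ⟨Projectivization.mk F ⟨P.rep, hP⟩ ?_, ?_⟩
    · simpa using P.rep_nonzero
    · simp [Projectivization.map_mk]

/-- Independent linear equations cut the number of points down as expected. -/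
theorem ncard_forall_dot_eq_zero [Finite F] {n : ℕ} {c : Fin n → Fin 4 → F}
    (hc : LinearIndependent F c) :
    {P : Pt F | ∀ i, c i ⬝ᵥ P.rep = 0}.ncard = ∑ i ∈ Finset.range (4 - n), Nat.card F ^ i := by
  have h := LinearMap.finrank_range_add_finrank_ker (Matrix.mulVecLin (Matrix.of c))
  have h2 : Module.finrank F (LinearMap.range (Matrix.mulVecLin (Matrix.of c))) = n := by
    have := LinearIndependent.rank_matrix (M := Matrix.of c) hc
    simpa [Matrix.rank] using this
  have h3 : Module.finrank F (LinearMap.ker (Matrix.mulVecLin (Matrix.of c))) = 4 - n := by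
    rw [h2] at h; simp at h; omega
  rw [← h3, ← ncard_rep_mem]
  congr 1; ext P
  simp [funext_iff, Matrix.mulVec]

theorem linearIndependent_of_dot {n : ℕ} {v f : Fin n → Fin 4 → F}
    (h0 : ∀ i j, i ≠ j → f i ⬝ᵥ v j = 0) (h1 : ∀ i, f i ⬝ᵥ v i ≠ 0) :
    LinearIndependent F v := by
  rw [Fintype.linearIndependent_iff]
  intro g hg i
  have h := congrArg (f i ⬝ᵥ ·) hg
  simp only [dotProduct_sum, dotProduct_smul, dotProduct_zero] at h
  rw [Finset.sum_eq_single i (fun j _ hj ↦ by simp [h0 i j hj.symm]) (by simp)] at h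
  simpa [h1 i] using h

theorem linearIndependent_cubicVec_one (t : OnePoint F) :
    LinearIndependent F ![cubicVec t] := by
  simpa using cubicVec_ne_zero t

theorem linearIndependent_cubicVec_two {r s : OnePoint F} (h : r ≠ s) :
    LinearIndependent F ![cubicVec r, cubicVec s] := by
  refine linearIndependent_of_dot (f := ![form3 (hom s) (hom s) (hom s),
    form3 (hom r) (hom r) (hom r)]) ?_ ?_
  · intro i j hij
    fin_cases i <;> fin_cases j <;> simp_all [form3_dot_cubicVec_eq_zero]
  · intro i
    fin_cases i <;> simp [form3_dot_cubicVec_eq_zero, h, h.symm]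

theorem linearIndependent_cubicVec_three {r s t : OnePoint F} (h : r ≠ s) (h' : r ≠ t)
    (h'' : s ≠ t) : LinearIndependent F ![cubicVec r, cubicVec s, cubicVec t] := by
  refine linearIndependent_of_dot (f := ![form3 (hom s) (hom t) (hom t),
    form3 (hom r) (hom t) (hom t), form3 (hom r) (hom s) (hom s)]) ?_ ?_
  · intro i j hij
    fin_cases i <;> fin_cases j <;> simp_all [form3_dot_cubicVec_eq_zero]
  · intro i
    fin_cases i <;> simp [form3_dot_cubicVec_eq_zero, h, h.symm, h', h'.symm, h'', h''.symm]

theorem linearIndependent_cubicVec_four {r : Fin 4 → OnePoint F} (hr : Function.Injective r) :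
    LinearIndependent F (fun i ↦ cubicVec (r i)) := by
  refine linearIndependent_of_dot
    (f := fun i ↦ form3 (hom (r (i + 1))) (hom (r (i + 2))) (hom (r (i + 3)))) ?_ ?_
  · intro i j hij
    rw [form3_dot_cubicVec_eq_zero, hr.eq_iff, hr.eq_iff, hr.eq_iff]
    revert i j; decide
  · intro i
    rw [Ne, form3_dot_cubicVec_eq_zero, hr.eq_iff, hr.eq_iff, hr.eq_iff]
    revert i; decide

theorem linearIndependent_tangent (t : OnePoint F) :
    LinearIndependent F ![cubicVec t, tangentVec t] := by
  obtain ⟨s, hs⟩ : ∃ s : OnePoint F, s ≠ t := by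
    cases t with
    | infty => exact ⟨((0 : F) : OnePoint F), OnePoint.coe_ne_infty 0⟩
    | coe t => exact ⟨OnePoint.infty, OnePoint.infty_ne_coe t⟩
  rw [LinearIndependent.pair_iff]
  intro a b h
  have hb : b = 0 := by
    have := congrArg (form3 (hom t) (hom s) (hom s) ⬝ᵥ ·) h
    simpa [dotProduct_add, form3_dot_tangentVec_single hs hs,
      form3_dot_cubicVec_eq_zero.2 (Or.inl (rfl : t = t))] using this
  exact ⟨by simpa [hb, cubicVec_ne_zero] using h, hb⟩

/-- A nonzero binary cubic form has at most three roots. -/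
theorem ncard_roots_le [Finite F] {c : Fin 4 → F} (hc : c ≠ 0) :
    {t : OnePoint F | c ⬝ᵥ cubicVec t = 0}.ncard ≤ 3 := by
  by_contra! h
  obtain ⟨S, hS, hS4⟩ := Set.exists_subset_card_eq (Nat.succ_le_of_lt h)
  have e : Fin 4 ≃ S := (Finite.equivFinOfCardEq hS4).symm
  have hli := linearIndependent_cubicVec_four (r := fun i ↦ (e i : OnePoint F))
    (Subtype.val_injective.comp e.injective)
  have hu := Matrix.mulVec_injective_iff_isUnit.2
    (Matrix.linearIndependent_rows_iff_isUnit.1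
      (show LinearIndependent F (Matrix.of fun i ↦ cubicVec (e i : OnePoint F)).row from hli))
  refine hc (hu (funext fun i ↦ ?_))
  rw [Matrix.mulVec_zero]
  exact (dotProduct_comm _ _).trans (hS (e i).2)

end Counting

/-! ### The symmetric cube of a two-dimensional matrix -/

section SymmetricCube

variable {R : Type*} [CommRing R]

/-- The action of a matrix on the homogeneous parameter. -/
def act (g : Matrix (Fin 2) (Fin 2) R) (p : R × R) : R × R :=
  (g 0 0 * p.1 + g 0 1 * p.2, g 1 0 * p.1 + g 1 1 * p.2)

/-- The symmetric cube of a `2 × 2` matrix, in the coordinates in which it maps `ver p` to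
`ver (act g p)`. -/
def sym3 : Matrix (Fin 2) (Fin 2) R →* Matrix (Fin 4) (Fin 4) R where
  toFun g :=
    let a := g 0 0; let b := g 0 1; let c := g 1 0; let d := g 1 1
    !![a ^ 3, 3 * a ^ 2 * b, 3 * a * b ^ 2, b ^ 3;
       a ^ 2 * c, a ^ 2 * d + 2 * a * b * c, 2 * a * b * d + b ^ 2 * c, b ^ 2 * d;
       a * c ^ 2, 2 * a * c * d + b * c ^ 2, a * d ^ 2 + 2 * b * c * d, b * d ^ 2;
       c ^ 3, 3 * c ^ 2 * d, 3 * c * d ^ 2, d ^ 3]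
  map_one' := by
    ext i j; fin_cases i <;> fin_cases j <;> simp
  map_mul' g h := by
    ext i j; fin_cases i <;> fin_cases j <;>
      simp [Matrix.mul_apply, Fin.sum_univ_succ] <;> ring

theorem sym3_mulVec_ver (g : Matrix (Fin 2) (Fin 2) R) (p : R × R) :
    sym3 g *ᵥ ver p = ver (act g p) := by
  ext i; fin_cases i <;> simp [sym3, ver, act, Matrix.mulVec] <;> ring

theorem sym3_mulVec_tan (g : Matrix (Fin 2) (Fin 2) R) (p w : R × R) :
    sym3 g *ᵥ tan p w = tan (act g p) (act g w) := by
  ext i; fin_cases i <;> simp [sym3, tan, act, Matrix.mulVec] <;> ring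

/-- The symmetric cube transports the plane with the roots `p`, `q`, `r` to the one with the roots
`act g p`, `act g q`, `act g r`. -/
theorem form3_vecMul_sym3 (g : Matrix (Fin 2) (Fin 2) R) (p q r : R × R) :
    form3 (act g p) (act g q) (act g r) ᵥ* sym3 g = g.det ^ 3 • form3 p q r := by
  ext i; fin_cases i <;>
    simp [sym3, form3, act, Matrix.vecMul, Matrix.det_fin_two] <;> ring

theorem bracket_act (g : Matrix (Fin 2) (Fin 2) R) (p w : R × R) :
    bracket (act g p) (act g w) = g.det * bracket p w := by
  simp [bracket, act, Matrix.det_fin_two]; ring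

theorem act_mul (g h : Matrix (Fin 2) (Fin 2) R) (p : R × R) :
    act (g * h) p = act g (act h p) := by
  simp [act, Matrix.mul_apply]; constructor <;> ring

theorem ver_smul (a : R) (p : R × R) : ver (a • p) = a ^ 3 • ver p := by
  ext i; fin_cases i <;> simp [ver] <;> ring

theorem form3_smul (a b c : R) (p q r : R × R) :
    form3 (a • p) (b • q) (c • r) = (a * b * c) • form3 p q r := by
  ext i; fin_cases i <;> simp [form3] <;> ring

/-- Changing the basis `p`, `w` of `R²` changes the tangent vector only by a multiple of the point
of the cubic, by Euler's identity `tan p p = 3 • ver p`; so the tangent does not depend on `w`. -/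
theorem tan_combination (a b c : R) (p w : R × R) :
    tan (a • p) (b • p + c • w) = (a ^ 2 * b * 3) • ver p + (a ^ 2 * c) • tan p w := by
  ext i; fin_cases i <;> simp [ver, tan] <;> ring

end SymmetricCube

/-! ### The action of the projectivities of the parameter line -/

section Moebius

variable {F : Type*} [Field F]

/-- The projectivity of `PG(3,q)` induced by a projectivity of the parameter line. -/
def moebius : GL (Fin 2) F →* Matrix.ProjGenLinGroup (Fin 4) F :=
  Matrix.ProjGenLinGroup.mk.comp (Units.map sym3)

theorem pgl_smul_mk (A : GL (Fin 4) F) {v : Fin 4 → F} (hv : v ≠ 0) :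
    ∃ h, Matrix.ProjGenLinGroup.mk A • Projectivization.mk F v hv =
      Projectivization.mk F ((A : Matrix (Fin 4) (Fin 4) F) *ᵥ v) h := ⟨_, rfl⟩

theorem moebius_smul_mk (g : GL (Fin 2) F) {v : Fin 4 → F} (hv : v ≠ 0) :
    ∃ h, moebius g • Projectivization.mk F v hv =
      Projectivization.mk F (sym3 (g : Matrix (Fin 2) (Fin 2) F) *ᵥ v) h := ⟨_, rfl⟩

theorem pgl_smul_plane (A : GL (Fin 4) F) (c : Fin 4 → F) :
    Matrix.ProjGenLinGroup.mk A • plane (c ᵥ* (A : Matrix (Fin 4) (Fin 4) F)) = plane c := by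
  rw [← eq_inv_smul_iff]
  ext P
  rw [Set.mem_inv_smul_set_iff]
  induction P using Projectivization.ind with | h v hv =>
  obtain ⟨h, e⟩ := pgl_smul_mk A hv
  rw [e, mk_mem_plane, mk_mem_plane, Matrix.dotProduct_mulVec]

theorem moebius_smul_plane (g : GL (Fin 2) F) (c : Fin 4 → F) :
    moebius g • plane (c ᵥ* sym3 (g : Matrix (Fin 2) (Fin 2) F)) = plane c := by
  have h := pgl_smul_plane (Units.map sym3 g) c
  rwa [Units.coe_map] at h

theorem moebius_smul_join (g : GL (Fin 2) F) (u w : Fin 4 → F) :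
    moebius g • join u w = join (sym3 (g : Matrix (Fin 2) (Fin 2) F) *ᵥ u)
      (sym3 (g : Matrix (Fin 2) (Fin 2) F) *ᵥ w) := by
  rw [← eq_inv_smul_iff]
  ext P
  rw [Set.mem_inv_smul_set_iff]
  induction P using Projectivization.ind with | h v hv =>
  obtain ⟨h, e⟩ := moebius_smul_mk g hv
  have hinj : Function.Injective ((sym3 (g : Matrix (Fin 2) (Fin 2) F)).mulVec) :=
    Matrix.mulVec_injective_of_isUnit (g.isUnit.map sym3)
  rw [e, mk_mem_join, mk_mem_join, Submodule.mem_span_pair, Submodule.mem_span_pair]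
  refine exists_congr fun a ↦ exists_congr fun b ↦ ?_
  rw [← hinj.eq_iff, Matrix.mulVec_add, Matrix.mulVec_smul, Matrix.mulVec_smul]

theorem act_ne_zero (g : GL (Fin 2) F) {p : F × F} (hp : p ≠ 0) :
    act (g : Matrix (Fin 2) (Fin 2) F) p ≠ 0 := by
  intro h
  apply hp
  have : act ((g⁻¹ : GL (Fin 2) F) * g : Matrix (Fin 2) (Fin 2) F) p = 0 := by
    rw [act_mul, h]; simp [act]
  rw [← Units.val_mul, inv_mul_cancel] at this
  simpa [act] using this

/-- The vectors `hom t` and `hom' t` form a basis. -/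
theorem exists_combination (t : OnePoint F) (p : F × F) :
    ∃ a b : F, p = a • hom t + b • hom' t := by
  cases t with
  | infty => exact ⟨p.1, p.2, by simp⟩
  | coe t => exact ⟨p.2, p.1 - p.2 * t, by simp⟩

theorem join_combination {a b c : F} (ha : a ≠ 0) (hc : c ≠ 0) (u w : Fin 4 → F) :
    join (a • u) (b • u + c • w) = join u w := by
  ext P
  simp only [join, Set.mem_ofPred_eq]
  suffices Submodule.span F {a • u, b • u + c • w} = Submodule.span F {u, w} by rw [this]
  apply le_antisymm <;> rw [Submodule.span_le]
  · rintro x (rfl | rfl) <;> rw [SetLike.mem_coe, Submodule.mem_span_pair]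
    exacts [⟨a, 0, by simp⟩, ⟨b, c, rfl⟩]
  · rintro x (rfl | rfl) <;> rw [SetLike.mem_coe, Submodule.mem_span_pair]
    · exact ⟨a⁻¹, 0, by simp [smul_smul, ha]⟩
    · refine ⟨-(c⁻¹ * b * a⁻¹), c⁻¹, ?_⟩
      ext i; simp; field_simp; ring

theorem exists_ne_ne (r s : OnePoint F) : ∃ t, r ≠ t ∧ s ≠ t := by
  by_contra! h
  have h0 := h ((0 : F) : OnePoint F)
  have h1 := h ((1 : F) : OnePoint F)
  have h2 := h OnePoint.infty
  by_cases e : r = ((0 : F) : OnePoint F) <;> by_cases e' : r = ((1 : F) : OnePoint F) <;>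
    by_cases e'' : r = OnePoint.infty <;> simp_all

variable [DecidableEq F]

/-- The linear action on homogeneous parameters induces the action of `GL (Fin 2) F` on `OnePoint
F`. -/
theorem act_hom (g : GL (Fin 2) F) (t : OnePoint F) :
    ∃ a : F, a ≠ 0 ∧ act (g : Matrix (Fin 2) (Fin 2) F) (hom t) = a • hom (g • t) := by
  obtain ⟨a, s, ha, h⟩ := exists_eq_smul_hom (act_ne_zero g (hom_ne_zero t))
  refine ⟨a, ha, ?_⟩
  suffices g • t = s by rw [h, this]
  cases t with
  | infty =>
    rw [OnePoint.smul_infty_eq_ite]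
    cases s <;> simp_all [act, Prod.ext_iff]
  | coe t =>
    rw [OnePoint.smul_some_eq_ite]
    cases s <;> simp_all [act, Prod.ext_iff]

theorem smul_eq_of_act {g : GL (Fin 2) F} {s t : OnePoint F} {a : F} (ha : a ≠ 0)
    (h : act (g : Matrix (Fin 2) (Fin 2) F) (hom t) = a • hom s) : g • t = s := by
  obtain ⟨b, hb, h'⟩ := act_hom g t
  rw [h'] at h
  rw [← bracket_hom_eq_zero]
  have : bracket (b • hom (g • t)) (b • hom (g • t)) = 0 := by simp [bracket]; ring
  rw [h] at this
  nth_rw 1 [← h] at this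
  have e : bracket (b • hom (g • t)) (a • hom s) = b * a * bracket (hom (g • t)) (hom s) := by
    simp [bracket]; ring
  rw [e] at this
  simpa [ha, hb] using this

theorem moebius_smul_cubicPt (g : GL (Fin 2) F) (t : OnePoint F) :
    moebius g • cubicPt t = cubicPt (g • t) := by
  obtain ⟨a, ha, h⟩ := act_hom g t
  obtain ⟨h', e⟩ := moebius_smul_mk g (cubicVec_ne_zero t)
  rw [cubicPt, e, cubicPt, Projectivization.mk_eq_mk_iff']
  refine ⟨a ^ 3, ?_⟩
  rw [cubicVec_eq, cubicVec_eq, sym3_mulVec_ver, h, ver_smul]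

theorem moebius_smul_oscPlane (g : GL (Fin 2) F) (t : OnePoint F) :
    moebius g • oscPlane t = oscPlane (g • t) := by
  obtain ⟨a, ha, h⟩ := act_hom g t
  rw [oscPlane_eq, oscPlane_eq, ← plane_smul (pow_ne_zero 3 g.det_ne_zero), ← form3_vecMul_sym3,
    moebius_smul_plane, h, form3_smul, plane_smul (by simp [ha])]

/-- The image of the tangent vector at `P(t)` is a tangent vector at `P(g • t)`, modulo the point of
contact; its coefficient `c` does not vanish since `g` preserves independence. -/
theorem moebius_smul_tangent (g : GL (Fin 2) F) (t : OnePoint F) :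
    moebius g • tangent t = tangent (g • t) := by
  obtain ⟨a, ha, h⟩ := act_hom g t
  obtain ⟨b, c, h'⟩ := exists_combination (g • t) (act (g : Matrix (Fin 2) (Fin 2) F) (hom' t))
  have hc : c ≠ 0 := by
    rintro rfl
    have := bracket_act (g : Matrix (Fin 2) (Fin 2) F) (hom t) (hom' t)
    rw [h, h'] at this
    have e : bracket (a • hom (g • t)) (b • hom (g • t) + (0 : F) • hom' (g • t)) = 0 := by
      simp [bracket]; ring
    rw [e] at this
    exact mul_ne_zero g.det_ne_zero (bracket_hom_hom' t) this.symm
  rw [tangent, tangent, moebius_smul_join, cubicVec_eq, cubicVec_eq, tangentVec_eq, tangentVec_eq,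
    sym3_mulVec_ver, sym3_mulVec_tan, h, h', ver_smul, tan_combination,
    join_combination (by simp [ha]) (by simp [ha, hc])]

theorem moebius_smul_realChord (g : GL (Fin 2) F) (s t : OnePoint F) :
    moebius g • realChord s t = realChord (g • s) (g • t) := by
  obtain ⟨a, ha, h⟩ := act_hom g s
  obtain ⟨b, hb, h'⟩ := act_hom g t
  rw [realChord, realChord, moebius_smul_join]
  simp only [cubicVec_eq]
  rw [sym3_mulVec_ver, sym3_mulVec_ver, h, h', ver_smul, ver_smul]
  simpa using join_combination (b := 0) (pow_ne_zero 3 ha) (pow_ne_zero 3 hb) (ver (hom (g • s)))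
    (ver (hom (g • t)))

theorem moebius_smul_cubic (g : GL (Fin 2) F) : moebius g • cubic F = cubic F := by
  rw [cubic, ← Set.image_smul, ← Set.range_comp]
  have : (fun x : Pt F ↦ moebius g • x) ∘ cubicPt = cubicPt ∘ (g • · : OnePoint F → OnePoint F) :=
    funext fun t ↦ moebius_smul_cubicPt g t
  rw [show (moebius g • ·) ∘ cubicPt = cubicPt ∘ (g • · : OnePoint F → OnePoint F) from this,
    Set.range_comp, (MulAction.surjective g).range_eq, Set.image_univ]

theorem moebius_mem_cubicGroup (g : GL (Fin 2) F) : moebius g ∈ cubicGroup F :=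
  moebius_smul_cubic g

/-- The projective linear group acts transitively on triples of distinct points of the line. -/
theorem exists_smul_eq_triple {r s t : OnePoint F} (hrs : r ≠ s) (hrt : r ≠ t) (hst : s ≠ t) :
    ∃ g : GL (Fin 2) F, g • (OnePoint.infty : OnePoint F) = r ∧ g • ((0 : F) : OnePoint F) = s ∧
      g • ((1 : F) : OnePoint F) = t := by
  -- scaling the columns by `a` and `b` makes the third point their sum, up to a factor
  set a := bracket (hom s) (hom t) with ha
  set b := bracket (hom t) (hom r) with hb
  have ha0 : a ≠ 0 := bracket_hom_ne_zero hst
  have hb0 : b ≠ 0 := bracket_hom_ne_zero hrt.symm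
  set m : Matrix (Fin 2) (Fin 2) F :=
    !![a * (hom r).1, b * (hom s).1; a * (hom r).2, b * (hom s).2] with hm
  have hdet : m.det ≠ 0 := by
    have : m.det = a * b * bracket (hom s) (hom r) := by
      rw [Matrix.det_fin_two]; simp [m, bracket]; ring
    rw [this]
    exact mul_ne_zero (mul_ne_zero ha0 hb0) (bracket_hom_ne_zero hrs.symm)
  refine ⟨Matrix.GeneralLinearGroup.mkOfDetNeZero m hdet, smul_eq_of_act ha0 ?_,
    smul_eq_of_act hb0 ?_, smul_eq_of_act (bracket_hom_ne_zero hrs.symm) ?_⟩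
  · simp [act, m, Matrix.GeneralLinearGroup.mkOfDetNeZero, Prod.ext_iff]
  · simp [act, m, Matrix.GeneralLinearGroup.mkOfDetNeZero, Prod.ext_iff]
  · simp [act, m, Matrix.GeneralLinearGroup.mkOfDetNeZero, Prod.ext_iff, ha, hb, bracket]
    constructor <;> ring

theorem exists_smul_eq_pair {r s : OnePoint F} (hrs : r ≠ s) :
    ∃ g : GL (Fin 2) F, g • (OnePoint.infty : OnePoint F) = r ∧
      g • ((0 : F) : OnePoint F) = s := by
  obtain ⟨t, h, h'⟩ := exists_ne_ne r s
  obtain ⟨g, h1, h2, -⟩ := exists_smul_eq_triple hrs h h'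
  exact ⟨g, h1, h2⟩

theorem exists_smul_infty_eq (r : OnePoint F) :
    ∃ g : GL (Fin 2) F, g • (OnePoint.infty : OnePoint F) = r := by
  obtain ⟨t, h, -⟩ := exists_ne_ne r r
  obtain ⟨g, h1, -⟩ := exists_smul_eq_pair h
  exact ⟨g, h1⟩

end Moebius

/-! ### The group of the twisted cubic -/

section GroupOfTheCubic

variable {F : Type*} [Field F]

/-- A cubic polynomial with at least four nonzero zeros vanishes identically. -/
theorem cubic_coeff_eq_zero [Finite F] (hq : 5 ≤ Nat.card F) {c : Fin 4 → F}
    (h : ∀ t : F, t ≠ 0 → c 0 * t ^ 3 + c 1 * t ^ 2 + c 2 * t + c 3 = 0) : c = 0 := by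
  by_contra hc
  have h3 := ncard_roots_le hc
  have hsub : ((↑) : F → OnePoint F) '' {0}ᶜ ⊆ {t | c ⬝ᵥ cubicVec t = 0} := by
    rintro _ ⟨t, ht, rfl⟩
    have := h t ht
    simpa [cubicVec, affineVec, dot_four] using this
  have h4 := Set.ncard_le_ncard hsub (Set.toFinite _)
  rw [Set.ncard_image_of_injective _ OnePoint.coe_injective, Set.ncard_compl,
    Set.ncard_singleton] at h4
  omega

/-- The vectors proportional to points of the cubic satisfy two of its quadratic equations. -/
theorem cubicVec_minors (t : OnePoint F) (a : F) (y : Fin 4 → F) (h : y = a • cubicVec t) :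
    y 0 * y 2 = y 1 ^ 2 ∧ y 1 * y 3 = y 2 ^ 2 := by
  subst h
  rw [cubicVec_eq]
  simp [ver]
  constructor <;> ring

/-- A matrix which maps the cubic to itself and fixes `P(∞)` and `P(0)` is, up to a scalar, the
symmetric cube of a diagonal matrix. -/
theorem exists_eq_smul_sym3_diagonal [Finite F] (hq : 5 ≤ Nat.card F)
    {N : Matrix (Fin 4) (Fin 4) F} (hN : IsUnit N)
    (h : ∀ t, ∃ (s : OnePoint F) (a : F), N *ᵥ cubicVec t = a • cubicVec s)
    (hinf : ∃ a : F, N *ᵥ cubicVec OnePoint.infty = a • cubicVec OnePoint.infty)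
    (hzero : ∃ a : F, N *ᵥ cubicVec ((0 : F) : OnePoint F) = a • cubicVec ((0 : F) : OnePoint F)) :
    ∃ a d : F, a ≠ 0 ∧ d ≠ 0 ∧ N = d • sym3 !![a, 0; 0, 1] := by
  have hinj := Matrix.mulVec_injective_of_isUnit hN
  obtain ⟨a, ha⟩ := hinf
  obtain ⟨d, hd⟩ := hzero
  have ha0 : a ≠ 0 := by
    rintro rfl
    exact cubicVec_ne_zero _ (hinj (by rw [ha, zero_smul, Matrix.mulVec_zero]))
  have hd0 : d ≠ 0 := by
    rintro rfl
    exact cubicVec_ne_zero _ (hinj (by rw [hd, zero_smul, Matrix.mulVec_zero]))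
  have c0 (i : Fin 4) : N i 0 = a * cubicVec OnePoint.infty i := by
    have := congrFun ha i
    simpa only [Matrix.mulVec, dot_four, cubicVec, Matrix.cons_val, mul_one, mul_zero, add_zero,
      Pi.smul_apply, smul_eq_mul] using this
  have c3 (i : Fin 4) : N i 3 = d * cubicVec ((0 : F) : OnePoint F) i := by
    have := congrFun hd i
    simpa [dotProduct, Matrix.mulVec, Fin.sum_univ_four, cubicVec, affineVec,
      -Matrix.cons_dotProduct, -Matrix.dotProduct_cons] using this
  have c00 : N 0 0 = a := by simp [c0, cubicVec]
  have c10 : N 1 0 = 0 := by simp [c0, cubicVec]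
  have c20 : N 2 0 = 0 := by simp [c0, cubicVec]
  have c30 : N 3 0 = 0 := by simp [c0, cubicVec]
  have c03 : N 0 3 = 0 := by simp [c3, cubicVec, affineVec]
  have c13 : N 1 3 = 0 := by simp [c3, cubicVec, affineVec]
  have c23 : N 2 3 = 0 := by simp [c3, cubicVec, affineVec]
  have c33 : N 3 3 = d := by simp [c3, cubicVec, affineVec]
  -- the equations of the cubic, applied to the image of `P(t)`, are polynomial equations in `t`,
  -- which hold for all `t`
  have key (t : F) := (h t).elim fun s h ↦ h.elim fun b hb ↦ cubicVec_minors s b _ hb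
  simp only [Matrix.mulVec, dot_four, cubicVec, affineVec, c00, c10, c20, c30, c03, c13, c23, c33,
    Matrix.cons_val] at key
  -- the coefficients of the first minor, divided by `t ^ 2`
  have e1 : ![a * N 2 1, a * N 2 2 + N 0 1 * N 2 1 - N 1 1 ^ 2,
      N 0 1 * N 2 2 + N 0 2 * N 2 1 - 2 * N 1 1 * N 1 2,
      N 0 2 * N 2 2 - N 1 2 ^ 2] = (0 : Fin 4 → F) := by
    refine cubic_coeff_eq_zero hq fun t ht ↦ ?_
    have := (key t).1
    simp only [Matrix.cons_val]
    apply mul_left_cancel₀ (pow_ne_zero 2 ht)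
    linear_combination this
  have h21 : N 2 1 = 0 := by simpa [ha0] using congrFun e1 0
  have h22 : N 2 2 ≠ 0 := by
    intro h22
    have hu := (Matrix.isUnit_iff_isUnit_det N).1 hN
    rw [Matrix.det_eq_zero_of_row_eq_zero 2 (fun j ↦ by fin_cases j <;> assumption)] at hu
    simp at hu
  -- the coefficients of the second minor, divided by `t`
  have e2 : ![N 1 1 * N 3 1, N 1 1 * N 3 2 + N 1 2 * N 3 1,
      N 1 1 * d + N 1 2 * N 3 2 - N 2 2 ^ 2, N 1 2 * d] = (0 : Fin 4 → F) := by
    refine cubic_coeff_eq_zero hq fun t ht ↦ ?_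
    have := (key t).2
    rw [h21] at this
    simp only [Matrix.cons_val]
    apply mul_left_cancel₀ ht
    linear_combination this
  have h12 : N 1 2 = 0 := by simpa [hd0] using congrFun e2 3
  have h11d : N 1 1 * d = N 2 2 ^ 2 := by simpa [h12, sub_eq_zero] using congrFun e2 2
  have h11 : N 1 1 ≠ 0 := by
    intro h; exact h22 (pow_eq_zero_iff two_ne_zero |>.1 (by rw [← h11d, h, zero_mul]))
  have h31 : N 3 1 = 0 := by simpa [h11] using congrFun e2 0
  have h32 : N 3 2 = 0 := by simpa [h11, h12] using congrFun e2 1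
  have h22a : a * N 2 2 = N 1 1 ^ 2 := by simpa [h21, sub_eq_zero] using congrFun e1 1
  have h01 : N 0 1 = 0 := by simpa [h21, h12, h22] using congrFun e1 2
  have h02 : N 0 2 = 0 := by simpa [h12, h22] using congrFun e1 3
  refine ⟨N 2 2 / d, d, div_ne_zero h22 hd0, hd0, ?_⟩
  have f11 : N 1 1 = N 2 2 ^ 2 / d := by field_simp; exact h11d
  have fa : a = N 2 2 ^ 3 / d ^ 2 := by
    rw [f11] at h22a
    field_simp at h22a ⊢
    exact h22a
  ext i j
  fin_cases i <;> fin_cases j <;>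
    simp [sym3, c00, c10, c20, c30, c03, c13, c23, c33, h01, h02, h12, h21, h31, h32]
  · rw [fa]; field_simp
  · rw [f11]; field_simp
  · field_simp

/-- For `q ≥ 5` every projectivity which fixes the cubic comes from a projectivity of the
parameter line. -/
theorem exists_moebius_eq [Finite F] [DecidableEq F] (hq : 5 ≤ Nat.card F)
    {A : Matrix.ProjGenLinGroup (Fin 4) F} (hA : A ∈ cubicGroup F) : ∃ g, moebius g = A := by
  have hmap (B : Matrix.ProjGenLinGroup (Fin 4) F) (hB : B ∈ cubicGroup F) (t : OnePoint F) :
      ∃ s : OnePoint F, B • cubicPt t = cubicPt s := by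
    have h1 : B • cubicPt t ∈ B • cubic F := Set.smul_mem_smul_set ⟨t, rfl⟩
    rw [show B • cubic F = cubic F from hB] at h1
    exact h1.imp fun s hs ↦ hs.symm
  obtain ⟨r, hr⟩ := hmap A hA OnePoint.infty
  obtain ⟨s, hs⟩ := hmap A hA ((0 : F) : OnePoint F)
  have hrs : r ≠ s := by
    rintro rfl
    exact OnePoint.infty_ne_coe _ (cubicPt_injective (smul_left_cancel A (hr.trans hs.symm)))
  obtain ⟨g, hg, hg'⟩ := exists_smul_eq_pair hrs
  -- after composition with `moebius g` both `P(∞)` and `P(0)` are fixed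
  have hB : (moebius g)⁻¹ * A ∈ cubicGroup F :=
    mul_mem (inv_mem (moebius_mem_cubicGroup g)) hA
  have hBr : ((moebius g)⁻¹ * A) • cubicPt (OnePoint.infty : OnePoint F) =
      cubicPt OnePoint.infty := by
    rw [mul_smul, hr, inv_smul_eq_iff, moebius_smul_cubicPt, hg]
  have hBs : ((moebius g)⁻¹ * A) • cubicPt ((0 : F) : OnePoint F) =
      cubicPt ((0 : F) : OnePoint F) := by
    rw [mul_smul, hs, inv_smul_eq_iff, moebius_smul_cubicPt, hg']
  obtain ⟨N, hN⟩ := Matrix.ProjGenLinGroup.mk_surjective ((moebius g)⁻¹ * A)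
  rw [← hN] at hB hBr hBs
  have hvec {t s : OnePoint F} (h : Matrix.ProjGenLinGroup.mk N • cubicPt t = cubicPt s) :
      ∃ a : F, (N : Matrix (Fin 4) (Fin 4) F) *ᵥ cubicVec t = a • cubicVec s := by
    obtain ⟨h', e⟩ := pgl_smul_mk N (cubicVec_ne_zero t)
    rw [cubicPt, e, cubicPt, Projectivization.mk_eq_mk_iff'] at h
    exact h.imp fun a ha ↦ ha.symm
  obtain ⟨a, d, ha, hd, hNad⟩ := exists_eq_smul_sym3_diagonal hq N.isUnit
    (fun t ↦ (hmap _ hB t).imp fun s hs ↦ hvec hs) (hvec hBr) (hvec hBs)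
  have hdet : (!![a, 0; 0, 1] : Matrix (Fin 2) (Fin 2) F).det ≠ 0 := by simpa using ha
  refine ⟨g * Matrix.GeneralLinearGroup.mkOfDetNeZero _ hdet, ?_⟩
  rw [map_mul, ← eq_inv_mul_iff_mul_eq, ← hN]
  refine Matrix.ProjGenLinGroup.mk_eq_mk_iff.2 ⟨Units.mk0 d hd, Units.ext ?_⟩
  rw [hNad]
  ext i j
  simp [Matrix.GeneralLinearGroup.mkOfDetNeZero, Matrix.mul_diagonal, mul_comm]

end GroupOfTheCubic

/-! ### Irreducible binary forms of degree two and three -/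

section IrreducibleForms

open Polynomial

variable {F : Type*} [Field F]

/-- The dehomogenization of the binary cubic form with the coefficients `c`. -/
noncomputable def formPoly (c : Fin 4 → F) : F[X] :=
  C (c 0) * X ^ 3 + C (c 1) * X ^ 2 + C (c 2) * X + C (c 3)

theorem aeval_formPoly {E : Type*} [CommRing E] [Algebra F E] (c : Fin 4 → F) (x : E) :
    aeval x (formPoly c) = algebraMap F E (c 0) * x ^ 3 + algebraMap F E (c 1) * x ^ 2 +
      algebraMap F E (c 2) * x + algebraMap F E (c 3) := by
  simp [formPoly]

theorem eval_formPoly (c : Fin 4 → F) (t : F) :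
    (formPoly c).eval t = c ⬝ᵥ cubicVec (t : OnePoint F) := by
  rw [dot_four]; simp [formPoly, cubicVec, affineVec]

theorem coeff_formPoly (c : Fin 4 → F) (i : Fin 4) : (formPoly c).coeff (3 - i) = c i := by
  fin_cases i <;> simp [formPoly, coeff_X, coeff_C, coeff_X_pow]

/-- If `y` is the image of `x` under the fractional linear map with the matrix `g`, then the form
transformed by `g` takes at `x` the value of the original form at `y`, up to a cube. -/
theorem aeval_formPoly_vecMul_sym3 {E : Type*} [CommRing E] [Algebra F E] (c : Fin 4 → F)
    (g : Matrix (Fin 2) (Fin 2) F) {x y : E}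
    (h : y * (algebraMap F E (g 1 0) * x + algebraMap F E (g 1 1)) =
      algebraMap F E (g 0 0) * x + algebraMap F E (g 0 1)) :
    aeval x (formPoly (c ᵥ* sym3 g)) =
      (algebraMap F E (g 1 0) * x + algebraMap F E (g 1 1)) ^ 3 * aeval y (formPoly c) := by
  have e : aeval x (formPoly (c ᵥ* sym3 g)) =
      let u := algebraMap F E (g 0 0) * x + algebraMap F E (g 0 1)
      let v := algebraMap F E (g 1 0) * x + algebraMap F E (g 1 1)
      algebraMap F E (c 0) * u ^ 3 + algebraMap F E (c 1) * u ^ 2 * v +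
      algebraMap F E (c 2) * u * v ^ 2 + algebraMap F E (c 3) * v ^ 3 := by
    simp only [aeval_formPoly, Matrix.vecMul, dot_four]
    simp [sym3, map_ofNat]
    ring
  rw [e, aeval_formPoly, ← h]
  ring

/-- A form of at most the degree of `c` which vanishes at a root of the form `c` in `AdjoinRoot
(formPoly c)` is a multiple of `c`. -/
theorem eq_smul_of_aeval_root_eq_zero {c h : Fin 4 → F} (hc : formPoly c ≠ 0)
    (hd : (formPoly h).natDegree ≤ (formPoly c).natDegree)
    (h0 : aeval (AdjoinRoot.root (formPoly c)) (formPoly h) = 0) : ∃ k : F, h = k • c := by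
  rw [AdjoinRoot.aeval_eq, AdjoinRoot.mk_eq_zero] at h0
  obtain ⟨k, hk⟩ := h0
  have hk0 : k.natDegree = 0 := by
    by_cases hk1 : k = 0
    · simp [hk1]
    · rw [hk, natDegree_mul hc hk1] at hd; omega
  rw [natDegree_eq_zero] at hk0
  obtain ⟨a, rfl⟩ := hk0
  refine ⟨a, funext fun i ↦ ?_⟩
  rw [← coeff_formPoly h, hk, coeff_mul_C, coeff_formPoly]
  simp [mul_comm]

/-- Over a finite field, an irreducible polynomial has a root in the extension generated by a root
of any other irreducible polynomial of the same degree. -/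
theorem exists_aeval_eq_zero_of_natDegree_eq [Finite F] {f f' : F[X]} (hf : Irreducible f)
    (hf' : Irreducible f') (h : f.natDegree = f'.natDegree) :
    ∃ y : AdjoinRoot f, aeval y f' = 0 := by
  have := Fact.mk hf
  have := Fact.mk hf'
  have : Module.Finite F (AdjoinRoot f) := (AdjoinRoot.powerBasis hf.ne_zero).finite
  have : Module.Finite F (AdjoinRoot f') := (AdjoinRoot.powerBasis hf'.ne_zero).finite
  have e : Module.finrank F (AdjoinRoot f') ∣ Module.finrank F (AdjoinRoot f) := by
    rw [(AdjoinRoot.powerBasis hf.ne_zero).finrank, (AdjoinRoot.powerBasis hf'.ne_zero).finrank,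
      AdjoinRoot.powerBasis_dim, AdjoinRoot.powerBasis_dim, h]
  have : Finite (AdjoinRoot f) := Module.finite_of_finite F
  obtain ⟨φ⟩ := FiniteField.nonempty_algHom_of_finrank_dvd e
  refine ⟨φ (AdjoinRoot.root f'), ?_⟩
  rw [aeval_algHom_apply, AdjoinRoot.aeval_eq, AdjoinRoot.mk_self, map_zero]

/-- A root of a polynomial of degree at least two satisfies no linear equation over `F`. -/
theorem eq_zero_of_root_mul_add {f : F[X]} (hd : 2 ≤ f.natDegree) {a b : F}
    (h : algebraMap F (AdjoinRoot f) a * AdjoinRoot.root f + algebraMap F (AdjoinRoot f) b = 0) :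
    a = 0 ∧ b = 0 := by
  have h0 : AdjoinRoot.mk f (C a * X + C b) = 0 := by
    simpa using h
  rw [AdjoinRoot.mk_eq_zero] at h0
  have h1 : C a * X + C b = 0 := by
    refine eq_zero_of_dvd_of_natDegree_lt h0 (lt_of_le_of_lt natDegree_linear_le ?_)
    omega
  refine ⟨?_, ?_⟩
  · simpa using congrArg (coeff · 1) h1
  · simpa using congrArg (coeff · 0) h1

/-- Two irreducible binary forms of the same degree, two or three (a form of degree two being
regarded as a cubic form with the root at infinity), are equivalent under the projective group. -/
theorem exists_vecMul_sym3_eq_smul [Finite F] {c c' : Fin 4 → F} (hc : Irreducible (formPoly c))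
    (hc' : Irreducible (formPoly c')) (hd : (formPoly c).natDegree = (formPoly c').natDegree)
    (h23 : ((formPoly c).natDegree = 3) ∨ ((formPoly c).natDegree = 2 ∧ c' 0 = 0)) :
    ∃ (g : GL (Fin 2) F) (k : F), k ≠ 0 ∧
      c' ᵥ* sym3 (g : Matrix (Fin 2) (Fin 2) F) = k • c := by
  obtain ⟨y, hy⟩ := exists_aeval_eq_zero_of_natDegree_eq hc hc' hd
  have := Fact.mk hc
  have : Module.Finite F (AdjoinRoot (formPoly c)) := (AdjoinRoot.powerBasis hc.ne_zero).finite
  have hfr : Module.finrank F (AdjoinRoot (formPoly c)) = (formPoly c).natDegree := by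
    rw [(AdjoinRoot.powerBasis hc.ne_zero).finrank, AdjoinRoot.powerBasis_dim]
  set x := AdjoinRoot.root (formPoly c) with hx
  have h2 : 2 ≤ (formPoly c).natDegree := by omega
  have hyF (t : F) : y ≠ algebraMap F _ t := by
    rintro rfl
    rw [aeval_algebraMap_apply, map_eq_zero] at hy
    have h1 : (formPoly c').degree = 1 :=
      degree_eq_one_of_irreducible_of_root hc' (x := t) (by simpa [IsRoot] using hy)
    have h2 : (formPoly c').natDegree = 1 := natDegree_eq_of_degree_eq_some h1
    omega
  -- the relation of linear dependence which expresses `y` as a fractional linear function of `x`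
  obtain ⟨g, hg0, hg, hg'⟩ : ∃ g : Matrix (Fin 2) (Fin 2) F, g ≠ 0 ∧
      y * (algebraMap F _ (g 1 0) * x + algebraMap F _ (g 1 1)) =
        algebraMap F _ (g 0 0) * x + algebraMap F _ (g 0 1) ∧
      ((formPoly c).natDegree = 2 → g 1 0 = 0) := by
    rcases h23 with h3 | ⟨h3, -⟩
    · have : ¬ LinearIndependent F ![x, 1, y * x, y] := by
        intro h
        have := h.fintype_card_le_finrank
        rw [hfr, h3] at this
        simp at this
      rw [Fintype.not_linearIndependent_iff] at this
      obtain ⟨a, ha, i, hi⟩ := this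
      refine ⟨!![a 0, a 1; -a 2, -a 3], ?_, ?_, by omega⟩
      · intro h
        apply hi
        fin_cases i
        · simpa using congrFun (congrFun h 0) 0
        · simpa using congrFun (congrFun h 0) 1
        · simpa using congrFun (congrFun h 1) 0
        · simpa using congrFun (congrFun h 1) 1
      · simp [Fin.sum_univ_four, Algebra.smul_def] at ha
        simp
        linear_combination -ha
    · have : ¬ LinearIndependent F ![x, 1, y] := by
        intro h
        have := h.fintype_card_le_finrank
        rw [hfr, h3] at this
        simp at this
      rw [Fintype.not_linearIndependent_iff] at this
      obtain ⟨a, ha, i, hi⟩ := this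
      refine ⟨!![a 0, a 1; 0, -a 2], ?_, ?_, by simp⟩
      · intro h
        apply hi
        fin_cases i
        · simpa using congrFun (congrFun h 0) 0
        · simpa using congrFun (congrFun h 0) 1
        · simpa using congrFun (congrFun h 1) 1
      · simp [Fin.sum_univ_three, Algebra.smul_def] at ha
        simp
        linear_combination -ha
  -- a singular `g` would put `y` into the base field
  have hdet : g.det ≠ 0 := by
    intro hdet
    rw [Matrix.det_fin_two] at hdet
    have hz : algebraMap F (AdjoinRoot (formPoly c)) (g 1 0) * x +
        algebraMap F (AdjoinRoot (formPoly c)) (g 1 1) ≠ 0 := by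
      intro hz
      obtain ⟨h10, h11⟩ := eq_zero_of_root_mul_add h2 hz
      rw [hz, mul_zero] at hg
      obtain ⟨h00, h01⟩ := eq_zero_of_root_mul_add h2 hg.symm
      apply hg0
      ext i j; fin_cases i <;> fin_cases j <;> assumption
    have hdet' := congrArg (algebraMap F (AdjoinRoot (formPoly c))) hdet
    simp only [map_sub, map_mul, map_zero] at hdet'
    by_cases h10 : g 1 0 = 0
    · have h11 : g 1 1 ≠ 0 := by rintro h; simp [h10, h] at hz
      have h00 : g 0 0 = 0 := by simpa [h10, h11] using hdet
      apply hyF (g 0 1 / g 1 1)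
      rw [h10, h00] at hg
      have : algebraMap F (AdjoinRoot (formPoly c)) (g 1 1) ≠ 0 := by simpa using h11
      rw [map_div₀, eq_div_iff this]
      simpa using hg
    · apply hyF (g 0 0 / g 1 0)
      have : algebraMap F (AdjoinRoot (formPoly c)) (g 1 0) ≠ 0 := by simpa using h10
      rw [map_div₀, eq_div_iff this]
      apply mul_right_cancel₀ hz
      linear_combination algebraMap F (AdjoinRoot (formPoly c)) (g 1 0) * hg - hdet'
  have hroot := aeval_formPoly_vecMul_sym3 c' g hg
  rw [hy, mul_zero] at hroot
  have hdeg : (formPoly (c' ᵥ* sym3 g)).natDegree ≤ (formPoly c).natDegree := by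
    rcases h23 with h3 | ⟨h3, h0⟩
    · rw [h3]; exact natDegree_cubic_le
    · have : (c' ᵥ* sym3 g) 0 = 0 := by
        simp only [Matrix.vecMul, dot_four]
        simp [sym3, h0, hg' h3]
      rw [h3, formPoly, this, C_0, zero_mul, zero_add]
      exact natDegree_quadratic_le
  obtain ⟨k, hk⟩ := eq_smul_of_aeval_root_eq_zero hc.ne_zero hdeg hroot
  refine ⟨Matrix.GeneralLinearGroup.mkOfDetNeZero g hdet, k, ?_, hk⟩
  rintro rfl
  rw [zero_smul] at hk
  have hu : IsUnit (sym3 g) := IsUnit.map sym3 ((Matrix.isUnit_iff_isUnit_det g).2 hdet.isUnit)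
  have := Matrix.vecMul_injective_of_isUnit hu (a₁ := c') (a₂ := 0) (by simpa using hk)
  apply hc'.ne_zero
  simp [this, formPoly]

end IrreducibleForms

/-! ### Conjugacy -/

section Conjugacy

variable {F : Type*} [Field F] {X : Type*} [MulAction (Matrix.ProjGenLinGroup (Fin 4) F) X]

/-- Two objects (points or planes) are conjugate when a projectivity of the parameter line moves one
to the other. The field `F` is not determined by the type `X`, so it has to be given explicitly. -/
def Conj (x y : X) : Prop := ∃ g : GL (Fin 2) F, (moebius g) • x = y

theorem Conj.refl (x : X) : Conj (F := F) x x := ⟨1, by simp⟩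

theorem Conj.symm {x y : X} (h : Conj (F := F) x y) : Conj (F := F) y x := by
  obtain ⟨g, rfl⟩ := h
  exact ⟨g⁻¹, by simp⟩

theorem Conj.trans {x y z : X} (h : Conj (F := F) x y) (h' : Conj (F := F) y z) :
    Conj (F := F) x z := by
  obtain ⟨g, rfl⟩ := h
  obtain ⟨g', rfl⟩ := h'
  exact ⟨g' * g, by rw [map_mul, mul_smul]⟩

end Conjugacy

/-! ### The classes of planes -/

section Planes

variable {F : Type*} [Field F]

/-- The number of points in which a set of points meets the cubic. -/
noncomputable def numCubic (π : Set (Pt F)) : ℕ := (π ∩ cubic F).ncard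

theorem numCubic_eq (π : Set (Pt F)) : numCubic π = {t | cubicPt t ∈ π}.ncard := by
  rw [numCubic, ← Set.ncard_image_of_injective _ cubicPt_injective]
  congr 1
  ext P
  constructor
  · rintro ⟨h, t, rfl⟩; exact ⟨t, h, rfl⟩
  · rintro ⟨t, h, rfl⟩; exact ⟨h, t, rfl⟩

theorem numCubic_oscPlane (t : OnePoint F) : numCubic (oscPlane t) = 1 := by
  rw [numCubic_eq]
  simp [cubicPt_mem_oscPlane]

theorem numCubic_le [Finite F] {π : Set (Pt F)} (hπ : IsPlane π) : numCubic π ≤ 3 := by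
  obtain ⟨c, hc, rfl⟩ := hπ
  rw [numCubic_eq]
  simpa only [cubicPt_mem_plane] using ncard_roots_le hc

theorem isPlane_smul_iff {A : Matrix.ProjGenLinGroup (Fin 4) F} {π : Set (Pt F)} :
    IsPlane (A • π) ↔ IsPlane π := by
  have key (A : Matrix.ProjGenLinGroup (Fin 4) F) (π : Set (Pt F)) (h : IsPlane π) :
      IsPlane (A • π) := by
    obtain ⟨c, hc, rfl⟩ := h
    obtain ⟨B, rfl⟩ := Matrix.ProjGenLinGroup.mk_surjective A
    have e := pgl_smul_plane B (c ᵥ* ((B⁻¹ : GL (Fin 4) F) : Matrix (Fin 4) (Fin 4) F))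
    have e' : ((B⁻¹ : GL (Fin 4) F) : Matrix (Fin 4) (Fin 4) F) * B = 1 := by
      rw [← Units.val_mul, inv_mul_cancel, Units.val_one]
    rw [Matrix.vecMul_vecMul, e', Matrix.vecMul_one] at e
    refine ⟨_, ?_, e⟩
    intro h0
    exact hc (Matrix.vecMul_injective_of_isUnit B⁻¹.isUnit (by simpa using h0))
  exact ⟨fun h ↦ by simpa using key A⁻¹ _ h, key A π⟩

theorem smul_cubic {A : Matrix.ProjGenLinGroup (Fin 4) F} (hA : A ∈ cubicGroup F) :
    A • cubic F = cubic F := hA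

theorem numCubic_smul {A : Matrix.ProjGenLinGroup (Fin 4) F} (hA : A ∈ cubicGroup F)
    (π : Set (Pt F)) : numCubic (A • π) = numCubic π := by
  rw [numCubic]
  nth_rw 1 [← smul_cubic hA]
  rw [← Set.smul_set_inter, numCubic, ← Set.image_smul,
    Set.ncard_image_of_injective _ (MulAction.injective A)]

theorem cubicPt_mem_moebius_smul [DecidableEq F] {g : GL (Fin 2) F} {t : OnePoint F}
    {π : Set (Pt F)} :
    cubicPt (g • t) ∈ moebius g • π ↔ cubicPt t ∈ π := by
  rw [← moebius_smul_cubicPt, Set.smul_mem_smul_set_iff]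

theorem conj_oscPlane [DecidableEq F] (s t : OnePoint F) :
    Conj (F := F) (oscPlane s) (oscPlane t) := by
  have key (s : OnePoint F) :
      Conj (F := F) (oscPlane (OnePoint.infty : OnePoint F)) (oscPlane s) := by
    obtain ⟨g, hg⟩ := exists_smul_infty_eq s
    exact ⟨g, by rw [moebius_smul_oscPlane, hg]⟩
  exact (key s).symm.trans (key t)

theorem cubicPt_infty_mem_plane {c : Fin 4 → F} :
    cubicPt (OnePoint.infty : OnePoint F) ∈ plane c ↔ c 0 = 0 := by
  rw [cubicPt_mem_plane, dot_four]; simp [cubicVec]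

theorem cubicPt_coe_mem_plane {c : Fin 4 → F} {t : F} : cubicPt (t : OnePoint F) ∈ plane c ↔
    c 0 * t ^ 3 + c 1 * t ^ 2 + c 2 * t + c 3 = 0 := by
  rw [cubicPt_mem_plane, dot_four]; simp [cubicVec, affineVec]

/-- A plane which meets the cubic may be moved so that it contains `P(∞)`. -/
theorem exists_conj_mem_infty [DecidableEq F] {π : Set (Pt F)} {r : OnePoint F}
    (h : cubicPt r ∈ π) :
    ∃ π', Conj (F := F) π' π ∧ cubicPt (OnePoint.infty : OnePoint F) ∈ π' := by
  obtain ⟨g, hg⟩ := exists_smul_infty_eq r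
  refine ⟨(moebius g)⁻¹ • π, ⟨g, by simp⟩, ?_⟩
  rw [← cubicPt_mem_moebius_smul (g := g), hg]
  simpa using h

theorem Conj.isPlane {π π' : Set (Pt F)} (h : Conj (F := F) π π') : IsPlane π ↔ IsPlane π' := by
  obtain ⟨g, rfl⟩ := h
  rw [isPlane_smul_iff]

theorem Conj.numCubic_eq [DecidableEq F] {π π' : Set (Pt F)} (h : Conj (F := F) π π') :
    numCubic π = numCubic π' := by
  obtain ⟨g, rfl⟩ := h
  rw [numCubic_smul (moebius_mem_cubicGroup g)]

theorem Conj.mem_developable [DecidableEq F] {π π' : Set (Pt F)} (h : Conj (F := F) π π') :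
    π ∈ developable F ↔ π' ∈ developable F := by
  have key {π π' : Set (Pt F)} (h : Conj (F := F) π π') (hπ : π ∈ developable F) :
      π' ∈ developable F := by
    obtain ⟨g, rfl⟩ := h
    obtain ⟨t, rfl⟩ := hπ
    exact ⟨g • t, (moebius_smul_oscPlane g t).symm⟩
  exact ⟨key h, key h.symm⟩

theorem plane_eq_of_smul {a : F} {c c' : Fin 4 → F} (ha : a ≠ 0) (h : c = a • c') :
    plane c = plane c' := by
  rw [h, plane_smul ha]

theorem numCubic_eq_zero [Finite F] {π : Set (Pt F)} :
    numCubic π = 0 ↔ ∀ t : OnePoint F, cubicPt t ∉ π := by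
  rw [numCubic_eq, Set.ncard_eq_zero (Set.toFinite _), Set.eq_empty_iff_forall_notMem]
  rfl

theorem ncard_le_numCubic [Finite F] {π : Set (Pt F)} {S : Set (OnePoint F)}
    (h : ∀ t ∈ S, cubicPt t ∈ π) : S.ncard ≤ numCubic π := by
  rw [numCubic_eq]
  exact Set.ncard_le_ncard h (Set.toFinite _)

theorem two_le_numCubic [Finite F] {π : Set (Pt F)} {r s : OnePoint F} (hrs : r ≠ s)
    (hr : cubicPt r ∈ π) (hs : cubicPt s ∈ π) : 2 ≤ numCubic π := by
  rw [← Set.ncard_pair hrs]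
  exact ncard_le_numCubic (by simp [hr, hs])

/-- A plane which meets the cubic in two points is equivalent to the one with the binary cubic
form `x y²`. -/
theorem conj_of_numCubic_eq_two [DecidableEq F] [Finite F] {π : Set (Pt F)} (hπ : IsPlane π)
    (h : numCubic π = 2) :
    Conj (F := F) (plane ![0, 0, 1, 0]) π := by
  rw [numCubic_eq, Set.ncard_eq_two] at h
  obtain ⟨r, s, hrs, h⟩ := h
  obtain ⟨g, hr, hs⟩ := exists_smul_eq_pair hrs
  have hc : Conj (F := F) ((moebius g)⁻¹ • π) π := ⟨g, by simp⟩
  have hmem (t : OnePoint F) : cubicPt t ∈ (moebius g)⁻¹ • π ↔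
      t = OnePoint.infty ∨ t = ((0 : F) : OnePoint F) := by
    rw [← cubicPt_mem_moebius_smul (g := g), smul_inv_smul]
    change g • t ∈ {t | cubicPt t ∈ π} ↔ _
    rw [h, ← hr, ← hs]
    simp
  obtain ⟨c, hc0, e⟩ := hc.isPlane.2 hπ
  rw [e] at hmem hc
  refine Conj.trans ?_ hc
  have h0 : c 0 = 0 := cubicPt_infty_mem_plane.1 ((hmem _).2 (Or.inl rfl))
  have h3 : c 3 = 0 := by simpa using cubicPt_coe_mem_plane.1 ((hmem _).2 (Or.inr rfl))
  -- the form is `x y (c 1 x + c 2 y)`, and its third root is one of the other two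
  have h12 : c 1 = 0 ∨ c 2 = 0 := by
    by_contra! h12
    have := (hmem ((-c 2 / c 1 : F) : OnePoint F)).1 (by
      rw [cubicPt_coe_mem_plane, h0, h3]
      field_simp [h12.1]; ring)
    simp [h12] at this
  rcases h12 with h1 | h2
  · rw [plane_eq_of_smul (a := c 2) (c := c) (c' := ![0, 0, 1, 0])]
    · exact Conj.refl _
    · rintro h2; apply hc0; ext i; fin_cases i <;> assumption
    · ext i; fin_cases i <;> simp [h0, h1, h3]
  · have hw : (!![0, 1; 1, 0] : Matrix (Fin 2) (Fin 2) F).det ≠ 0 := by simp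
    -- the form is `x² y`; the swap of the two roots turns it into `x y²`
    refine ⟨Matrix.GeneralLinearGroup.mkOfDetNeZero _ hw, ?_⟩
    have h1 : c 1 ≠ 0 := by rintro h1; apply hc0; ext i; fin_cases i <;> assumption
    rw [← moebius_smul_plane (Matrix.GeneralLinearGroup.mkOfDetNeZero _ hw) c]
    refine congrArg _ (plane_eq_of_smul (a := c 1) h1 ?_).symm
    ext i
    simp only [Matrix.vecMul, dot_four, h0, h2, h3]
    fin_cases i <;> simp [Matrix.GeneralLinearGroup.mkOfDetNeZero, sym3]

/-- A plane which meets the cubic in three points is equivalent to the one with the binary cubic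
form `x² y - x y²`. -/
theorem conj_of_numCubic_eq_three [DecidableEq F] {π : Set (Pt F)} (hπ : IsPlane π)
    (h : numCubic π = 3) : Conj (F := F) (plane ![0, 1, -1, 0]) π := by
  rw [numCubic_eq, Set.ncard_eq_three] at h
  obtain ⟨r, s, t, hrs, hrt, hst, h⟩ := h
  obtain ⟨g, hr, hs, ht⟩ := exists_smul_eq_triple hrs hrt hst
  have hc : Conj (F := F) ((moebius g)⁻¹ • π) π := ⟨g, by simp⟩
  have hmem (t : OnePoint F) : cubicPt t ∈ (moebius g)⁻¹ • π ↔
      t = OnePoint.infty ∨ t = ((0 : F) : OnePoint F) ∨ t = ((1 : F) : OnePoint F) := by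
    rw [← cubicPt_mem_moebius_smul (g := g), smul_inv_smul]
    change g • t ∈ {t | cubicPt t ∈ π} ↔ _
    rw [h, ← hr, ← hs, ← ht]
    simp
  obtain ⟨c, hc0, e⟩ := hc.isPlane.2 hπ
  rw [e] at hmem hc
  have h0 : c 0 = 0 := cubicPt_infty_mem_plane.1 ((hmem _).2 (Or.inl rfl))
  have h3 : c 3 = 0 := by simpa using cubicPt_coe_mem_plane.1 ((hmem _).2 (Or.inr (Or.inl rfl)))
  have h12 : c 1 + c 2 = 0 := by
    simpa [h0, h3] using cubicPt_coe_mem_plane.1 ((hmem _).2 (Or.inr (Or.inr rfl)))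
  have h2 : c 2 = - c 1 := by linear_combination h12
  rwa [plane_eq_of_smul (a := c 1) (c := c) (c' := ![0, 1, -1, 0])] at hc
  · rintro h1; apply hc0; ext i; fin_cases i <;> simp [h0, h1, h2, h3]
  · ext i; fin_cases i <;> simp [h0, h2, h3]

theorem conj_plane_of_vecMul {c c' : Fin 4 → F} (h : ∃ (g : GL (Fin 2) F) (k : F), k ≠ 0 ∧
    c' ᵥ* sym3 (g : Matrix (Fin 2) (Fin 2) F) = k • c) :
    Conj (F := F) (plane c) (plane c') := by
  obtain ⟨g, k, hk, h⟩ := h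
  refine ⟨g, ?_⟩
  rw [← plane_smul hk, ← h, moebius_smul_plane]

open Polynomial in
/-- The planes which miss the cubic are equivalent. -/
theorem conj_of_numCubic_eq_zero [DecidableEq F] [Finite F] {π π' : Set (Pt F)} (hπ : IsPlane π)
    (hπ' : IsPlane π') (h : numCubic π = 0) (h' : numCubic π' = 0) : Conj (F := F) π π' := by
  have key (c : Fin 4 → F) (h : numCubic (plane c) = 0) :
      Irreducible (formPoly c) ∧ (formPoly c).natDegree = 3 := by
    have hr (t : OnePoint F) : cubicPt t ∉ plane c := fun ht ↦ by
      exact numCubic_eq_zero.1 h t ht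
    have h0 : c 0 ≠ 0 := fun h0 ↦ hr _ (cubicPt_infty_mem_plane.2 h0)
    have hd : (formPoly c).natDegree = 3 := natDegree_cubic h0
    refine ⟨irreducible_of_degree_le_three_of_not_isRoot (by simp [hd]) fun t ht ↦ ?_, hd⟩
    exact hr _ (cubicPt_mem_plane.2 ((eval_formPoly c t).symm.trans ht))
  obtain ⟨c, hc, rfl⟩ := hπ
  obtain ⟨c', hc', rfl⟩ := hπ'
  obtain ⟨h1, h2⟩ := key c h
  obtain ⟨h3, h4⟩ := key c' h'
  exact conj_plane_of_vecMul (exists_vecMul_sym3_eq_smul h1 h3 (h2.trans h4.symm) (Or.inl h2))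

open Polynomial in
/-- The planes which meet the cubic in just one point without osculating it are equivalent. -/
theorem conj_of_numCubic_eq_one [DecidableEq F] [Finite F] {π π' : Set (Pt F)} (hπ : IsPlane π)
    (hπ' : IsPlane π') (h : numCubic π = 1) (h' : numCubic π' = 1) (ho : π ∉ developable F)
    (ho' : π' ∉ developable F) : Conj (F := F) π π' := by
  have key (π : Set (Pt F)) (hπ : IsPlane π) (h : numCubic π = 1) (ho : π ∉ developable F) :
      ∃ c : Fin 4 → F, Conj (F := F) (plane c) π ∧ c 0 = 0 ∧
      Irreducible (formPoly c) ∧ (formPoly c).natDegree = 2 := by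
    obtain ⟨r, hr⟩ : ∃ r : OnePoint F, cubicPt r ∈ π := by
      by_contra! hr
      have := numCubic_eq_zero.2 hr
      omega
    obtain ⟨π₁, hπ₁, hr⟩ := exists_conj_mem_infty hr
    obtain ⟨c, hc, rfl⟩ := hπ₁.isPlane.2 hπ
    rw [← hπ₁.numCubic_eq] at h
    rw [← hπ₁.mem_developable] at ho
    have h0 := cubicPt_infty_mem_plane.1 hr
    have hnr (t : F) : cubicPt (t : OnePoint F) ∉ plane c := fun ht ↦ by
      have := two_le_numCubic (OnePoint.infty_ne_coe t) hr ht; omega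
    -- otherwise `∞` would be a double root, and the third root would give a second point or
    -- osculation
    have h1 : c 1 ≠ 0 := by
      intro h1
      by_cases h2 : c 2 = 0
      · apply ho
        refine ⟨OnePoint.infty, ?_⟩
        change plane ![0, 0, 0, 1] = plane c
        refine (plane_eq_of_smul (a := c 3) ?_ ?_).symm
        · rintro h3; apply hc; ext i; fin_cases i <;> assumption
        · ext i; fin_cases i <;> simp [h0, h1, h2]
      · apply hnr (-c 3 / c 2)
        rw [cubicPt_coe_mem_plane, h0, h1]
        field_simp; ring
    have hd : (formPoly c).natDegree = 2 := by
      rw [formPoly, h0, C_0, zero_mul, zero_add]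
      exact natDegree_quadratic h1
    refine ⟨c, hπ₁, h0, irreducible_of_degree_le_three_of_not_isRoot (by simp [hd]) fun t ht ↦ ?_,
      hd⟩
    exact hnr _ (cubicPt_mem_plane.2 ((eval_formPoly c t).symm.trans ht))
  obtain ⟨c, hc, h0, h1, h2⟩ := key π hπ h ho
  obtain ⟨c', hc', h0', h3, h4⟩ := key π' hπ' h' ho'
  exact hc.symm.trans ((conj_plane_of_vecMul (exists_vecMul_sym3_eq_smul h1 h3
    (h2.trans h4.symm) (Or.inr ⟨h2, h0'⟩))).trans hc')

/-- Any two planes of the same class are equivalent. -/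
theorem conj_of_mem_N [DecidableEq F] [Finite F] {i : Fin 5} {π π' : Set (Pt F)} (h : π ∈ N F i)
    (h' : π' ∈ N F i) :
    Conj (F := F) π π' := by
  fin_cases i
  · obtain ⟨t, rfl⟩ := h
    obtain ⟨s, rfl⟩ := h'
    exact conj_oscPlane t s
  · exact (conj_of_numCubic_eq_two h.1 h.2).symm.trans (conj_of_numCubic_eq_two h'.1 h'.2)
  · exact (conj_of_numCubic_eq_three h.1 h.2).symm.trans (conj_of_numCubic_eq_three h'.1 h'.2)
  · exact conj_of_numCubic_eq_one h.1.1 h'.1.1 h.1.2 h'.1.2 h.2 h'.2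
  · exact conj_of_numCubic_eq_zero h.1 h'.1 h.2 h'.2

theorem isPlane_of_mem_N {i : Fin 5} {π : Set (Pt F)} (h : π ∈ N F i) : IsPlane π := by
  fin_cases i
  · obtain ⟨t, rfl⟩ := h
    exact isPlane_oscPlane t
  exacts [h.1, h.1, h.1.1, h.1]

/-- The number of common points of the cubic with a plane of each class. -/
def numN : Fin 5 → ℕ := ![1, 2, 3, 1, 0]

theorem numCubic_of_mem_N {i : Fin 5} {π : Set (Pt F)} (h : π ∈ N F i) :
    numCubic π = numN i := by
  fin_cases i
  · obtain ⟨t, rfl⟩ := h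
    exact numCubic_oscPlane t
  exacts [h.2, h.2, h.1.2, h.2]

theorem exists_mem_N [Finite F] {π : Set (Pt F)} (hπ : IsPlane π) : ∃ i, π ∈ N F i := by
  by_cases ho : π ∈ developable F
  · exact ⟨0, ho⟩
  have h := numCubic_le hπ
  interval_cases hn : numCubic π
  · exact ⟨4, hπ, hn⟩
  · exact ⟨3, ⟨hπ, hn⟩, ho⟩
  · exact ⟨1, hπ, hn⟩
  · exact ⟨2, hπ, hn⟩

theorem eq_of_mem_N {i j : Fin 5} {π : Set (Pt F)} (hi : π ∈ N F i) (hj : π ∈ N F j) : i = j := by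
  have h := (numCubic_of_mem_N hi).symm.trans (numCubic_of_mem_N hj)
  have h03 (h0 : π ∈ N F 0) (h3 : π ∈ N F 3) : False := h3.2 h0
  fin_cases i <;> fin_cases j <;> simp [numN] at h ⊢
  · exact h03 hi hj
  · exact h03 hj hi

theorem Conj.mem_N [DecidableEq F] {i : Fin 5} {π π' : Set (Pt F)} (h : Conj (F := F) π π')
    (hπ : π ∈ N F i) :
    π' ∈ N F i := by
  fin_cases i
  · exact h.mem_developable.1 hπ
  · exact ⟨h.isPlane.1 hπ.1, h.numCubic_eq.symm.trans hπ.2⟩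
  · exact ⟨h.isPlane.1 hπ.1, h.numCubic_eq.symm.trans hπ.2⟩
  · exact ⟨⟨h.isPlane.1 hπ.1.1, h.numCubic_eq.symm.trans hπ.1.2⟩, mt h.mem_developable.2 hπ.2⟩
  · exact ⟨h.isPlane.1 hπ.1, h.numCubic_eq.symm.trans hπ.2⟩

end Planes

/-! ### Double counting -/

section DoubleCounting

/-- Double counting of the pairs in a relation between two finite types. -/
theorem sum_ncard_comm {α β : Type*} [Fintype α] [Fintype β] (r : α → β → Prop) :
    ∑ a, {b | r a b}.ncard = ∑ b, {a | r a b}.ncard := by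
  classical
  simp only [Set.ncard_eq_toFinset_card', Set.toFinset_ofPred]
  exact Finset.sum_card_bipartiteAbove_eq_sum_card_bipartiteBelow r

/-- The number of embeddings of `Fin k` with values in a set. -/
theorem ncard_embedding_mem {α : Type*} [Finite α] (k : ℕ) (S : Set α) :
    {e : Fin k ↪ α | ∀ i, e i ∈ S}.ncard = S.ncard.descFactorial k := by
  classical
  have := Fintype.ofFinite α
  have := Fintype.ofFinite S
  rw [← Nat.card_coe_set_eq, ← Nat.card_coe_set_eq,
    show Nat.card {e : Fin k ↪ α | ∀ i, e i ∈ S} = Nat.card (Fin k ↪ S) from Nat.card_congr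
      (Equiv.codRestrict (Fin k) S),
    Nat.card_eq_fintype_card, Fintype.card_embedding_eq, Fintype.card_fin,
    Nat.card_eq_fintype_card]

end DoubleCounting

/-! ### The sizes of the classes of planes -/

section PlaneCounts

variable {F : Type*} [Field F]

theorem linearIndependent_cubicVec : ∀ {k : ℕ}, k ≤ 4 → ∀ (e : Fin k ↪ OnePoint F),
    LinearIndependent F (fun i ↦ cubicVec (e i))
  | 0, _, e => linearIndependent_empty_type
  | 1, _, e => by
    convert linearIndependent_cubicVec_one (e 0) with i
    fin_cases i; rfl
  | 2, _, e => by
    convert linearIndependent_cubicVec_two (e.injective.ne (show (0 : Fin 2) ≠ 1 by decide)) with i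
    fin_cases i <;> rfl
  | 3, _, e => by
    convert linearIndependent_cubicVec_three (e.injective.ne (show (0 : Fin 3) ≠ 1 by decide))
      (e.injective.ne (show (0 : Fin 3) ≠ 2 by decide))
      (e.injective.ne (show (1 : Fin 3) ≠ 2 by decide)) with i
    fin_cases i <;> rfl
  | 4, _, e => linearIndependent_cubicVec_four e.injective

/-- The plane whose coordinate vector represents a given point of `PG(3,q)`; this identifies the
points of the dual space with the planes. -/
def dualPlane (Q : Pt F) : Set (Pt F) := plane Q.rep

theorem isPlane_dualPlane (Q : Pt F) : IsPlane (dualPlane Q) := ⟨_, Q.rep_nonzero, rfl⟩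

theorem exists_dualPlane_eq {π : Set (Pt F)} (hπ : IsPlane π) : ∃ Q, dualPlane Q = π := by
  obtain ⟨c, hc, rfl⟩ := hπ
  obtain ⟨a, ha, h⟩ := exists_smul_rep hc
  exact ⟨_, (plane_eq_of_smul ha h).symm⟩

theorem ncard_plane [Finite F] {π : Set (Pt F)} (hπ : IsPlane π) :
    π.ncard = Nat.card F ^ 2 + Nat.card F + 1 := by
  obtain ⟨c, hc, rfl⟩ := hπ
  have h := ncard_forall_dot_eq_zero (c := ![c]) (by simpa using hc)
  simp [Finset.sum_range_succ] at h
  rw [plane, h]; ring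

theorem ncard_dualPlane_inter [Finite F] {Q Q' : Pt F} (h : Q ≠ Q') :
    (dualPlane Q ∩ dualPlane Q').ncard = Nat.card F + 1 := by
  have h := ncard_forall_dot_eq_zero ((Projectivization.linearIndependent_pair_iff_ne).2 h)
  simp [Finset.sum_range_succ] at h
  rw [add_comm, ← h]
  rfl

theorem dualPlane_injective [Finite F] : Function.Injective (dualPlane : Pt F → Set (Pt F)) := by
  intro Q Q' h
  by_contra hne
  have h1 := ncard_dualPlane_inter hne
  rw [← h, Set.inter_self, ncard_plane (isPlane_dualPlane Q)] at h1
  have : 0 < Nat.card F := Nat.card_pos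
  nlinarith

theorem ncard_inter_of_ne [Finite F] {π π' : Set (Pt F)} (hπ : IsPlane π) (hπ' : IsPlane π')
    (h : π ≠ π') : (π ∩ π').ncard = Nat.card F + 1 := by
  obtain ⟨Q, rfl⟩ := exists_dualPlane_eq hπ
  obtain ⟨Q', rfl⟩ := exists_dualPlane_eq hπ'
  exact ncard_dualPlane_inter (fun e ↦ h (by rw [e]))

theorem card_pt [Finite F] :
    Nat.card (Pt F) = Nat.card F ^ 3 + Nat.card F ^ 2 + Nat.card F + 1 := by
  rw [Projectivization.card_of_finrank F (Fin 4 → F) (n := 4) (by simp)]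
  simp [Finset.sum_range_succ]; ring

/-- The planes through `k ≤ 4` given points of the cubic. -/
theorem ncard_planes_through [Finite F] {k : ℕ} (hk : k ≤ 4) (e : Fin k ↪ OnePoint F) :
    {Q : Pt F | ∀ i, cubicPt (e i) ∈ dualPlane Q}.ncard =
      ∑ j ∈ Finset.range (4 - k), Nat.card F ^ j := by
  rw [← ncard_forall_dot_eq_zero (linearIndependent_cubicVec hk e)]
  congr 1
  ext Q
  simp only [Set.mem_ofPred_eq, dualPlane, cubicPt_mem_plane, dotProduct_comm]

/-- The factorial moments of the number of points in which a plane meets the cubic. -/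
theorem sum_descFactorial_numCubic [Finite F] [Fintype (Pt F)] {k : ℕ} (hk : k ≤ 4) :
    ∑ Q : Pt F, (numCubic (dualPlane Q)).descFactorial k =
      (Nat.card F + 1).descFactorial k * ∑ j ∈ Finset.range (4 - k), Nat.card F ^ j := by
  have := Fintype.ofFinite (Fin k ↪ OnePoint F)
  have h := sum_ncard_comm (fun (Q : Pt F) (e : Fin k ↪ OnePoint F) ↦
    ∀ i, cubicPt (e i) ∈ dualPlane Q)
  simp only [ncard_planes_through hk, Finset.sum_const, smul_eq_mul, Finset.card_univ] at h
  have h1 (Q : Pt F) : {e : Fin k ↪ OnePoint F | ∀ i, cubicPt (e i) ∈ dualPlane Q}.ncard =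
      (numCubic (dualPlane Q)).descFactorial k := by
    rw [numCubic_eq, ← ncard_embedding_mem]
    rfl
  simp only [h1] at h
  have h2 := ncard_embedding_mem k (Set.univ : Set (OnePoint F))
  simp only [Set.mem_univ, implies_true, Set.ncard_univ] at h2
  rw [h, ← card_onePoint, ← h2, ← Nat.card_eq_fintype_card, ← Set.ncard_univ]
  congr 1

theorem card_N_eq [Finite F] (i : Fin 5) :
    Nat.card (N F i) = {Q : Pt F | dualPlane Q ∈ N F i}.ncard := by
  rw [Nat.card_coe_set_eq, ← Set.ncard_image_of_injective _ dualPlane_injective]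
  congr 1
  ext π
  constructor
  · intro h
    obtain ⟨Q, rfl⟩ := exists_dualPlane_eq (isPlane_of_mem_N h)
    exact ⟨Q, h, rfl⟩
  · rintro ⟨Q, h, rfl⟩
    exact h

/-- A sum over a finite type which is partitioned into classes. -/
theorem sum_eq_sum_classes {α ι : Type*} [Fintype α] [Fintype ι] (C : ι → Set α)
    (hex : ∀ a, ∃ i, a ∈ C i) (huniq : ∀ a i j, a ∈ C i → a ∈ C j → i = j) (f : α → ℕ) (g : ι → ℕ)
    (hfg : ∀ i, ∀ a ∈ C i, f a = g i) : ∑ a, f a = ∑ i, (C i).ncard * g i := by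
  classical
  choose cls hcls using hex
  rw [← Finset.sum_fiberwise (s := Finset.univ) (g := cls) (f := f)]
  refine Finset.sum_congr rfl fun i _ ↦ ?_
  have : Finset.univ.filter (fun a ↦ cls a = i) = (C i).toFinset := by
    ext a
    simp only [Finset.mem_filter, Finset.mem_univ, true_and, Set.mem_toFinset]
    exact ⟨fun h ↦ h ▸ hcls a, fun h ↦ huniq a _ _ (hcls a) h⟩
  rw [this, Set.ncard_eq_toFinset_card', ← smul_eq_mul, ← Finset.sum_const]
  exact Finset.sum_congr rfl fun a ha ↦ hfg i a (by simpa using ha)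

theorem card_developable [Finite F] : Nat.card (N F 0) = Nat.card F + 1 := by
  change Nat.card (Set.range oscPlane) = _
  rw [Nat.card_range_of_injective oscPlane_injective, card_onePoint]

/-- The sizes of the five classes of planes: the factorial moments of order `0`, `1`, `2`, `3` of
the number of points on the cubic give four linear equations, and there are `q + 1` osculating
planes. -/
theorem card_N [Finite F] (i : Fin 5) : (Nat.card (N F i) : ℚ) = sizeN (Nat.card F) i := by
  have := Fintype.ofFinite (Pt F)
  have key {k : ℕ} (hk : k ≤ 4) := (sum_eq_sum_classes (fun i ↦ {Q : Pt F | dualPlane Q ∈ N F i})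
    (fun Q ↦ exists_mem_N (isPlane_dualPlane Q)) (fun Q i j hi hj ↦ eq_of_mem_N hi hj)
    (fun Q ↦ (numCubic (dualPlane Q)).descFactorial k) (fun i ↦ (numN i).descFactorial k)
    (fun i Q hQ ↦ by rw [numCubic_of_mem_N hQ])).symm.trans (sum_descFactorial_numCubic hk)
  simp only [← card_N_eq] at key
  -- the substitution `|F| = q + 1` removes the truncated subtractions in the falling factorials
  obtain ⟨q, hq⟩ : ∃ q, Nat.card F = q + 1 := ⟨Nat.card F - 1, by
    have : 0 < Nat.card F := Nat.card_pos
    omega⟩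
  have e0 := key (k := 0) (by omega)
  have e1 := key (k := 1) (by omega)
  have e2 := key (k := 2) (by omega)
  have e3 := key (k := 3) (by omega)
  have e := card_developable (F := F)
  simp [Fin.sum_univ_five, numN, Finset.sum_range_succ, Nat.descFactorial, hq] at e0 e1 e2 e3 e
  rw [Nat.card_coe_set_eq, hq]
  qify at e0 e1 e2 e3 e
  fin_cases i <;> simp [sizeN] <;> linarith

end PlaneCounts

/-! ### Tangents and real chords -/

section Lines

variable {F : Type*} [Field F]

theorem mem_join {u w : Fin 4 → F} {P : Pt F} :
    P ∈ join u w ↔ ∃ a b : F, a • u + b • w = P.rep := Submodule.mem_span_pair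

theorem ncard_join [Finite F] {u w : Fin 4 → F} (h : LinearIndependent F ![u, w]) :
    (join u w).ncard = Nat.card F + 1 := by
  have e : Module.finrank F (Submodule.span F {u, w}) = 2 := by
    have := finrank_span_eq_card h
    rwa [Matrix.range_cons_cons_empty, Fintype.card_fin] at this
  rw [join, ncard_rep_mem, e]
  simp [Finset.sum_range_succ, add_comm]

theorem join_subset_plane {u w c : Fin 4 → F} (hu : c ⬝ᵥ u = 0) (hw : c ⬝ᵥ w = 0) :
    join u w ⊆ plane c := by
  intro P hP
  obtain ⟨a, b, h⟩ := mem_join.1 hP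
  rw [mem_plane, ← h]
  simp [hu, hw]

/-- A line meets a plane which does not contain it in exactly one point. -/
theorem ncard_join_inter_plane {u w c : Fin 4 → F} (h : LinearIndependent F ![u, w])
    (hc : c ⬝ᵥ u ≠ 0 ∨ c ⬝ᵥ w ≠ 0) : (join u w ∩ plane c).ncard = 1 := by
  have hv : (c ⬝ᵥ w) • u + (-(c ⬝ᵥ u)) • w ≠ 0 := by
    intro h0
    have := LinearIndependent.pair_iff.1 h _ _ h0
    simp [this.1] at hc
    simp [hc] at this
  rw [Set.ncard_eq_one]
  refine ⟨Projectivization.mk F _ hv, ?_⟩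
  ext P
  rw [Set.mem_singleton_iff]
  constructor
  · rintro ⟨hP, hPc⟩
    obtain ⟨a, b, e⟩ := mem_join.1 hP
    rw [mem_plane, ← e] at hPc
    simp at hPc
    rw [← P.mk_rep, Projectivization.mk_eq_mk_iff']
    rw [← e]
    rcases hc with hc | hc
    · refine ⟨-b / (c ⬝ᵥ u), ?_⟩
      ext i
      simp
      field_simp
      linear_combination (-u i) * hPc
    · refine ⟨a / (c ⬝ᵥ w), ?_⟩
      ext i
      simp
      field_simp
      linear_combination (-w i) * hPc
  · rintro rfl
    refine ⟨(mk_mem_join hv).2 (Submodule.mem_span_pair.2 ⟨_, _, rfl⟩), (mk_mem_plane hv).2 ?_⟩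
    simp; ring

theorem eq_cubicPt {P : Pt F} {t : OnePoint F} {a : F} (h : P.rep = a • cubicVec t) :
    P = cubicPt t := by
  rw [← P.mk_rep, cubicPt, Projectivization.mk_eq_mk_iff']
  exact ⟨a, h.symm⟩

theorem cubicPt_mem_tangent (t : OnePoint F) : cubicPt t ∈ tangent t :=
  cubicPt_mem_join.2 (Submodule.subset_span (by simp))

theorem cubicPt_mem_realChord_left (s t : OnePoint F) : cubicPt s ∈ realChord s t :=
  cubicPt_mem_join.2 (Submodule.subset_span (by simp))

theorem cubicPt_mem_realChord_right (s t : OnePoint F) : cubicPt t ∈ realChord s t :=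
  cubicPt_mem_join.2 (Submodule.subset_span (by simp))

theorem form3_dot_cubicVec_eq_zero_of {p q r x : OnePoint F} (h : p = x ∨ q = x ∨ r = x) :
    form3 (hom p) (hom q) (hom r) ⬝ᵥ cubicVec x = 0 := form3_dot_cubicVec_eq_zero.2 h

/-- Two tangents meet at most in a point of the cubic: the form with the double root `s` and the
simple root `t` vanishes on the tangent at `s`, but on the tangent at `t` only in `P(t)`. -/
theorem mem_cubic_of_mem_two_tangents {P : Pt F} {s t : OnePoint F} (hst : s ≠ t)
    (hs : P ∈ tangent s) (ht : P ∈ tangent t) : P ∈ cubic F := by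
  obtain ⟨a, b, h⟩ := mem_join.1 hs
  obtain ⟨a', b', h'⟩ := mem_join.1 ht
  have e := congrArg (form3 (hom t) (hom s) (hom s) ⬝ᵥ ·) (h.trans h'.symm)
  have e1 : form3 (hom t) (hom s) (hom s) ⬝ᵥ tangentVec s = 0 := by
    rw [tangentVec_eq, form3_dot_tan, bracket_hom_self]; ring
  simp only [dotProduct_add, dotProduct_smul, e1, form3_dot_cubicVec_eq_zero_of (p := t) (q := s)
    (r := s) (x := s) (by simp), form3_dot_cubicVec_eq_zero_of (p := t) (q := s)
    (r := s) (x := t) (by simp), mul_zero, zero_add, smul_eq_mul, zero_eq_mul,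
    form3_dot_tangentVec_single hst hst, or_false] at e
  rw [e, zero_smul, add_zero] at h'
  exact ⟨t, (eq_cubicPt h'.symm).symm⟩

/-- A real chord and a tangent meet at most in a point of the cubic: the form with a double root at
`r` and a root at one end point of the chord vanishes on the tangent, but on the chord only in that
end point. -/
theorem mem_cubic_of_mem_realChord_of_mem_tangent {P : Pt F} {s t r : OnePoint F} (hst : s ≠ t)
    (h : P ∈ realChord s t) (hr : P ∈ tangent r) : P ∈ cubic F := by
  have key {s t : OnePoint F} (hst : s ≠ t) (hsr : r ≠ s) (h : P ∈ realChord s t) :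
      P ∈ cubic F := by
    obtain ⟨a, b, h⟩ := mem_join.1 h
    obtain ⟨a', b', h'⟩ := mem_join.1 hr
    have e := congrArg (form3 (hom r) (hom r) (hom t) ⬝ᵥ ·) (h.trans h'.symm)
    have e1 : form3 (hom r) (hom r) (hom t) ⬝ᵥ cubicVec s ≠ 0 := by
      rw [Ne, form3_dot_cubicVec_eq_zero]; simp [hsr, hst.symm]
    simp only [dotProduct_add, dotProduct_smul, form3_dot_tangentVec,
      form3_dot_cubicVec_eq_zero_of (p := r) (q := r) (r := t) (x := r) (by simp),
      form3_dot_cubicVec_eq_zero_of (p := r) (q := r) (r := t) (x := t) (by simp), mul_zero,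
      add_zero, smul_eq_mul, mul_eq_zero, e1, or_false] at e
    rw [e, zero_smul, zero_add] at h
    exact ⟨t, (eq_cubicPt h.symm).symm⟩
  by_cases hrs : r = s
  · refine key hst.symm (hrs ▸ hst) ?_
    rwa [realChord, join, Set.pair_comm]
  · exact key hst hrs h

/-- Two real chords through a point off the cubic have their end points in common: the form with the
roots `s`, `t`, `t'` vanishes on the first chord, but on the second only in `P(t')`, unless it
vanishes in `P(s')`. -/
theorem eq_or_eq_of_mem_realChord {P : Pt F} (hP : P ∉ cubic F) {s t s' t' : OnePoint F}
    (hst' : s' ≠ t') (h : P ∈ realChord s t) (h' : P ∈ realChord s' t') :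
    s' = s ∨ s' = t := by
  by_contra! hne
  obtain ⟨a, b, h⟩ := mem_join.1 h
  obtain ⟨a', b', h'⟩ := mem_join.1 h'
  have e := congrArg (form3 (hom s) (hom t) (hom t') ⬝ᵥ ·) (h.trans h'.symm)
  have e1 : form3 (hom s) (hom t) (hom t') ⬝ᵥ cubicVec s' ≠ 0 := by
    rw [Ne, form3_dot_cubicVec_eq_zero]; simp [hne.1.symm, hne.2.symm, hst'.symm]
  simp only [dotProduct_add, dotProduct_smul,
    form3_dot_cubicVec_eq_zero_of (p := s) (q := t) (r := t') (x := s) (by simp),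
    form3_dot_cubicVec_eq_zero_of (p := s) (q := t) (r := t') (x := t) (by simp),
    form3_dot_cubicVec_eq_zero_of (p := s) (q := t) (r := t') (x := t') (by simp), mul_zero,
    add_zero, smul_eq_mul, zero_eq_mul, e1, or_false] at e
  rw [e, zero_smul, zero_add] at h'
  exact hP ⟨t', (eq_cubicPt h'.symm).symm⟩

theorem cubicPt_mem_tangent_iff {s t : OnePoint F} : cubicPt s ∈ tangent t ↔ s = t := by
  constructor
  · intro h
    have := join_subset_plane (c := form3 (hom t) (hom t) (hom t))
      (form3_dot_cubicVec_eq_zero_of (by simp)) (form3_dot_tangentVec t t) h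
    rw [cubicPt_mem_plane, form3_dot_cubicVec_eq_zero] at this
    simpa [eq_comm] using this
  · rintro rfl
    exact cubicPt_mem_tangent s

theorem cubicPt_mem_realChord_iff {r s t : OnePoint F} (hst : s ≠ t) :
    cubicPt r ∈ realChord s t ↔ r = s ∨ r = t := by
  constructor
  · intro h
    have := join_subset_plane (c := form3 (hom s) (hom t) (hom t))
      (form3_dot_cubicVec_eq_zero_of (by simp)) (form3_dot_cubicVec_eq_zero_of (by simp)) h
    rw [cubicPt_mem_plane, form3_dot_cubicVec_eq_zero] at this
    simpa [eq_comm] using this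
  · rintro (rfl | rfl)
    · exact cubicPt_mem_realChord_left _ _
    · exact cubicPt_mem_realChord_right _ _

theorem tangent_subset_plane_iff {t : OnePoint F} {c : Fin 4 → F} :
    tangent t ⊆ plane c ↔ c ⬝ᵥ cubicVec t = 0 ∧ c ⬝ᵥ tangentVec t = 0 := by
  constructor
  · intro h
    have ht : tangentVec t ≠ 0 := (linearIndependent_tangent t).ne_zero 1
    exact ⟨cubicPt_mem_plane.1 (h (cubicPt_mem_tangent t)),
      (mk_mem_plane ht).1 (h ((mk_mem_join ht).2 (Submodule.subset_span (by simp))))⟩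
  · exact fun h ↦ join_subset_plane h.1 h.2

end Lines

/-! ### Points on tangents and real chords -/

section PointsOnTangentsAndChords

variable {F : Type*} [Field F]

theorem ncard_eq_sum {α : Type*} [Fintype α] (S : Set α) [DecidablePred (· ∈ S)] :
    S.ncard = ∑ a, if a ∈ S then 1 else 0 := by
  rw [Set.ncard_eq_toFinset_card', Finset.sum_boole]
  simp

open Classical in
/-- A plane contains all `q` points off the cubic of a tangent, or just one of them, or only the
point of contact. -/
theorem ncard_tangent_inter [Finite F] {π : Set (Pt F)} (hπ : IsPlane π) (t : OnePoint F) :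
    {P | P ∈ tangent t ∧ P ∉ cubic F ∧ P ∈ π}.ncard =
      (if tangent t ⊆ π then 1 else 0) * Nat.card F + if cubicPt t ∉ π then 1 else 0 := by
  have e : {P | P ∈ tangent t ∧ P ∉ cubic F ∧ P ∈ π} = (tangent t ∩ π) \ {cubicPt t} := by
    ext P
    constructor
    · rintro ⟨h1, h2, h3⟩
      exact ⟨⟨h1, h3⟩, by rintro rfl; exact h2 ⟨t, rfl⟩⟩
    · rintro ⟨⟨h1, h3⟩, h2⟩
      refine ⟨h1, ?_, h3⟩
      rintro ⟨s, rfl⟩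
      exact h2 (by rw [cubicPt_mem_tangent_iff.1 h1]; rfl)
  obtain ⟨c, hc, rfl⟩ := hπ
  rw [e]
  by_cases h : tangent t ⊆ plane c
  · have h' : cubicPt t ∈ plane c := h (cubicPt_mem_tangent t)
    rw [Set.inter_eq_left.2 h, Set.ncard_sdiff_singleton_of_mem (cubicPt_mem_tangent t), tangent,
      ncard_join (linearIndependent_tangent t)]
    rw [tangent] at h
    simp [h, h']
  · have h1 : (tangent t ∩ plane c).ncard = 1 := by
      refine ncard_join_inter_plane (linearIndependent_tangent t) ?_
      rw [tangent_subset_plane_iff] at h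
      tauto
    by_cases h' : cubicPt t ∈ plane c
    · rw [Set.ncard_sdiff_singleton_of_mem (Set.mem_inter (cubicPt_mem_tangent t) h'), h1]
      simp [h, h']
    · rw [Set.sdiff_singleton_eq_self (fun h2 ↦ h' h2.2), h1]
      simp [h, h']

/-- The number of tangents in a set of points. -/
noncomputable def numTangents (π : Set (Pt F)) : ℕ := {t | tangent t ⊆ π}.ncard

theorem ncard_cubicPt_notMem [Finite F] (π : Set (Pt F)) :
    {t | cubicPt t ∉ π}.ncard = Nat.card F + 1 - numCubic π := by
  rw [numCubic_eq, ← card_onePoint, ← Set.ncard_compl]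
  rfl

/-- The points off the cubic on the tangents may be counted tangent by tangent. -/
theorem ncard_inter_tangentPts_eq_sum [Finite F] [Fintype (OnePoint F)] (π : Set (Pt F)) :
    (π ∩ tangentPts F).ncard =
      ∑ t : OnePoint F, {P | P ∈ tangent t ∧ P ∉ cubic F ∧ P ∈ π}.ncard := by
  classical
  have := Fintype.ofFinite (Pt F)
  rw [sum_ncard_comm, ncard_eq_sum]
  refine Finset.sum_congr rfl fun P _ ↦ ?_
  split_ifs with hP
  · obtain ⟨h1, h2, t, ht⟩ := hP
    symm
    rw [Set.ncard_eq_one]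
    refine ⟨t, ?_⟩
    ext s
    constructor
    · rintro ⟨hs, -, -⟩
      by_contra hne
      exact h2 (mem_cubic_of_mem_two_tangents hne hs ht)
    · rintro rfl
      exact ⟨ht, h2, h1⟩
  · symm
    rw [Set.ncard_eq_zero (Set.toFinite _), Set.eq_empty_iff_forall_notMem]
    rintro t ⟨h1, h2, h3⟩
    exact hP ⟨h3, h2, t, h1⟩

/-- The number of points off the cubic which a plane has in common with the tangents. -/
theorem ncard_inter_tangentPts [Finite F] {π : Set (Pt F)} (hπ : IsPlane π) :
    (π ∩ tangentPts F).ncard =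
      numTangents π * Nat.card F + (Nat.card F + 1 - numCubic π) := by
  classical
  have := Fintype.ofFinite (OnePoint F)
  have e1 := ncard_eq_sum {t : OnePoint F | tangent t ⊆ π}
  have e2 := ncard_eq_sum {t : OnePoint F | cubicPt t ∉ π}
  simp only [Set.mem_ofPred_eq] at e1 e2
  rw [ncard_inter_tangentPts_eq_sum]
  simp only [ncard_tangent_inter hπ, Finset.sum_add_distrib, ← Finset.sum_mul]
  rw [numTangents, ← ncard_cubicPt_notMem, e1, e2]

theorem ncard_tangentPts [Finite F] :
    (tangentPts F).ncard = (Nat.card F + 1) * Nat.card F := by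
  have := Fintype.ofFinite (OnePoint F)
  rw [← Set.univ_inter (tangentPts F), ncard_inter_tangentPts_eq_sum]
  have e (t : OnePoint F) :
      {P | P ∈ tangent t ∧ P ∉ cubic F ∧ P ∈ Set.univ}.ncard = Nat.card F := by
    have : {P | P ∈ tangent t ∧ P ∉ cubic F ∧ P ∈ Set.univ} = tangent t \ {cubicPt t} := by
      ext P
      constructor
      · rintro ⟨h1, h2, -⟩
        exact ⟨h1, by rintro rfl; exact h2 ⟨t, rfl⟩⟩
      · rintro ⟨h1, h2⟩
        refine ⟨h1, ?_, trivial⟩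
        rintro ⟨s, rfl⟩
        exact h2 (by rw [cubicPt_mem_tangent_iff.1 h1]; rfl)
    rw [this, Set.ncard_sdiff_singleton_of_mem (cubicPt_mem_tangent t), tangent,
      ncard_join (linearIndependent_tangent t), Nat.add_sub_cancel]
  simp only [e, Finset.sum_const, smul_eq_mul, Finset.card_univ]
  rw [← Nat.card_eq_fintype_card, card_onePoint]

/-- The embedding of `Fin 2` given by two distinct elements. -/
def pairEmb {α : Type*} {s t : α} (h : s ≠ t) : Fin 2 ↪ α where
  toFun := ![s, t]
  inj' i j hij := by
    fin_cases i <;> fin_cases j <;> simp_all [h.symm]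

/-- The points off the cubic on the real chords may be counted chord by chord; every such point is
counted twice, once for each order of the end points of its chord. -/
theorem ncard_inter_realChordPts_eq_sum [Finite F] [Fintype (Fin 2 ↪ OnePoint F)]
    (π : Set (Pt F)) :
    (π ∩ realChordPts F).ncard * 2 = ∑ e : Fin 2 ↪ OnePoint F,
      {P | P ∈ realChord (e 0) (e 1) ∧ P ∉ cubic F ∧ P ∈ π}.ncard := by
  classical
  have := Fintype.ofFinite (Pt F)
  rw [sum_ncard_comm, ncard_eq_sum, Finset.sum_mul]
  refine Finset.sum_congr rfl fun P _ ↦ ?_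
  split_ifs with hP
  · obtain ⟨h1, h2, s, t, hst, hP⟩ := hP
    have hP' : P ∈ realChord t s := by rwa [realChord, join, Set.pair_comm]
    symm
    rw [one_mul, Set.ncard_eq_two]
    refine ⟨pairEmb hst, pairEmb hst.symm, ?_, ?_⟩
    · intro h
      exact hst (congrArg (· 0) h)
    · ext e
      constructor
      · rintro ⟨he, -, -⟩
        have hne : e 0 ≠ e 1 := e.injective.ne (by decide)
        have he' : P ∈ realChord (e 1) (e 0) := by rwa [realChord, join, Set.pair_comm]
        have h3 := eq_or_eq_of_mem_realChord h2 hne hP he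
        have h4 := eq_or_eq_of_mem_realChord h2 hne.symm hP he'
        rcases h3 with h3 | h3 <;> rcases h4 with h4 | h4
        · exact absurd (h3.trans h4.symm) hne
        · left; ext i; fin_cases i <;> assumption
        · right; ext i; fin_cases i <;> assumption
        · exact absurd (h3.trans h4.symm) hne
      · rintro (rfl | rfl)
        · exact ⟨hP, h2, h1⟩
        · exact ⟨hP', h2, h1⟩
  · symm
    rw [zero_mul, Set.ncard_eq_zero (Set.toFinite _), Set.eq_empty_iff_forall_notMem]
    rintro e ⟨h1, h2, h3⟩
    exact hP ⟨h3, h2, e 0, e 1, e.injective.ne (by decide), h1⟩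

open Classical in
/-- A plane contains the `q - 1` points off the cubic of a real chord if it contains both end
points, none of them if it contains one end point, and one of them otherwise. -/
theorem ncard_realChord_inter [Finite F] {π : Set (Pt F)} (hπ : IsPlane π) {s t : OnePoint F}
    (hst : s ≠ t) :
    {P | P ∈ realChord s t ∧ P ∉ cubic F ∧ P ∈ π}.ncard =
      (if cubicPt s ∈ π ∧ cubicPt t ∈ π then 1 else 0) * (Nat.card F - 1) +
        if cubicPt s ∉ π ∧ cubicPt t ∉ π then 1 else 0 := by
  have e : {P | P ∈ realChord s t ∧ P ∉ cubic F ∧ P ∈ π} =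
      (realChord s t ∩ π) \ {cubicPt s, cubicPt t} := by
    ext P
    constructor
    · rintro ⟨h1, h2, h3⟩
      exact ⟨⟨h1, h3⟩, by rintro (rfl | rfl) <;> exact h2 ⟨_, rfl⟩⟩
    · rintro ⟨⟨h1, h3⟩, h2⟩
      refine ⟨h1, ?_, h3⟩
      rintro ⟨r, rfl⟩
      rcases (cubicPt_mem_realChord_iff hst).1 h1 with rfl | rfl <;> simp at h2
  have hs := cubicPt_mem_realChord_left s t
  have ht := cubicPt_mem_realChord_right s t
  have hli := linearIndependent_cubicVec_two hst
  obtain ⟨c, hc, rfl⟩ := hπ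
  rw [e]
  by_cases h1 : cubicPt s ∈ plane c
  · by_cases h2 : cubicPt t ∈ plane c
    · have h : realChord s t ⊆ plane c :=
        join_subset_plane (cubicPt_mem_plane.1 h1) (cubicPt_mem_plane.1 h2)
      rw [Set.inter_eq_left.2 h, Set.ncard_sdiff (by simp [Set.insert_subset_iff, hs, ht]),
        Set.ncard_pair (cubicPt_injective.ne hst), realChord, ncard_join hli]
      simp [h1, h2]
    · have h : (realChord s t ∩ plane c).ncard = 1 :=
        ncard_join_inter_plane hli (Or.inr (mt cubicPt_mem_plane.2 h2))
      obtain ⟨P, hP⟩ := Set.ncard_eq_one.1 h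
      have hP' : P = cubicPt s := by
        have : cubicPt s ∈ realChord s t ∩ plane c := ⟨hs, h1⟩
        rw [hP] at this
        exact this.symm
      rw [hP, hP', Set.sdiff_eq_empty.2 (by simp)]
      simp [h1, h2]
  · have h : (realChord s t ∩ plane c).ncard = 1 :=
      ncard_join_inter_plane hli (Or.inl (mt cubicPt_mem_plane.2 h1))
    by_cases h2 : cubicPt t ∈ plane c
    · obtain ⟨P, hP⟩ := Set.ncard_eq_one.1 h
      have hP' : P = cubicPt t := by
        have : cubicPt t ∈ realChord s t ∩ plane c := ⟨ht, h2⟩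
        rw [hP] at this
        exact this.symm
      rw [hP, hP', Set.sdiff_eq_empty.2 (by simp)]
      simp [h1, h2]
    · rw [sdiff_eq_left.2, h]
      · simp [h1, h2]
      · rw [Set.disjoint_right]
        rintro P (rfl | rfl) ⟨-, h3⟩
        exacts [h1 h3, h2 h3]

/-- The number of points off the cubic which a plane has in common with the real chords. -/
theorem ncard_inter_realChordPts [Finite F] {π : Set (Pt F)} (hπ : IsPlane π) :
    (π ∩ realChordPts F).ncard * 2 =
      (numCubic π).descFactorial 2 * (Nat.card F - 1) +
        (Nat.card F + 1 - numCubic π).descFactorial 2 := by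
  classical
  have := Fintype.ofFinite (Fin 2 ↪ OnePoint F)
  have e1 := ncard_embedding_mem 2 {t : OnePoint F | cubicPt t ∈ π}
  have e2 := ncard_embedding_mem 2 {t : OnePoint F | cubicPt t ∉ π}
  simp only [Set.mem_ofPred_eq] at e1 e2
  rw [ncard_inter_realChordPts_eq_sum, numCubic_eq, ← e1, ← numCubic_eq, ← ncard_cubicPt_notMem,
    ← e2, ncard_eq_sum, ncard_eq_sum, Finset.sum_mul, ← Finset.sum_add_distrib]
  refine Finset.sum_congr rfl fun e _ ↦ ?_
  rw [ncard_realChord_inter hπ (e.injective.ne (by decide))]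
  simp only [Set.mem_ofPred_eq, Fin.forall_fin_two]

/-- Twice the number of points off the cubic on the real chords, so that all ordered pairs of end
points may be counted. -/
theorem ncard_realChordPts [Finite F] :
    (realChordPts F).ncard * 2 = (Nat.card F + 1).descFactorial 2 * (Nat.card F - 1) := by
  have := Fintype.ofFinite (Fin 2 ↪ OnePoint F)
  rw [← Set.univ_inter (realChordPts F), ncard_inter_realChordPts_eq_sum]
  have key (e : Fin 2 ↪ OnePoint F) :
      {P | P ∈ realChord (e 0) (e 1) ∧ P ∉ cubic F ∧ P ∈ Set.univ}.ncard = Nat.card F - 1 := by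
    have hne : e 0 ≠ e 1 := e.injective.ne (by decide)
    have : {P | P ∈ realChord (e 0) (e 1) ∧ P ∉ cubic F ∧ P ∈ Set.univ} =
        realChord (e 0) (e 1) \ {cubicPt (e 0), cubicPt (e 1)} := by
      ext P
      constructor
      · rintro ⟨h1, h2, -⟩
        exact ⟨h1, by rintro (rfl | rfl) <;> exact h2 ⟨_, rfl⟩⟩
      · rintro ⟨h1, h2⟩
        refine ⟨h1, ?_, trivial⟩
        rintro ⟨r, rfl⟩
        rcases (cubicPt_mem_realChord_iff hne).1 h1 with h | h <;> simp [h] at h2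
    rw [this, Set.ncard_sdiff (by simp [Set.insert_subset_iff, cubicPt_mem_realChord_left,
      cubicPt_mem_realChord_right]), Set.ncard_pair (cubicPt_injective.ne hne), realChord,
      ncard_join (linearIndependent_cubicVec_two hne)]
    omega
  have h2 := ncard_embedding_mem 2 (Set.univ : Set (OnePoint F))
  simp only [Set.mem_univ, implies_true, Set.ncard_univ] at h2
  simp only [key, Finset.sum_const, smul_eq_mul, Finset.card_univ]
  rw [← card_onePoint, ← h2, ← Nat.card_eq_fintype_card, ← Set.ncard_univ]
  congr 1

theorem numTangents_smul [DecidableEq F] (g : GL (Fin 2) F) (π : Set (Pt F)) :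
    numTangents (moebius g • π) = numTangents π := by
  rw [numTangents, numTangents,
    ← Set.ncard_image_of_injective {t | tangent t ⊆ π} (MulAction.injective g)]
  congr 1
  ext t
  simp only [Set.mem_ofPred_eq, Set.mem_image]
  constructor
  · intro h
    refine ⟨g⁻¹ • t, ?_, by simp⟩
    rwa [← Set.smul_set_subset_smul_set_iff (a := moebius g),
      moebius_smul_tangent, smul_inv_smul]
  · rintro ⟨s, h, rfl⟩
    rw [← moebius_smul_tangent]
    exact Set.smul_set_mono h

/-- The number of tangents in a plane of each class. -/
def numTangentsN : Fin 5 → ℕ := ![1, 1, 0, 0, 0]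

/-- A plane contains the tangent at `P(t)` exactly when `t` is a multiple root of its form: this
happens once for the forms of the first two classes, and for no other form. -/
theorem numTangents_of_mem_N [Finite F] [DecidableEq F] {i : Fin 5} {π : Set (Pt F)}
    (h : π ∈ N F i) : numTangents π = numTangentsN i := by
  fin_cases i
  · obtain ⟨t, rfl⟩ := h
    change {s | tangent s ⊆ oscPlane t}.ncard = 1
    rw [Set.ncard_eq_one]
    refine ⟨t, ?_⟩
    ext s
    rw [Set.mem_ofPred_eq, Set.mem_singleton_iff]
    constructor
    · intro h
      exact (cubicPt_mem_oscPlane.1 (h (cubicPt_mem_tangent s))).symm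
    · rintro rfl
      rw [oscPlane_eq]
      exact join_subset_plane (form3_dot_cubicVec_eq_zero_of (by simp)) (form3_dot_tangentVec s s)
  · obtain ⟨g, rfl⟩ := conj_of_numCubic_eq_two h.1 h.2
    rw [numTangents_smul, numTangents]
    change _ = 1
    rw [Set.ncard_eq_one]
    refine ⟨OnePoint.infty, ?_⟩
    ext s
    rw [Set.mem_ofPred_eq, Set.mem_singleton_iff, tangent_subset_plane_iff, dot_four, dot_four]
    cases s <;> simp [cubicVec, tangentVec, affineVec]
  · obtain ⟨g, rfl⟩ := conj_of_numCubic_eq_three h.1 h.2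
    rw [numTangents_smul, numTangents]
    change _ = 0
    rw [Set.ncard_eq_zero (Set.toFinite _), Set.eq_empty_iff_forall_notMem]
    intro s
    rw [Set.mem_ofPred_eq, tangent_subset_plane_iff, dot_four, dot_four]
    cases s with
    | infty => simp [cubicVec, tangentVec]
    | coe s =>
      simp [cubicVec, tangentVec, affineVec]
      intro h h'
      -- the form `x² y - x y²` and its derivative have no common root
      have h1 : s * (s - 1) = 0 := by linear_combination h
      rcases mul_eq_zero.1 h1 with h1 | h1
      · simp [h1] at h'
      · have : s = 1 := by linear_combination h1
        rw [this] at h'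
        have : (1 : F) = 0 := by linear_combination h'
        simp at this
  · change numTangents π = 0
    rw [numTangents, Set.ncard_eq_zero (Set.toFinite _), Set.eq_empty_iff_forall_notMem]
    intro r hr
    obtain ⟨g, hg⟩ := exists_smul_infty_eq r
    have hc : Conj (F := F) ((moebius g)⁻¹ • π) π := ⟨g, by simp⟩
    have ht : tangent (OnePoint.infty : OnePoint F) ⊆ (moebius g)⁻¹ • π := by
      rwa [← Set.smul_set_subset_smul_set_iff (a := moebius g), moebius_smul_tangent, hg,
        smul_inv_smul]
    obtain ⟨c, hc0, e⟩ := hc.isPlane.2 h.1.1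
    rw [e] at hc ht
    rw [tangent_subset_plane_iff, dot_four, dot_four] at ht
    simp [cubicVec, tangentVec] at ht
    obtain ⟨h0, h1⟩ := ht
    by_cases h2 : c 2 = 0
    · apply mt hc.mem_developable.1 h.2
      refine ⟨OnePoint.infty, ?_⟩
      change plane ![0, 0, 0, 1] = plane c
      refine (plane_eq_of_smul (a := c 3) ?_ ?_).symm
      · rintro h3; apply hc0; ext i; fin_cases i <;> assumption
      · ext i; fin_cases i <;> simp [h0, h1, h2]
    · have := two_le_numCubic (OnePoint.infty_ne_coe (-c 3 / c 2))
        (cubicPt_infty_mem_plane.2 h0) (cubicPt_coe_mem_plane.2 (by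
          rw [h0, h1]; field_simp; ring))
      have h1 : numCubic π = 1 := h.1.2
      rw [hc.numCubic_eq] at this
      omega
  · change numTangents π = 0
    rw [numTangents, Set.ncard_eq_zero (Set.toFinite _), Set.eq_empty_iff_forall_notMem]
    intro r hr
    exact numCubic_eq_zero.1 h.2 r (hr (cubicPt_mem_tangent r))

end PointsOnTangentsAndChords

/-! ### Osculating planes through a point -/

section Classes

theorem ncard_coe_mem {α : Type*} (π S : Set α) : {P : π | (P : α) ∈ S}.ncard = (π ∩ S).ncard := by
  rw [← Subtype.image_preimage_coe, Set.ncard_image_of_injective _ Subtype.val_injective]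
  rfl

/-- A sum over a subset of a type which is partitioned into classes. -/
theorem sum_coe_eq_sum_classes {α ι : Type*} [Fintype ι] (C : ι → Set α)
    (hex : ∀ a, ∃ i, a ∈ C i) (huniq : ∀ a i j, a ∈ C i → a ∈ C j → i = j) (π : Set α) [Fintype π]
    (f : α → ℕ) (g : ι → ℕ) (hfg : ∀ i, ∀ a ∈ C i, f a = g i) :
    ∑ a : π, f a = ∑ i, (π ∩ C i).ncard * g i := by
  simp only [← ncard_coe_mem]
  exact sum_eq_sum_classes (fun i ↦ {P : π | (P : α) ∈ C i}) (fun a ↦ hex a)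
    (fun a ↦ huniq a) (fun a ↦ f a) g fun i a ↦ hfg i a

variable {F : Type*} [Field F]

/-- Every osculating plane meets a given plane in a line of `q + 1` points, except the plane itself.
-/
theorem sum_ncard_inter_oscPlane [Finite F] [Fintype (OnePoint F)] {i : Fin 5} {π : Set (Pt F)}
    (hπ : π ∈ N F i) : ∑ t : OnePoint F, (π ∩ oscPlane t).ncard =
      (Nat.card F + 1) * (Nat.card F + 1) + if i = 0 then Nat.card F ^ 2 else 0 := by
  classical
  have hpl := isPlane_of_mem_N hπ
  have h1 (t : OnePoint F) : (π ∩ oscPlane t).ncard =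
      (Nat.card F + 1) + if π = oscPlane t then Nat.card F ^ 2 else 0 := by
    split_ifs with h
    · rw [← h, Set.inter_self, ncard_plane hpl]; ring
    · rw [ncard_inter_of_ne hpl (isPlane_oscPlane t) h, add_zero]
  rw [Finset.sum_congr rfl fun t _ ↦ h1 t, Finset.sum_add_distrib, Finset.sum_const, smul_eq_mul,
    Finset.card_univ, ← Nat.card_eq_fintype_card, card_onePoint]
  congr 1
  split_ifs with hi
  · subst hi
    obtain ⟨s, rfl⟩ := hπ
    simp [oscPlane_injective.eq_iff]
  · refine Finset.sum_eq_zero fun t _ ↦ if_neg ?_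
    rintro rfl
    exact hi (eq_of_mem_N hπ ⟨t, rfl⟩)

/-- The number of osculating planes through a point, counted by their points of osculation (which is
the same by `oscPlane_injective`). -/
noncomputable def numOsc (P : Pt F) : ℕ := {t | P ∈ oscPlane t}.ncard

theorem ncard_developable_eq (P : Pt F) : {π ∈ developable F | P ∈ π}.ncard = numOsc P := by
  rw [numOsc, ← Set.ncard_image_of_injective _ oscPlane_injective]
  congr 1
  ext π
  constructor
  · rintro ⟨⟨t, rfl⟩, h⟩; exact ⟨t, h, rfl⟩
  · rintro ⟨t, h, rfl⟩; exact ⟨⟨t, rfl⟩, h⟩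

theorem numOsc_cubicPt (t : OnePoint F) : numOsc (cubicPt t) = 1 := by
  simp [numOsc, cubicPt_mem_oscPlane]

/-- The osculating planes through the points of a plane, counted in two ways. -/
theorem sum_numOsc [Finite F] {i : Fin 5} {π : Set (Pt F)} [Fintype π] (hπ : π ∈ N F i) :
    ∑ P : π, numOsc (P : Pt F) =
      (Nat.card F + 1) * (Nat.card F + 1) + if i = 0 then Nat.card F ^ 2 else 0 := by
  have := Fintype.ofFinite (OnePoint F)
  rw [← sum_ncard_inter_oscPlane hπ]
  simp only [← ncard_coe_mem]
  exact sum_ncard_comm (fun (P : π) (t : OnePoint F) ↦ (P : Pt F) ∈ oscPlane t)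

theorem Conj.mem_cubic {P P' : Pt F} (h : Conj (F := F) P P') (hP : P ∈ cubic F) :
    P' ∈ cubic F := by
  classical
  obtain ⟨g, rfl⟩ := h
  rw [← moebius_smul_cubic g]
  exact Set.smul_mem_smul_set hP

theorem Conj.mem_tangentPts {P P' : Pt F} (h : Conj (F := F) P P') (hP : P ∈ tangentPts F) :
    P' ∈ tangentPts F := by
  classical
  refine ⟨mt h.symm.mem_cubic hP.1, ?_⟩
  obtain ⟨g, rfl⟩ := h
  obtain ⟨-, t, ht⟩ := hP
  exact ⟨g • t, by rw [← moebius_smul_tangent]; exact Set.smul_mem_smul_set ht⟩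

theorem Conj.mem_realChordPts {P P' : Pt F} (h : Conj (F := F) P P') (hP : P ∈ realChordPts F) :
    P' ∈ realChordPts F := by
  classical
  refine ⟨mt h.symm.mem_cubic hP.1, ?_⟩
  obtain ⟨g, rfl⟩ := h
  obtain ⟨-, s, t, hst, ht⟩ := hP
  exact ⟨g • s, g • t, (MulAction.injective g).ne hst,
    by rw [← moebius_smul_realChord]; exact Set.smul_mem_smul_set ht⟩

theorem Conj.numOsc_eq {P P' : Pt F} (h : Conj (F := F) P P') : numOsc P = numOsc P' := by
  classical
  obtain ⟨g, rfl⟩ := h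
  rw [numOsc, numOsc, ← Set.ncard_image_of_injective {t | P ∈ oscPlane t} (MulAction.injective g)]
  congr 1
  ext t
  simp only [Set.mem_ofPred_eq, Set.mem_image]
  constructor
  · rintro ⟨s, h, rfl⟩
    rw [← moebius_smul_oscPlane]
    exact Set.smul_mem_smul_set h
  · intro h
    refine ⟨g⁻¹ • t, ?_, by simp⟩
    rwa [← Set.smul_mem_smul_set_iff (a := moebius g), moebius_smul_oscPlane, smul_inv_smul]

/-- Every point off the cubic on a real chord is equivalent to a point on the chord which joins
`P(∞)` and `P(0)`. -/
theorem exists_conj_of_mem_realChordPts {P : Pt F} (hP : P ∈ realChordPts F) :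
    ∃ (a d : F) (h : ![a, 0, 0, d] ≠ 0), a ≠ 0 ∧ d ≠ 0 ∧
      Conj (F := F) (Projectivization.mk F ![a, 0, 0, d] h) P := by
  classical
  obtain ⟨hPc, s, t, hst, h⟩ := hP
  obtain ⟨g, hs, ht⟩ := exists_smul_eq_pair hst
  have hc : Conj (F := F) ((moebius g)⁻¹ • P) P := ⟨g, by simp⟩
  have hm : (moebius g)⁻¹ • P ∈ realChord (OnePoint.infty : OnePoint F) ((0 : F) : OnePoint F) := by
    rwa [← Set.smul_mem_smul_set_iff (a := moebius g), moebius_smul_realChord, hs, ht,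
      smul_inv_smul]
  obtain ⟨a, d, e⟩ := mem_join.1 hm
  have e' : ![a, 0, 0, d] = ((moebius g)⁻¹ • P).rep := by
    rw [← e]
    ext i; fin_cases i <;> simp [cubicVec, affineVec]
  refine ⟨a, d, e' ▸ Projectivization.rep_nonzero _, ?_, ?_, ?_⟩
  · rintro rfl
    rw [zero_smul, zero_add] at e
    exact hPc (hc.mem_cubic ⟨_, (eq_cubicPt e.symm).symm⟩)
  · rintro rfl
    rw [zero_smul, add_zero] at e
    exact hPc (hc.mem_cubic ⟨_, (eq_cubicPt e.symm).symm⟩)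
  · convert hc
    simp only [e', Projectivization.mk_rep]

end Classes

/-! ### The polarity -/

section Polarity

variable {F : Type*} [Field F]

/-- The alternating form attached to the cubic: the polar of `P(t)` is the osculating plane at
`P(t)`. It is degenerate in characteristic three. -/
def polar (x : Fin 4 → F) : Fin 4 → F := ![x 3, -3 * x 2, 3 * x 1, -x 0]

theorem polar_dot (x y : Fin 4 → F) : polar x ⬝ᵥ y = -(polar y ⬝ᵥ x) := by
  rw [dot_four, dot_four]; simp [polar]; ring

theorem polar_smul (a : F) (x : Fin 4 → F) : polar (a • x) = a • polar x := by
  ext i; fin_cases i <;> simp [polar] <;> ring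

theorem polar_ver (p : F × F) : polar (ver p) = form3 p p p := by
  ext i; fin_cases i <;> simp [polar, ver, form3] <;> ring

theorem polar_vecMul_sym3 (g : Matrix (Fin 2) (Fin 2) F) (x : Fin 4 → F) :
    polar (sym3 g *ᵥ x) ᵥ* sym3 g = g.det ^ 3 • polar x := by
  obtain ⟨a, b, c, d, rfl⟩ : ∃ a b c d, x = ![a, b, c, d] :=
    ⟨x 0, x 1, x 2, x 3, by ext i; fin_cases i <;> rfl⟩
  ext i
  simp only [Matrix.vecMul, dot_four, Pi.smul_apply, smul_eq_mul, Matrix.det_fin_two]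
  fin_cases i <;> simp [polar, sym3, Matrix.mulVec] <;> ring

theorem polar_ne_zero (h3 : (3 : F) ≠ 0) {x : Fin 4 → F} (hx : x ≠ 0) : polar x ≠ 0 := by
  intro h
  apply hx
  have h0 := congrFun h 0
  have h1 := congrFun h 1
  have h2 := congrFun h 2
  have h3 := congrFun h 3
  simp [polar, *] at h0 h1 h2 h3
  ext i; fin_cases i <;> assumption

/-- The polar plane of a point. -/
noncomputable def polarPlane (P : Pt F) : Set (Pt F) := plane (polar P.rep)

theorem polarPlane_mk {v : Fin 4 → F} (hv : v ≠ 0) :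
    polarPlane (Projectivization.mk F v hv) = plane (polar v) := by
  obtain ⟨a, ha, h⟩ := exists_smul_rep hv
  conv_rhs => rw [h, polar_smul, plane_smul ha]
  rfl

theorem mem_polarPlane_comm {P Q : Pt F} : P ∈ polarPlane Q ↔ Q ∈ polarPlane P := by
  rw [polarPlane, polarPlane, mem_plane, mem_plane, polar_dot, neg_eq_zero]

theorem polarPlane_cubicPt (t : OnePoint F) : polarPlane (cubicPt t) = oscPlane t := by
  rw [cubicPt, polarPlane_mk, cubicVec_eq, polar_ver, oscPlane_eq]

/-- By the symmetry of the polarity, the points of the cubic in the polar plane of `P` are the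
points of osculation of the osculating planes through `P`. -/
theorem numCubic_polarPlane (P : Pt F) : numCubic (polarPlane P) = numOsc P := by
  rw [numCubic_eq, numOsc]
  simp only [mem_polarPlane_comm (Q := P), polarPlane_cubicPt]

theorem moebius_smul_polarPlane (g : GL (Fin 2) F) (P : Pt F) :
    moebius g • polarPlane P = polarPlane (moebius g • P) := by
  induction P using Projectivization.ind with | h v hv =>
  obtain ⟨h, e⟩ := moebius_smul_mk g hv
  rw [e, polarPlane_mk, polarPlane_mk, ← plane_smul (pow_ne_zero 3 g.det_ne_zero),
    ← polar_vecMul_sym3, moebius_smul_plane]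

theorem isPlane_polarPlane (h3 : (3 : F) ≠ 0) (P : Pt F) : IsPlane (polarPlane P) :=
  ⟨_, polar_ne_zero h3 P.rep_nonzero, rfl⟩

theorem exists_polarPlane_eq (h3 : (3 : F) ≠ 0) {π : Set (Pt F)} (hπ : IsPlane π) :
    ∃ P, polarPlane P = π := by
  obtain ⟨c, hc, rfl⟩ := hπ
  set v : Fin 4 → F := ![-c 3, c 2 / 3, -c 1 / 3, c 0] with hv
  have e : polar v = c := by
    ext i; fin_cases i <;> simp [v, polar] <;> field_simp
  have hv0 : v ≠ 0 := by
    rintro h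
    rw [h] at e
    apply hc
    rw [← e]
    ext i; fin_cases i <;> simp [polar]
  exact ⟨Projectivization.mk F v hv0, by rw [polarPlane_mk, e]⟩

/-- A surjection between finite sets of the same size, since there are as many points as planes. -/
theorem polarPlane_injective [Finite F] (h3 : (3 : F) ≠ 0) :
    Function.Injective (polarPlane : Pt F → Set (Pt F)) := by
  have : Function.Surjective (fun P : Pt F ↦ (⟨polarPlane P, isPlane_polarPlane h3 P⟩ :
      {π : Set (Pt F) // IsPlane π})) := fun π ↦ by
    obtain ⟨P, hP⟩ := exists_polarPlane_eq h3 π.2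
    exact ⟨P, Subtype.ext hP⟩
  let e : Pt F ≃ {π : Set (Pt F) // IsPlane π} := Equiv.ofBijective
    (fun Q ↦ ⟨dualPlane Q, isPlane_dualPlane Q⟩)
    ⟨fun Q Q' h ↦ dualPlane_injective (congrArg Subtype.val h), fun π ↦ by
      obtain ⟨P, hP⟩ := exists_dualPlane_eq π.2
      exact ⟨P, Subtype.ext hP⟩⟩
  have h2 := Finite.injective_iff_surjective_of_equiv e |>.2 this
  exact fun P Q h ↦ h2 (Subtype.ext h)

theorem Conj.polarPlane_iff [Finite F] (h3 : (3 : F) ≠ 0) {P Q : Pt F} :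
    Conj (F := F) (polarPlane P) (polarPlane Q) ↔ Conj (F := F) P Q := by
  refine exists_congr fun g ↦ ?_
  rw [moebius_smul_polarPlane, (polarPlane_injective h3).eq_iff]

theorem ncard_polarPlane_mem_N [Finite F] (h3 : (3 : F) ≠ 0) (i : Fin 5) :
    {P : Pt F | polarPlane P ∈ N F i}.ncard = Nat.card (N F i) := by
  rw [Nat.card_coe_set_eq, ← Set.ncard_image_of_injective _ (polarPlane_injective h3)]
  congr 1
  ext π
  constructor
  · rintro ⟨Q, h, rfl⟩
    exact h
  · intro h
    obtain ⟨Q, rfl⟩ := exists_polarPlane_eq h3 (isPlane_of_mem_N h)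
    exact ⟨Q, h, rfl⟩

theorem polarPlane_mem_developable_iff [Finite F] (h3 : (3 : F) ≠ 0) {P : Pt F} :
    polarPlane P ∈ developable F ↔ P ∈ cubic F := by
  constructor
  · rintro ⟨t, ht⟩
    rw [← polarPlane_cubicPt] at ht
    exact ⟨t, polarPlane_injective h3 ht⟩
  · rintro ⟨t, rfl⟩
    exact ⟨t, (polarPlane_cubicPt t).symm⟩

/-- The polarity maps the points off the cubic on the tangents to the planes with two points on the
cubic: the normal form `x y²` of such a plane is the polar of a point of the tangent at `P(∞)`,
which gives one inclusion, and the sets have the same size. -/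
theorem polarPlane_mem_N_one_iff [Finite F] (h3 : (3 : F) ≠ 0) {P : Pt F} :
    polarPlane P ∈ N F 1 ↔ P ∈ tangentPts F := by
  classical
  have hsub : {P : Pt F | polarPlane P ∈ N F 1} ⊆ tangentPts F := by
    intro P hP
    have hv : (![0, 1, 0, 0] : Fin 4 → F) ≠ 0 := fun h ↦ by simpa using congrFun h 1
    have hc := conj_of_numCubic_eq_two hP.1 hP.2
    have e : plane ![0, 0, 1, 0] = polarPlane (Projectivization.mk F ![0, 1, 0, 0] hv) := by
      rw [polarPlane_mk]
      symm
      refine plane_eq_of_smul h3 ?_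
      ext i; fin_cases i <;> simp [polar]
    rw [e, Conj.polarPlane_iff h3] at hc
    refine hc.mem_tangentPts ⟨?_, OnePoint.infty, ?_⟩
    · rintro ⟨t, ht⟩
      rw [cubicPt, Projectivization.mk_eq_mk_iff'] at ht
      obtain ⟨a, ha⟩ := ht
      have h1 := congrFun ha 1
      have h0 := congrFun ha 0
      have h3 := congrFun ha 3
      cases t <;> simp [cubicVec, affineVec] at h0 h1 h3
    · exact (mk_mem_join hv).2 (Submodule.subset_span (by simp [tangentVec]))
  have hcard : (tangentPts F).ncard ≤ {P : Pt F | polarPlane P ∈ N F 1}.ncard := by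
    rw [ncard_polarPlane_mem_N h3, ncard_tangentPts]
    have h := card_N (F := F) 1
    simp [sizeN] at h
    apply le_of_eq
    qify
    rw [Nat.card_coe_set_eq, h]; ring
  rw [← Set.eq_of_subset_of_ncard_le hsub hcard (Set.toFinite _)]
  rfl

/-- Away from characteristic three the polarity maps the classes of points to those of planes. -/
theorem mem_M_iff [Finite F] (h3 : (3 : F) ≠ 0) (hq : Nat.card F % 3 ≠ 0) {j : Fin 5} {P : Pt F} :
    P ∈ M F j ↔ polarPlane P ∈ N F j := by
  have hp := isPlane_polarPlane h3 P
  have hdev := polarPlane_mem_developable_iff h3 (P := P)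
  have hcub : P ∈ cubic F → numOsc P = 1 := by
    rintro ⟨t, rfl⟩; exact numOsc_cubicPt t
  rw [M, if_neg hq]
  fin_cases j
  · exact hdev.symm
  · exact (polarPlane_mem_N_one_iff h3).symm
  · change P ∉ cubic F ∧ _ = 3 ↔ IsPlane _ ∧ numCubic _ = 3
    rw [ncard_developable_eq, numCubic_polarPlane]
    refine ⟨fun h ↦ ⟨hp, h.2⟩, fun h ↦ ⟨fun h' ↦ ?_, h.2⟩⟩
    have := hcub h'; omega
  · change P ∉ cubic F ∧ _ = 1 ↔ (IsPlane _ ∧ numCubic _ = 1) ∧ _ ∉ developable F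
    rw [ncard_developable_eq, numCubic_polarPlane, hdev]
    tauto
  · change P ∉ cubic F ∧ _ = 0 ↔ IsPlane _ ∧ numCubic _ = 0
    rw [ncard_developable_eq, numCubic_polarPlane]
    refine ⟨fun h ↦ ⟨hp, h.2⟩, fun h ↦ ⟨fun h' ↦ ?_, h.2⟩⟩
    have := hcub h'; omega

end Polarity

/-! ### Osculating planes through the points of a real chord -/

section CubeRoots

variable {F : Type*} [Field F]

/-- The osculating planes through a point `(a, 0, 0, d)` of the chord of `P(∞)` and `P(0)`
correspond to the cube roots of `a / d`. -/
theorem cubicPt_mem_polarPlane_diagonal {a d : F} (h : ![a, 0, 0, d] ≠ 0) (hd : d ≠ 0)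
    (t : OnePoint F) : cubicPt t ∈ polarPlane (Projectivization.mk F ![a, 0, 0, d] h) ↔
      ∃ x : F, t = x ∧ d * x ^ 3 = a := by
  rw [polarPlane_mk]
  cases t with
  | infty => rw [cubicPt_infty_mem_plane]; simp [polar, hd]
  | coe t => rw [cubicPt_coe_mem_plane]; simp [polar, ← sub_eq_add_neg, sub_eq_zero]

theorem pow_three_bijective [Finite F] (hq : Nat.card F % 3 = 2) :
    Function.Bijective (fun x : F ↦ x ^ 3) := by
  rw [← Finite.injective_iff_bijective]
  have := Fintype.ofFinite F
  obtain ⟨m, hm⟩ : ∃ m, Nat.card F = 3 * m + 2 := ⟨Nat.card F / 3, by omega⟩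
  -- the exponents `3` and `2 * m + 1` are inverse to each other modulo `q - 1 = 3 * m + 1`
  have key (x : F) : (x ^ 3) ^ (2 * m + 1) = x := by
    by_cases hx : x = 0
    · simp [hx]
    · have h1 := FiniteField.pow_card_sub_one_eq_one x hx
      rw [← Nat.card_eq_fintype_card, hm] at h1
      rw [← pow_mul, show 3 * (2 * m + 1) = (3 * m + 2 - 1) * 2 + 1 by omega, pow_succ, pow_mul, h1]
      simp
  intro x y h
  rw [← key x, ← key y]
  exact congrArg (· ^ (2 * m + 1)) h

/-- For `q ≡ 2 (mod 3)` every element has exactly one cube root. -/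
theorem numOsc_of_mem_realChordPts_of_mod_two [Finite F] (hq : Nat.card F % 3 = 2) {P : Pt F}
    (hP : P ∈ realChordPts F) : numOsc P = 1 := by
  obtain ⟨a, d, h, ha, hd, hc⟩ := exists_conj_of_mem_realChordPts hP
  rw [← hc.numOsc_eq, ← numCubic_polarPlane, numCubic_eq]
  simp only [cubicPt_mem_polarPlane_diagonal h hd]
  rw [Set.ncard_eq_one]
  obtain ⟨x, hx⟩ := (pow_three_bijective hq).2 (a / d)
  refine ⟨(x : OnePoint F), ?_⟩
  ext t
  rw [Set.mem_ofPred_eq, Set.mem_singleton_iff]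
  constructor
  · rintro ⟨y, rfl, hy⟩
    rw [OnePoint.coe_eq_coe]
    apply (pow_three_bijective hq).1
    simp only at hx ⊢
    rw [hx, ← hy]; field_simp
  · rintro rfl
    refine ⟨x, rfl, ?_⟩
    simp only at hx
    rw [hx]; field_simp

theorem exists_primitive_cube_root [Finite F] (hq : Nat.card F % 3 = 1) :
    ∃ w : F, w ≠ 1 ∧ w ^ 3 = 1 := by
  have : Fact (Nat.Prime 3) := ⟨Nat.prime_three⟩
  have hdvd : 3 ∣ Nat.card Fˣ := by
    rw [Nat.card_units]; omega
  obtain ⟨w, hw⟩ := exists_prime_orderOf_dvd_card' 3 hdvd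
  refine ⟨w, ?_, ?_⟩
  · intro h
    rw [Units.val_eq_one] at h
    simp [h] at hw
  · rw [← Units.val_pow_eq_pow_val, ← hw, pow_orderOf_eq_one, Units.val_one]

/-- For `q ≡ 1 (mod 3)` an element has no cube root or three of them. -/
theorem numOsc_of_mem_realChordPts_of_mod_one [Finite F] (h3 : (3 : F) ≠ 0)
    (hq : Nat.card F % 3 = 1) {P : Pt F} (hP : P ∈ realChordPts F) :
    numOsc P = 0 ∨ numOsc P = 3 := by
  obtain ⟨a, d, h, ha, hd, hc⟩ := exists_conj_of_mem_realChordPts hP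
  rw [← hc.numOsc_eq, ← numCubic_polarPlane]
  have hle := numCubic_le (isPlane_polarPlane h3 (Projectivization.mk F ![a, 0, 0, d] h))
  by_contra! hne
  obtain ⟨x, hx⟩ : ∃ x : F, d * x ^ 3 = a := by
    by_contra! hx
    apply hne.1
    rw [numCubic_eq_zero]
    intro t ht
    obtain ⟨x, -, h⟩ := (cubicPt_mem_polarPlane_diagonal h hd t).1 ht
    exact hx x h
  obtain ⟨w, hw1, hw3⟩ := exists_primitive_cube_root hq
  have hx0 : x ≠ 0 := by rintro rfl; simp at hx; exact ha hx.symm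
  have hw0 : w ≠ 0 := by rintro rfl; simp at hw3
  have hww : w ^ 2 ≠ 1 := by
    intro h
    apply hw1
    calc w = w ^ 3 := by rw [pow_succ, h, one_mul]
      _ = 1 := hw3
  -- with `x` also `w * x` and `w ^ 2 * x` are cube roots
  have h2 := ncard_le_numCubic (π := polarPlane (Projectivization.mk F ![a, 0, 0, d] h))
    (S := {(x : OnePoint F), ((w * x : F) : OnePoint F), ((w ^ 2 * x : F) : OnePoint F)}) (by
      rintro t (rfl | rfl | rfl) <;> rw [cubicPt_mem_polarPlane_diagonal h hd]
      · exact ⟨_, rfl, hx⟩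
      · exact ⟨_, rfl, by rw [mul_pow, hw3, one_mul, hx]⟩
      · exact ⟨_, rfl, by rw [mul_pow, ← pow_mul, mul_comm 2, pow_mul, hw3, one_pow, one_mul, hx]⟩)
  have h4 : ({(x : OnePoint F), ((w * x : F) : OnePoint F), ((w ^ 2 * x : F) : OnePoint F)} :
      Set (OnePoint F)).ncard = 3 := by
    rw [Set.ncard_eq_three]
    refine ⟨_, _, _, ?_, ?_, ?_, rfl⟩
    · rw [Ne, OnePoint.coe_eq_coe]; intro h; exact hw1 (by field_simp at h; exact h.symm)
    · rw [Ne, OnePoint.coe_eq_coe]; intro h; exact hww (by field_simp at h; exact h.symm)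
    · rw [Ne, OnePoint.coe_eq_coe]; intro h; exact hw1 (by field_simp at h; exact h.symm)
  omega

end CubeRoots

/-! ### The classes of points for `q` prime to three -/

section NonzeroResidue

variable {F : Type*} [Field F]

theorem card_M_eq [Finite F] (h3 : (3 : F) ≠ 0) (hq : Nat.card F % 3 ≠ 0) (j : Fin 5) :
    (M F j).ncard = Nat.card (N F j) := by
  rw [← ncard_polarPlane_mem_N h3]
  congr 1
  ext P
  exact mem_M_iff h3 hq

theorem exists_mem_M_of_ne [Finite F] (h3 : (3 : F) ≠ 0) (hq : Nat.card F % 3 ≠ 0) (P : Pt F) :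
    ∃ j, P ∈ M F j := by
  simp only [mem_M_iff h3 hq]
  exact exists_mem_N (isPlane_polarPlane h3 P)

theorem eq_of_mem_M_of_ne [Finite F] (h3 : (3 : F) ≠ 0) (hq : Nat.card F % 3 ≠ 0) {P : Pt F}
    {i j : Fin 5} (hi : P ∈ M F i) (hj : P ∈ M F j) : i = j := by
  rw [mem_M_iff h3 hq] at hi hj
  exact eq_of_mem_N hi hj

theorem numOsc_of_mem_M [Finite F] (h3 : (3 : F) ≠ 0) (hq : Nat.card F % 3 ≠ 0) {P : Pt F}
    {j : Fin 5} (hj : P ∈ M F j) : numOsc P = numN j := by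
  rw [mem_M_iff h3 hq] at hj
  rw [← numCubic_polarPlane, numCubic_of_mem_N hj]

theorem mul_descFactorial_two (n : ℕ) : (((n + 1).descFactorial 2 : ℕ) : ℚ) = (n + 1) * n := by
  simp [Nat.descFactorial]; ring

/-- For `q ≡ 2 (mod 3)` the points of the real chords are those on one osculating plane: one
inclusion is clear, and the sets have the same size. -/
theorem realChordPts_eq_of_mod_two [Finite F] (h3 : (3 : F) ≠ 0) (hq : Nat.card F % 3 = 2) :
    realChordPts F = M F 3 := by
  have hq' : Nat.card F % 3 ≠ 0 := by omega
  have hsub : realChordPts F ⊆ M F 3 := by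
    intro P hP
    rw [M, if_neg hq']
    exact ⟨hP.1, by rw [ncard_developable_eq, numOsc_of_mem_realChordPts_of_mod_two hq hP]⟩
  refine Set.eq_of_subset_of_ncard_le hsub ?_ (Set.toFinite _)
  have h1 := card_N (F := F) 3
  have h2 := ncard_realChordPts (F := F)
  rw [card_M_eq h3 hq']
  have h0 : 1 ≤ Nat.card F := Nat.card_pos
  apply le_of_eq
  qify [h0] at h2 ⊢
  rw [mul_descFactorial_two] at h2
  rw [h1]
  simp [sizeN]
  linarith

/-- For `q ≡ 1 (mod 3)` the points of the real chords are those on three or on no osculating planes: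
one inclusion is clear, and the sets have the same size. -/
theorem realChordPts_eq_of_mod_one [Finite F] (h3 : (3 : F) ≠ 0) (hq : Nat.card F % 3 = 1) :
    realChordPts F = M F 2 ∪ M F 4 := by
  have hq' : Nat.card F % 3 ≠ 0 := by omega
  have hsub : realChordPts F ⊆ M F 2 ∪ M F 4 := by
    intro P hP
    rw [M, if_neg hq']
    rcases numOsc_of_mem_realChordPts_of_mod_one h3 hq hP with h | h
    · exact Or.inr ⟨hP.1, by rw [ncard_developable_eq, h]⟩
    · exact Or.inl ⟨hP.1, by rw [ncard_developable_eq, h]⟩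
  refine Set.eq_of_subset_of_ncard_le hsub ?_ (Set.toFinite _)
  refine (Set.ncard_union_le _ _).trans ?_
  have h1 := card_N (F := F) 2
  have h4 := card_N (F := F) 4
  have h2 := ncard_realChordPts (F := F)
  rw [card_M_eq h3 hq', card_M_eq h3 hq']
  have h0 : 1 ≤ Nat.card F := Nat.card_pos
  apply le_of_eq
  qify [h0] at h2 ⊢
  rw [mul_descFactorial_two] at h2
  rw [h1, h4]
  simp [sizeN]
  linarith

theorem disjoint_M_of_ne [Finite F] (h3 : (3 : F) ≠ 0) (hq : Nat.card F % 3 ≠ 0)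
    {i j : Fin 5} (hij : i ≠ j) : Disjoint (M F i) (M F j) := by
  rw [Set.disjoint_left]
  exact fun P hi hj ↦ hij (eq_of_mem_M_of_ne h3 hq hi hj)

theorem residue_cases {q : ℕ} {ξ : ℤ} (hξ : ξ = -1 ∨ ξ = 0 ∨ ξ = 1) (h : (q : ℤ) ≡ ξ [ZMOD 3]) :
    (ξ = -1 ∧ q % 3 = 2) ∨ (ξ = 0 ∧ q % 3 = 0) ∨ (ξ = 1 ∧ q % 3 = 1) := by
  unfold Int.ModEq at h
  omega

/-- The intersections of a plane with the classes of points, for `q` prime to three. The classes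
are told apart by the tangents, the real chords and the osculating planes. -/
theorem ncard_inter_M_of_ne [Finite F] (hq5 : 5 ≤ Nat.card F) (h3 : (3 : F) ≠ 0) {ξ : ℤ}
    (hξ : (ξ = -1 ∧ Nat.card F % 3 = 2) ∨ (ξ = 1 ∧ Nat.card F % 3 = 1)) {i : Fin 5}
    {π : Set (Pt F)} (hπ : π ∈ N F i) (j : Fin 5) :
    ((π ∩ M F j).ncard : ℚ) = tableK (Nat.card F) ξ i j := by
  classical
  have hq : Nat.card F % 3 ≠ 0 := by omega
  have := Fintype.ofFinite π
  have hpl := isPlane_of_mem_N hπ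
  have e0 : (π ∩ M F 0).ncard = numN i := by
    rw [← numCubic_of_mem_N hπ, numCubic, M, if_neg hq]; rfl
  have e1 : (π ∩ M F 1).ncard = numTangentsN i * Nat.card F + (Nat.card F + 1 - numN i) := by
    rw [← numCubic_of_mem_N hπ, ← numTangents_of_mem_N hπ, ← ncard_inter_tangentPts hpl, M,
      if_neg hq]
    rfl
  have esum := sum_coe_eq_sum_classes (M F) (exists_mem_M_of_ne h3 hq)
    (fun P i j ↦ eq_of_mem_M_of_ne h3 hq) π (fun _ ↦ 1) (fun _ ↦ 1) (fun _ _ _ ↦ rfl)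
  rw [Finset.sum_const, Finset.card_univ, ← Nat.card_eq_fintype_card, Nat.card_coe_set_eq,
    ncard_plane hpl] at esum
  have eosc := sum_coe_eq_sum_classes (M F) (exists_mem_M_of_ne h3 hq)
    (fun P i j ↦ eq_of_mem_M_of_ne h3 hq) π numOsc numN (fun j P hP ↦ numOsc_of_mem_M h3 hq hP)
  rw [sum_numOsc hπ] at eosc
  have ereal := ncard_inter_realChordPts hpl
  rw [numCubic_of_mem_N hπ] at ereal
  -- the numbers of points on the cubic, on the tangents and on the real chords, their total and the
  -- number of incidences with osculating planes are five linear equations for the five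
  -- intersections; the substitution `|F| = p + 3` removes the truncated subtractions
  obtain ⟨p, hp⟩ : ∃ p, Nat.card F = p + 3 := ⟨Nat.card F - 3, by omega⟩
  have hpq : ((Nat.card F : ℕ) : ℚ) = p + 3 := by rw [hp]; push_cast; ring
  rw [hp] at e1 esum eosc ereal
  obtain ⟨κ, hκ⟩ : ∃ κ : Fin 5 → ℕ, ∀ j, (π ∩ M F j).ncard = κ j := ⟨_, fun _ ↦ rfl⟩
  rw [hpq]
  obtain ⟨c, hc⟩ : ∃ c : Fin 5 → ℚ, ∀ j, (κ j : ℚ) = c j := ⟨_, fun _ ↦ rfl⟩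
  simp only [hκ, Fin.sum_univ_five] at e0 e1 esum eosc ⊢
  rw [hc]
  rcases hξ with ⟨rfl, hξ⟩ | ⟨rfl, hξ⟩
  · rw [realChordPts_eq_of_mod_two h3 hξ, hκ] at ereal
    clear hπ
    fin_cases i <;>
      simp [numN, numTangentsN, Nat.descFactorial] at e0 e1 esum eosc ereal <;>
      qify at e0 e1 esum eosc ereal <;>
      simp only [hc] at e0 e1 esum eosc ereal <;>
      fin_cases j <;> simp [tableK] <;> linarith
  · rw [realChordPts_eq_of_mod_one h3 hξ, Set.inter_union_distrib_left, Set.ncard_union_eq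
      ((disjoint_M_of_ne h3 hq (by decide)).mono Set.inter_subset_right Set.inter_subset_right),
      hκ, hκ] at ereal
    clear hπ
    fin_cases i <;>
      simp [numN, numTangentsN, Nat.descFactorial] at e0 e1 esum eosc ereal <;>
      qify at e0 e1 esum eosc ereal <;>
      simp only [hc] at e0 e1 esum eosc ereal <;>
      fin_cases j <;> simp [tableK] <;> linarith

theorem conj_of_mem_M_of_ne [Finite F] (h3 : (3 : F) ≠ 0) (hq : Nat.card F % 3 ≠ 0)
    {P P' : Pt F} {j : Fin 5} (h : P ∈ M F j) (h' : P' ∈ M F j) : Conj (F := F) P P' := by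
  classical
  rw [mem_M_iff h3 hq] at h h'
  exact (Conj.polarPlane_iff h3).1 (conj_of_mem_N h h')

theorem Conj.mem_M_of_ne [Finite F] (h3 : (3 : F) ≠ 0) (hq : Nat.card F % 3 ≠ 0)
    {P P' : Pt F} {j : Fin 5} (h : Conj (F := F) P P') (hP : P ∈ M F j) : P' ∈ M F j := by
  classical
  rw [mem_M_iff h3 hq] at hP ⊢
  exact ((Conj.polarPlane_iff h3).2 h).mem_N hP

end NonzeroResidue

theorem sym3_map {R S : Type*} [CommRing R] [CommRing S] (f : R →+* S)
    (g : Matrix (Fin 2) (Fin 2) R) : (sym3 g).map f = sym3 (g.map f) := by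
  ext i j
  fin_cases i <;> fin_cases j <;> simp [sym3, map_ofNat f 2, map_ofNat f 3]

/-! ### Imaginary chords -/

section ImaginaryChords

variable {F : Type u} [Field F]

/-- The Frobenius automorphism `x ↦ x ^ q` over `F`. -/
theorem exists_frobenius [Finite F] :
    ∃ σ : AlgebraicClosure F →ₐ[F] AlgebraicClosure F, ∀ x, σ x = x ^ Nat.card F := by
  have := Fintype.ofFinite F
  exact ⟨FiniteField.frobeniusAlgHom F _, fun x ↦ by
    rw [FiniteField.coe_frobeniusAlgHom, Nat.card_eq_fintype_card]⟩

open Polynomial in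
/-- The elements with `x ^ q = x` are those of `F`, since the polynomial `X ^ q - X` has at most `q`
roots. -/
theorem mem_range_of_pow_card_eq [Finite F] {x : AlgebraicClosure F} (h : x ^ Nat.card F = x) :
    x ∈ Set.range (algebraMap F (AlgebraicClosure F)) := by
  classical
  have := Fintype.ofFinite F
  have h1 : 1 < Nat.card F := Finite.one_lt_card
  have hne := FiniteField.X_pow_card_sub_X_ne_zero (AlgebraicClosure F) h1
  have hsub : Finset.univ.image (algebraMap F (AlgebraicClosure F)) ⊆
      (X ^ Nat.card F - X : (AlgebraicClosure F)[X]).roots.toFinset := by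
    intro y hy
    obtain ⟨a, -, rfl⟩ := Finset.mem_image.1 hy
    rw [Multiset.mem_toFinset, mem_roots hne]
    simp [IsRoot, Nat.card_eq_fintype_card, ← map_pow, FiniteField.pow_card]
  have heq := Finset.eq_of_subset_of_card_le hsub (by
    rw [Finset.card_image_of_injective _ (FaithfulSMul.algebraMap_injective F _), Finset.card_univ,
      ← Nat.card_eq_fintype_card]
    refine (Multiset.toFinset_card_le _).trans ((card_roots' _).trans ?_)
    rw [FiniteField.X_pow_card_sub_X_natDegree_eq _ h1])
  have hx : x ∈ (X ^ Nat.card F - X : (AlgebraicClosure F)[X]).roots.toFinset := by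
    rw [Multiset.mem_toFinset, mem_roots hne]
    rw [IsRoot.def, eval_sub, eval_pow, eval_X, h, sub_self]
  rw [← heq] at hx
  obtain ⟨a, -, ha⟩ := Finset.mem_image.1 hx
  exact ⟨a, ha⟩

theorem pow_card_notMem_range [Finite F] {x : AlgebraicClosure F} (h : x ^ Nat.card F ^ 2 = x)
    (hx : x ∉ Set.range (algebraMap F (AlgebraicClosure F))) :
    x ^ Nat.card F ∉ Set.range (algebraMap F (AlgebraicClosure F)) := by
  rintro ⟨a, ha⟩
  have := Fintype.ofFinite F
  refine hx ⟨a, ?_⟩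
  rw [← h, pow_two, pow_mul, ← ha, ← map_pow, Nat.card_eq_fintype_card, FiniteField.pow_card]

/-- The forms over `F` with two given roots `s`, `t` in `F ∪ {∞}` do not vanish simultaneously in a
point of an imaginary chord. -/
theorem notMem_imaginaryChord [Finite F] {P : Pt F} {s t : OnePoint F}
    (h : ∀ r : F × F, form3 (hom s) (hom t) r ⬝ᵥ P.rep = 0) {α : AlgebraicClosure F}
    (hα : α ^ Nat.card F ^ 2 = α) (hα' : α ∉ Set.range (algebraMap F (AlgebraicClosure F))) :
    P ∉ imaginaryChord α := by
  intro hP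
  obtain ⟨u, v, huv⟩ := Submodule.mem_span_pair.1 hP
  have hβ' := pow_card_notMem_range hα hα'
  have hαβ : α ≠ α ^ Nat.card F := fun e ↦ hα' (mem_range_of_pow_card_eq e.symm)
  generalize α ^ Nat.card F = β at *
  let ι := algebraMap F (AlgebraicClosure F)
  have hne (s : OnePoint F) {x : AlgebraicClosure F} (hx : x ∉ Set.range ι) :
      bracket (Prod.map ι ι (hom s)) (x, 1) ≠ 0 := by
    cases s with
    | infty => simp [bracket]
    | coe s =>
      simp only [bracket, hom_coe, Prod.map_apply, map_one, one_mul, mul_one]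
      exact fun e ↦ hx ⟨s, (sub_eq_zero.1 e).symm⟩
  have key (r : F × F) :
      u * (bracket (Prod.map ι ι (hom s)) (α, 1) * bracket (Prod.map ι ι (hom t)) (α, 1) *
        bracket (Prod.map ι ι r) (α, 1)) +
      v * (bracket (Prod.map ι ι (hom s)) (β, 1) * bracket (Prod.map ι ι (hom t)) (β, 1) *
        bracket (Prod.map ι ι r) (β, 1)) = 0 := by
    rw [← form3_dot_ver, ← form3_dot_ver, ← affineVec_eq, ← affineVec_eq, ← smul_eq_mul,
      ← smul_eq_mul, ← dotProduct_smul, ← dotProduct_smul, ← dotProduct_add, huv]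
    have e := congrArg ι (h r)
    rw [dot_four] at e ⊢
    simpa [form3, ι] using e
  -- two choices of the third root give independent linear equations for `u` and `v`
  have k1 := key (1, 0)
  have k2 := key (0, 1)
  have hA := mul_ne_zero (hne s hα') (hne t hα')
  have hB := mul_ne_zero (hne s hβ') (hne t hβ')
  generalize bracket (Prod.map ι ι (hom s)) (α, 1) * bracket (Prod.map ι ι (hom t)) (α, 1) = A at *
  generalize bracket (Prod.map ι ι (hom s)) (β, 1) * bracket (Prod.map ι ι (hom t)) (β, 1) = B at *
  simp [bracket] at k1 k2
  have hv : v * B * (β - α) = 0 := by linear_combination k2 + α * k1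
  have hv0 : v = 0 := by simpa [hB, sub_ne_zero.2 hαβ.symm] using hv
  have hu0 : u = 0 := by simpa [hv0, hA] using k1
  apply P.rep_nonzero
  ext i
  rw [hu0, hv0, zero_smul, zero_smul, zero_add] at huv
  exact (map_eq_zero ι).1 (congrFun huv i).symm

/-- An imaginary chord contains no point of the cubic, of a tangent or of a real chord: on such a
point all forms with the roots `s` and `t` vanish, for suitable `s` and `t`. -/
theorem notMem_of_mem_imaginaryChordPts [Finite F] {P : Pt F} (hP : P ∈ imaginaryChordPts F) :
    P ∉ cubic F ∧ P ∉ tangentPts F ∧ P ∉ realChordPts F := by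
  obtain ⟨α, hα, hα', hP⟩ := hP
  have ht (t : OnePoint F) : P ∉ tangent t := fun h ↦ by
    refine notMem_imaginaryChord (s := t) (t := t) (fun r ↦ ?_) hα hα' hP
    obtain ⟨a, b, e⟩ := mem_join.1 h
    rw [← e, dotProduct_add, dotProduct_smul, dotProduct_smul, cubicVec_eq, tangentVec_eq,
      form3_dot_ver, form3_dot_tan, bracket_hom_self]
    simp
  refine ⟨?_, fun h ↦ ?_, fun h ↦ ?_⟩
  · rintro ⟨t, rfl⟩
    exact ht t (cubicPt_mem_tangent t)
  · obtain ⟨-, t, h⟩ := h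
    exact ht t h
  · obtain ⟨-, s, t, -, h⟩ := h
    refine notMem_imaginaryChord (s := s) (t := t) (fun r ↦ ?_) hα hα' hP
    obtain ⟨a, b, e⟩ := mem_join.1 h
    rw [← e, dotProduct_add, dotProduct_smul, dotProduct_smul, cubicVec_eq, cubicVec_eq,
      form3_dot_ver, form3_dot_ver, bracket_hom_self, bracket_hom_self]
    simp

/-- A fractional linear map `g` over `F` commutes with the Frobenius automorphism, so that it maps
the imaginary chord of `α` and `α ^ q` to that of `g α` and `(g α) ^ q`. -/
theorem Conj.mem_imaginaryChordPts [Finite F] {P P' : Pt F} (h : Conj (F := F) P P')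
    (hP : P ∈ imaginaryChordPts F) : P' ∈ imaginaryChordPts F := by
  obtain ⟨g, rfl⟩ := h
  obtain ⟨α, hα, hα', hP⟩ := hP
  obtain ⟨u, v, huv⟩ := Submodule.mem_span_pair.1 hP
  obtain ⟨σ, hσ⟩ := exists_frobenius (F := F)
  let ι := algebraMap F (AlgebraicClosure F)
  have hdet := g.det_ne_zero
  rw [Matrix.det_fin_two] at hdet
  set m : Matrix (Fin 2) (Fin 2) F := (g : Matrix (Fin 2) (Fin 2) F) with hm
  have hden : ι (m 1 0) * α + ι (m 1 1) ≠ 0 := by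
    intro h0
    by_cases hc : m 1 0 = 0
    · have hd : m 1 1 = 0 := by simpa [hc, ι] using h0
      simp [hc, hd] at hdet
    · refine hα' ⟨-m 1 1 / m 1 0, ?_⟩
      have hc' : ι (m 1 0) ≠ 0 := by simpa [ι] using hc
      rw [map_div₀, map_neg, div_eq_iff hc']
      linear_combination -h0
  have hσσ : σ (σ α) = α := by rw [hσ, hσ, ← pow_mul, ← pow_two, hα]
  have hσι (x : F) : σ (ι x) = ι x := σ.commutes x
  have hden' : ι (m 1 0) * σ α + ι (m 1 1) ≠ 0 := by
    have : σ (ι (m 1 0) * α + ι (m 1 1)) ≠ 0 := (map_ne_zero σ).2 hden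
    rwa [map_add, map_mul, hσι, hσι] at this
  have hφ {x : AlgebraicClosure F} (hx : ι (m 1 0) * x + ι (m 1 1) ≠ 0) :
      sym3 (m.map ι) *ᵥ affineVec x = (ι (m 1 0) * x + ι (m 1 1)) ^ 3 •
        affineVec ((ι (m 0 0) * x + ι (m 0 1)) / (ι (m 1 0) * x + ι (m 1 1))) := by
    rw [affineVec_eq, sym3_mulVec_ver, affineVec_eq, ← ver_smul]
    congr 1
    simp [act, mul_div_cancel₀ _ hx]
  have hmap : (fun i ↦ ι ((sym3 m *ᵥ P.rep) i)) = sym3 (m.map ι) *ᵥ (fun i ↦ ι (P.rep i)) := by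
    rw [← sym3_map]
    exact funext fun i ↦ RingHom.map_mulVec ι _ _ i
  set β := (ι (m 0 0) * α + ι (m 0 1)) / (ι (m 1 0) * α + ι (m 1 1)) with hβ
  have hσβ : β ^ Nat.card F = (ι (m 0 0) * σ α + ι (m 0 1)) / (ι (m 1 0) * σ α + ι (m 1 1)) := by
    rw [← hσ, hβ]; simp [hσι]
  refine ⟨β, ?_, ?_, ?_⟩
  · rw [pow_two, pow_mul, ← hσ, ← hσ, hβ]
    simp [hσι, hσσ]
  · rintro ⟨x, hx⟩
    have e : ι (m 0 0 - x * m 1 0) * α = ι (x * m 1 1 - m 0 1) := by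
      rw [hβ, eq_div_iff hden] at hx
      simp only [map_sub, map_mul]
      linear_combination -hx
    by_cases h0 : m 0 0 - x * m 1 0 = 0
    · rw [h0, map_zero, zero_mul, eq_comm, map_eq_zero] at e
      exact hdet (by linear_combination m 1 1 * h0 + m 1 0 * e)
    · refine hα' ⟨(x * m 1 1 - m 0 1) / (m 0 0 - x * m 1 0), ?_⟩
      have h0' : ι (m 0 0 - x * m 1 0) ≠ 0 := (map_ne_zero ι).2 h0
      rw [map_div₀, div_eq_iff h0', ← e, mul_comm]
  · obtain ⟨hv, e⟩ := moebius_smul_mk g P.rep_nonzero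
    rw [P.mk_rep] at e
    rw [e]
    obtain ⟨a, ha, hrep⟩ := exists_smul_rep hv
    rw [imaginaryChord, Set.mem_ofPred_eq,
      ← Submodule.smul_mem_iff _ (show ι a ≠ 0 by simpa [ι] using ha)]
    have e2 : ι a • (fun i ↦ ι ((Projectivization.mk F (sym3 m *ᵥ P.rep) hv).rep i)) =
        fun i ↦ ι ((sym3 m *ᵥ P.rep) i) := by
      ext i
      rw [Pi.smul_apply, smul_eq_mul, ← map_mul]
      exact congrArg ι (congrFun hrep i).symm
    rw [e2, hmap, ← huv, Matrix.mulVec_add, Matrix.mulVec_smul, Matrix.mulVec_smul, hφ hden,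
      ← hσ α, hφ hden', ← hβ, ← hσβ, smul_smul, smul_smul]
    exact Submodule.mem_span_pair.2 ⟨_, _, rfl⟩

end ImaginaryChords

/-- A finite field has characteristic three exactly when three divides its order. -/
theorem three_eq_zero_iff {F : Type*} [Field F] [Finite F] :
    (3 : F) = 0 ↔ Nat.card F % 3 = 0 := by
  have : Fact (Nat.Prime 3) := ⟨Nat.prime_three⟩
  rw [← Nat.dvd_iff_mod_eq_zero]
  constructor
  · intro h
    have h3 : addOrderOf (1 : F) = 3 := by
      refine addOrderOf_eq_prime ?_ one_ne_zero
      simpa using h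
    exact h3 ▸ addOrderOf_dvd_natCard (1 : F)
  · intro h
    obtain ⟨x, hx⟩ := exists_prime_addOrderOf_dvd_card' 3 h
    have hx0 : x ≠ 0 := by
      rintro rfl
      simp at hx
    have h := addOrderOf_nsmul_eq_zero x
    rw [hx] at h
    simpa [hx0] using h

/-! ### Normal forms of points -/

section NormalForms

variable {F : Type u} [Field F]

theorem conj_mk_of_mulVec {v w : Fin 4 → F} {hv : v ≠ 0} {hw : w ≠ 0}
    {g : Matrix (Fin 2) (Fin 2) F} (hg : g.det ≠ 0) (k : F) (h : sym3 g *ᵥ v = k • w) :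
    Conj (F := F) (Projectivization.mk F v hv) (Projectivization.mk F w hw) := by
  refine ⟨Matrix.GeneralLinearGroup.mkOfDetNeZero g hg, ?_⟩
  obtain ⟨h', e⟩ := moebius_smul_mk (Matrix.GeneralLinearGroup.mkOfDetNeZero g hg) hv
  rw [e, Projectivization.mk_eq_mk_iff']
  exact ⟨k, h.symm⟩

/-- Every point off the cubic on a tangent is equivalent to a point on the tangent at `P(∞)`. -/
theorem exists_conj_of_mem_tangentPts {P : Pt F} (hP : P ∈ tangentPts F) :
    ∃ (a b : F) (h : ![a, b, 0, 0] ≠ 0), b ≠ 0 ∧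
      Conj (F := F) (Projectivization.mk F ![a, b, 0, 0] h) P := by
  classical
  obtain ⟨hPc, t, h⟩ := hP
  obtain ⟨g, ht⟩ := exists_smul_infty_eq t
  have hc : Conj (F := F) ((moebius g)⁻¹ • P) P := ⟨g, by simp⟩
  have hm : (moebius g)⁻¹ • P ∈ tangent (OnePoint.infty : OnePoint F) := by
    rwa [← Set.smul_mem_smul_set_iff (a := moebius g), moebius_smul_tangent, ht, smul_inv_smul]
  obtain ⟨a, b, e⟩ := mem_join.1 hm
  have e' : ![a, b, 0, 0] = ((moebius g)⁻¹ • P).rep := by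
    rw [← e]
    ext i; fin_cases i <;> simp [cubicVec, tangentVec]
  refine ⟨a, b, e' ▸ Projectivization.rep_nonzero _, ?_, ?_⟩
  · rintro rfl
    rw [zero_smul, add_zero] at e
    exact hPc (hc.mem_cubic ⟨_, (eq_cubicPt e.symm).symm⟩)
  · convert hc
    simp only [e', Projectivization.mk_rep]

end NormalForms

/-! ### Osculating planes in characteristic three -/

section CharThree

variable {F : Type u} [Field F]

/-- In characteristic three, the line common to all osculating planes. -/
def axis (F : Type u) [Field F] : Set (Pt F) := {P | P.rep 0 = 0 ∧ P.rep 3 = 0}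

theorem mk_mem_axis {v : Fin 4 → F} (hv : v ≠ 0) :
    Projectivization.mk F v hv ∈ axis F ↔ v 0 = 0 ∧ v 3 = 0 := by
  obtain ⟨a, ha, h⟩ := exists_smul_rep hv
  conv_rhs => rw [h]
  simp [axis, ha]

theorem axis_eq_join : axis F = join ![0, 1, 0, 0] ![0, 0, 1, 0] := by
  ext P
  rw [mem_join]
  constructor
  · rintro ⟨h0, h3⟩
    refine ⟨P.rep 1, P.rep 2, ?_⟩
    ext i; fin_cases i <;> simp [h0, h3]
  · rintro ⟨a, b, h⟩
    simp [axis, ← h]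

theorem linearIndependent_axis :
    LinearIndependent F ![(![0, 1, 0, 0] : Fin 4 → F), ![0, 0, 1, 0]] := by
  rw [LinearIndependent.pair_iff]
  intro s t h
  exact ⟨by simpa using congrFun h 1, by simpa using congrFun h 2⟩

theorem ncard_axis [Finite F] : (axis F).ncard = Nat.card F + 1 := by
  rw [axis_eq_join, ncard_join linearIndependent_axis]

theorem mem_oscPlane_infty {P : Pt F} :
    P ∈ oscPlane (OnePoint.infty : OnePoint F) ↔ P.rep 3 = 0 := by
  change P ∈ plane ![0, 0, 0, 1] ↔ _
  rw [mem_plane, dot_four]; simp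

variable (h3 : (3 : F) = 0)
include h3

theorem two_eq_neg_one : (2 : F) = -1 := by linear_combination h3

theorem two_ne_zero_of_three_eq_zero : (2 : F) ≠ 0 := by
  rw [two_eq_neg_one h3]; simp

theorem cube_injective : Function.Injective (fun x : F ↦ x ^ 3) := by
  intro x y h
  have h : x ^ 3 = y ^ 3 := h
  have : (x - y) ^ 3 = 0 := by linear_combination h - x * y * (x - y) * h3
  exact sub_eq_zero.1 (pow_eq_zero_iff (by norm_num) |>.1 this)

theorem exists_cube_eq [Finite F] (a : F) : ∃ x : F, x ^ 3 = a :=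
  Finite.injective_iff_surjective.1 (cube_injective h3) a

theorem mem_oscPlane_coe {P : Pt F} {t : F} :
    P ∈ oscPlane (t : OnePoint F) ↔ P.rep 0 = t ^ 3 * P.rep 3 := by
  change P ∈ plane ![1, -3 * t, 3 * t ^ 2, -t ^ 3] ↔ _
  rw [mem_plane, dot_four]
  simp [h3, ← sub_eq_add_neg, sub_eq_zero]

/-- In characteristic three the osculating planes are `x₀ = t³ x₃` and `x₃ = 0`; all of them contain
the axis. -/
theorem numOsc_of_mem_axis [Finite F] {P : Pt F} (hP : P ∈ axis F) :
    numOsc P = Nat.card F + 1 := by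
  rw [numOsc, ← card_onePoint, ← Set.ncard_univ]
  congr 1
  ext t
  cases t with
  | infty => simp [mem_oscPlane_infty, hP.2]
  | coe t => simp [mem_oscPlane_coe h3, hP.1, hP.2]

/-- The osculating planes `x₀ = t³ x₃` and `x₃ = 0` form the whole pencil around the axis, because
every element is a cube. -/
theorem numOsc_of_notMem_axis [Finite F] {P : Pt F} (hP : P ∉ axis F) : numOsc P = 1 := by
  rw [numOsc, Set.ncard_eq_one]
  by_cases h : P.rep 3 = 0
  · have h0 : P.rep 0 ≠ 0 := fun h0 ↦ hP ⟨h0, h⟩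
    refine ⟨OnePoint.infty, ?_⟩
    ext t
    cases t with
    | infty => simp [mem_oscPlane_infty, h]
    | coe t => simp [mem_oscPlane_coe h3, h, h0]
  · obtain ⟨x, hx⟩ := exists_cube_eq h3 (P.rep 0 / P.rep 3)
    refine ⟨(x : OnePoint F), ?_⟩
    ext t
    cases t with
    | infty => simp [mem_oscPlane_infty, h]
    | coe t =>
      simp only [Set.mem_ofPred_eq, mem_oscPlane_coe h3, Set.mem_singleton_iff, OnePoint.coe_eq_coe]
      rw [← div_eq_iff h, ← hx]
      exact ⟨fun e ↦ (cube_injective h3 e).symm, fun e ↦ by rw [e]⟩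

/-- The tangent at `P(t)` meets the axis in `(0, 2t, 1, 0)`, and that at `P(∞)` in `(0, 1, 0, 0)`;
these are all points of the axis. -/
theorem axis_subset_tangentPts [Finite F] : axis F ⊆ tangentPts F := by
  intro P hP
  refine ⟨?_, ?_⟩
  · rintro ⟨t, rfl⟩
    have h := numOsc_of_mem_axis h3 hP
    rw [numOsc_cubicPt] at h
    have : 0 < Nat.card F := Nat.card_pos
    omega
  · have h2 := two_ne_zero_of_three_eq_zero h3
    by_cases h : P.rep 2 = 0
    · refine ⟨OnePoint.infty, mem_join.2 ⟨0, P.rep 1, ?_⟩⟩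
      ext i; fin_cases i <;> simp [tangentVec, hP.1, hP.2, h]
    · refine ⟨((P.rep 1 / (2 * P.rep 2) : F) : OnePoint F), mem_join.2 ⟨0, P.rep 2, ?_⟩⟩
      ext i; fin_cases i <;> simp [tangentVec, hP.1, hP.2, h3]
      field_simp

theorem gammaPts_card_add_one [Finite F] : gammaPts F (Nat.card F + 1) = axis F := by
  have : 0 < Nat.card F := Nat.card_pos
  ext P
  constructor
  · rintro ⟨-, h⟩
    by_contra hP
    rw [ncard_developable_eq, numOsc_of_notMem_axis h3 hP] at h
    omega
  · intro hP
    exact ⟨(axis_subset_tangentPts h3 hP).1,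
      by rw [ncard_developable_eq, numOsc_of_mem_axis h3 hP]⟩

theorem toPts_eq [Finite F] : toPts F = tangentPts F \ axis F := by
  have : 0 < Nat.card F := Nat.card_pos
  ext P
  constructor
  · rintro ⟨hP, -, h⟩
    refine ⟨hP, fun hx ↦ ?_⟩
    rw [ncard_developable_eq, numOsc_of_mem_axis h3 hx] at h
    omega
  · rintro ⟨hP, hx⟩
    exact ⟨hP, hP.1, by rw [ncard_developable_eq, numOsc_of_notMem_axis h3 hx]⟩

/-- A point off the cubic, the tangents and the real chords is equivalent to a point `(1, 0, y, 0)`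
with a nonsquare `y`: it lies on just one osculating plane, which may be taken to be `x₃ = 0`. -/
theorem exists_conj_of_notMem [Finite F] {P : Pt F} (hT : P ∉ tangentPts F) (hC : P ∉ cubic F)
    (hR : P ∉ realChordPts F) : ∃ (y : F) (h : ![1, 0, y, 0] ≠ 0), ¬ IsSquare y ∧
      Conj (F := F) (Projectivization.mk F ![1, 0, y, 0] h) P := by
  classical
  have h2 := two_ne_zero_of_three_eq_zero h3
  have hx : P ∉ axis F := fun hx ↦ hT (axis_subset_tangentPts h3 hx)
  obtain ⟨t, ht⟩ : ∃ t, P ∈ oscPlane t := by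
    have h := numOsc_of_notMem_axis h3 hx
    rw [numOsc, Set.ncard_eq_one] at h
    obtain ⟨t, ht⟩ := h
    exact ⟨t, (Set.ext_iff.1 ht t).2 rfl⟩
  obtain ⟨g, hg⟩ := exists_smul_infty_eq t
  have hc : Conj (F := F) ((moebius g)⁻¹ • P) P := ⟨g, by simp⟩
  have hm : (moebius g)⁻¹ • P ∈ oscPlane (OnePoint.infty : OnePoint F) := by
    rwa [← Set.smul_mem_smul_set_iff (a := moebius g), moebius_smul_oscPlane, hg, smul_inv_smul]
  have hx' : (moebius g)⁻¹ • P ∉ axis F := fun h ↦ hT (hc.mem_tangentPts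
    (axis_subset_tangentPts h3 h))
  have hT' : (moebius g)⁻¹ • P ∉ tangentPts F := fun h ↦ hT (hc.mem_tangentPts h)
  have hC' : (moebius g)⁻¹ • P ∉ cubic F := fun h ↦ hC (hc.mem_cubic h)
  have hR' : (moebius g)⁻¹ • P ∉ realChordPts F := fun h ↦ hR (hc.mem_realChordPts h)
  generalize (moebius g)⁻¹ • P = Q at *
  rw [mem_oscPlane_infty] at hm
  have h0 : Q.rep 0 ≠ 0 := fun h ↦ hx' ⟨h, hm⟩
  have hQ2 : Q.rep 2 ≠ 0 := by
    intro h
    refine hT' ⟨hC', OnePoint.infty, mem_join.2 ⟨Q.rep 0, Q.rep 1, ?_⟩⟩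
    ext i; fin_cases i <;> simp [cubicVec, tangentVec, hm, h]
  have hy0 : (![1, 0, Q.rep 2 / Q.rep 0, 0] : Fin 4 → F) ≠ 0 := fun h ↦ by simpa using congrFun h 0
  -- a translation of the parameter removes the second coordinate
  have hcQ : Conj (F := F) Q (Projectivization.mk F ![1, 0, Q.rep 2 / Q.rep 0, 0] hy0) := by
    have := conj_mk_of_mulVec (hv := Q.rep_nonzero) (hw := hy0)
      (g := !![1, Q.rep 1 / Q.rep 2; 0, 1]) (by simp) (Q.rep 0) (by
        ext i
        simp only [Matrix.mulVec, dot_four]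
        fin_cases i <;> simp [sym3, hm, h3, two_eq_neg_one h3]
        · rw [div_mul_cancel₀ _ hQ2, add_neg_cancel]
        · rw [mul_div_cancel₀ _ h0])
    rwa [Q.mk_rep] at this
  refine ⟨Q.rep 2 / Q.rep 0, hy0, ?_, hcQ.symm.trans hc⟩
  rintro ⟨s, hs⟩
  -- if `y = s²`, the point lies on the real chord of `P(1 / s)` and `P(-1 / s)`
  have hs0 : s ≠ 0 := by
    rintro rfl
    rw [mul_zero, div_eq_zero_iff] at hs
    exact hs.elim hQ2 h0
  refine hR' (hcQ.symm.mem_realChordPts ⟨fun h ↦ hC' (hcQ.symm.mem_cubic h),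
    ((s⁻¹ : F) : OnePoint F), ((-s⁻¹ : F) : OnePoint F), ?_, ?_⟩)
  · rw [Ne, OnePoint.coe_eq_coe]
    intro e
    have : 2 * s⁻¹ = 0 := by linear_combination e
    simp [h2, hs0] at this
  · refine (mk_mem_join hy0).2 (Submodule.mem_span_pair.2 ⟨s ^ 3 / 2, - (s ^ 3 / 2), ?_⟩)
    rw [hs]
    ext i; fin_cases i <;> simp [cubicVec, affineVec] <;> field_simp <;> ring

end CharThree

/-! ### The classes of points in characteristic three -/

section CharThreeClasses

variable {F : Type u} [Field F]

/-- For a nonsquare `y` choose `α` with `α² = 1 / y`. Then `α ^ q = -α`, and the imaginary chord of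
`α` and `-α` contains `P(α) - P(-α) = 2 α³ (1, 0, y, 0)`. -/
theorem mk_mem_imaginaryChordPts [Finite F] (h2 : (2 : F) ≠ 0) {y : F} (hy : ¬ IsSquare y)
    (h : ![1, 0, y, 0] ≠ 0) : Projectivization.mk F ![1, 0, y, 0] h ∈ imaginaryChordPts F := by
  obtain ⟨σ, hσ⟩ := exists_frobenius (F := F)
  let ι := algebraMap F (AlgebraicClosure F)
  have hy0 : y ≠ 0 := by
    rintro rfl; exact hy ⟨0, by simp⟩
  obtain ⟨α, hα⟩ := IsAlgClosed.exists_pow_nat_eq (ι y⁻¹) (n := 2) (by norm_num)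
  have hα0 : α ≠ 0 := by
    rintro rfl
    rw [zero_pow two_ne_zero] at hα
    exact (map_ne_zero ι).2 (inv_ne_zero hy0) hα.symm
  have hr : α ∉ Set.range ι := by
    rintro ⟨a, rfl⟩
    rw [← map_pow] at hα
    have := ι.injective hα
    exact hy ⟨a⁻¹, by rw [← pow_two, inv_pow, this, inv_inv]⟩
  have hσα : σ α = -α := by
    have e : σ α ^ 2 = α ^ 2 := by rw [← map_pow, hα]; exact σ.commutes _
    refine (sq_eq_sq_iff_eq_or_eq_neg.1 e).resolve_left fun e ↦ hr ?_
    exact mem_range_of_pow_card_eq (by rw [← hσ, e])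
  refine ⟨α, by rw [pow_two, pow_mul, ← hσ, ← hσ, hσα, map_neg, hσα, neg_neg], hr, ?_⟩
  obtain ⟨a, ha, hrep⟩ := exists_smul_rep h
  have h2' : (2 : AlgebraicClosure F) ≠ 0 := by
    have : ι 2 ≠ 0 := (map_ne_zero ι).2 h2
    rwa [map_ofNat] at this
  rw [imaginaryChord, Set.mem_ofPred_eq, ← Submodule.smul_mem_iff _ ((map_ne_zero ι).2 ha)]
  have e2 : ι a • (fun i ↦ ι ((Projectivization.mk F ![1, 0, y, 0] h).rep i)) =
      fun i ↦ ι ((![1, 0, y, 0] : Fin 4 → F) i) := by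
    ext i
    rw [Pi.smul_apply, smul_eq_mul, ← map_mul]
    exact congrArg ι (congrFun hrep i).symm
  have hαy : α ^ 2 * ι y = 1 := by rw [hα, ← map_mul, inv_mul_cancel₀ hy0, map_one]
  rw [e2, ← hσ, hσα]
  refine Submodule.mem_span_pair.2 ⟨ι y / (2 * α), -(ι y / (2 * α)), ?_⟩
  ext i
  fin_cases i <;> simp [affineVec]
  · field_simp
    linear_combination 2 * hαy
  · field_simp
    ring

variable [Finite F] (h3 : (3 : F) = 0)
include h3

/-- In characteristic three the imaginary chords cover exactly the points off the cubic, the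
tangents and the real chords. -/
theorem mem_imaginaryChordPts_iff {P : Pt F} :
    P ∈ imaginaryChordPts F ↔ P ∉ cubic F ∧ P ∉ tangentPts F ∧ P ∉ realChordPts F := by
  refine ⟨notMem_of_mem_imaginaryChordPts, fun ⟨hC, hT, hR⟩ ↦ ?_⟩
  obtain ⟨y, h, hy, hc⟩ := exists_conj_of_notMem h3 hT hC hR
  exact hc.mem_imaginaryChordPts
    (mk_mem_imaginaryChordPts (two_ne_zero_of_three_eq_zero h3) hy h)

/-- The classes of points in characteristic three, with the condition on the osculating planes
replaced by the position with respect to their common line. -/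
theorem M_of_three_eq_zero : M F = ![cubic F, axis F, tangentPts F \ axis F, realChordPts F,
    imaginaryChordPts F] := by
  rw [M, if_pos (three_eq_zero_iff.1 h3), gammaPts_card_add_one h3, toPts_eq h3]

omit [Finite F] h3 in
theorem notMem_realChordPts_of_mem_tangentPts {P : Pt F} (hT : P ∈ tangentPts F) :
    P ∉ realChordPts F := by
  rintro ⟨hC, s, t, hst, h⟩
  obtain ⟨-, r, hr⟩ := hT
  exact hC (mem_cubic_of_mem_realChord_of_mem_tangent hst h hr)

theorem exists_mem_M_of_eq (P : Pt F) : ∃ j, P ∈ M F j := by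
  rw [M_of_three_eq_zero h3]
  have hI := mem_imaginaryChordPts_iff h3 (P := P)
  by_cases hC : P ∈ cubic F
  · exact ⟨0, hC⟩
  by_cases hR : P ∈ realChordPts F
  · exact ⟨3, hR⟩
  by_cases hT : P ∈ tangentPts F
  · by_cases hx : P ∈ axis F
    · exact ⟨1, hx⟩
    · exact ⟨2, hT, hx⟩
  · exact ⟨4, hI.2 ⟨hC, hT, hR⟩⟩

theorem eq_of_mem_M_of_eq {P : Pt F} {i j : Fin 5} (hi : P ∈ M F i) (hj : P ∈ M F j) :
    i = j := by
  rw [M_of_three_eq_zero h3] at hi hj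
  have hI := mem_imaginaryChordPts_iff h3 (P := P)
  have hTC : P ∈ tangentPts F → P ∉ cubic F := fun h ↦ h.1
  have hRC : P ∈ realChordPts F → P ∉ cubic F := fun h ↦ h.1
  have hxT : P ∈ axis F → P ∈ tangentPts F := fun h ↦ axis_subset_tangentPts h3 h
  have hTR := notMem_realChordPts_of_mem_tangentPts (P := P)
  fin_cases i <;> fin_cases j <;> simp at hi hj ⊢ <;> tauto

/-- Each class of points in characteristic three is an orbit, with the normal forms `(1, 0, 0, 0)`,
`(0, 1, 0, 0)`, `(1, 1, 0, 0)`, `(1, 0, 0, 1)` and `(1, 0, y, 0)`, where `y` is any nonsquare. -/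
theorem conj_of_mem_M_of_eq {P P' : Pt F} {j : Fin 5} (h : P ∈ M F j) (h' : P' ∈ M F j) :
    Conj (F := F) P P' := by
  classical
  have := Fintype.ofFinite F
  rw [M_of_three_eq_zero h3] at h h'
  by_cases hj : j = 4
  · subst hj
    obtain ⟨hC, hT, hR⟩ := (mem_imaginaryChordPts_iff h3).1 h
    obtain ⟨y, hv, hy, hc⟩ := exists_conj_of_notMem h3 hT hC hR
    obtain ⟨hC, hT, hR⟩ := (mem_imaginaryChordPts_iff h3).1 h'
    obtain ⟨y', hv', hy', hc'⟩ := exists_conj_of_notMem h3 hT hC hR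
    refine hc.symm.trans (Conj.trans ?_ hc')
    have hne {y : F} (hy : ¬ IsSquare y) : y ≠ 0 := by
      rintro rfl; exact hy ⟨0, by simp⟩
    -- the product of two nonsquares is a square
    have hsq : IsSquare (y * y') := by
      rw [← quadraticChar_one_iff_isSquare (mul_ne_zero (hne hy) (hne hy')), map_mul,
        quadraticChar_neg_one_iff_not_isSquare.2 hy, quadraticChar_neg_one_iff_not_isSquare.2 hy']
      norm_num
    obtain ⟨r, hr⟩ := hsq
    have hy0 := hne hy
    have hy0' := hne hy'
    have hr0 : r ≠ 0 := by
      rintro rfl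
      simp [hy0, hy0'] at hr
    refine conj_mk_of_mulVec (g := !![r / y', 0; 0, 1]) (by simp [hr0, hy0']) ((r / y') ^ 3) ?_
    ext i
    simp only [Matrix.mulVec, dot_four]
    fin_cases i <;> simp [sym3]
    field_simp
    linear_combination hr
  -- in the other classes every point is equivalent to a fixed one
  suffices hs : ∃ Q : Pt F, ∀ P ∈ M F j, Conj (F := F) P Q by
    rw [M_of_three_eq_zero h3] at hs
    obtain ⟨Q, hQ⟩ := hs
    exact (hQ P h).trans (hQ P' h').symm
  rw [M_of_three_eq_zero h3]
  have hT (P : Pt F) (hP : P ∈ tangentPts F) : ∃ (a b : F) (h : ![a, b, 0, 0] ≠ 0), b ≠ 0 ∧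
      Conj (F := F) P (Projectivization.mk F ![a, b, 0, 0] h) ∧ (P ∈ axis F ↔ a = 0) := by
    obtain ⟨a, b, hv, hb, hc⟩ := exists_conj_of_mem_tangentPts hP
    refine ⟨a, b, hv, hb, hc.symm, ?_⟩
    have e := hc.numOsc_eq
    have e' := mk_mem_axis hv
    simp only [Matrix.cons_val] at e'
    have : 0 < Nat.card F := Nat.card_pos
    by_cases h1 : P ∈ axis F <;> by_cases h2 : Projectivization.mk F ![a, b, 0, 0] hv ∈ axis F
    · simpa [h1, h2] using e'
    · rw [numOsc_of_mem_axis h3 h1, numOsc_of_notMem_axis h3 h2] at e; omega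
    · rw [numOsc_of_notMem_axis h3 h1, numOsc_of_mem_axis h3 h2] at e; omega
    · simpa [h1, h2] using e'
  fin_cases j
  · refine ⟨cubicPt OnePoint.infty, ?_⟩
    rintro P ⟨t, rfl⟩
    obtain ⟨g, rfl⟩ := exists_smul_infty_eq t
    exact Conj.symm ⟨g, moebius_smul_cubicPt g _⟩
  · refine ⟨Projectivization.mk F ![0, 1, 0, 0] (fun h ↦ by simpa using congrFun h 1), ?_⟩
    intro P hP
    obtain ⟨a, b, hv, hb, hc, hx⟩ := hT P (axis_subset_tangentPts h3 hP)
    obtain rfl := hx.1 hP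
    refine hc.trans (conj_mk_of_mulVec (g := 1) (by simp) b ?_)
    rw [map_one, Matrix.one_mulVec]
    ext i; fin_cases i <;> simp
  · refine ⟨Projectivization.mk F ![1, 1, 0, 0] (fun h ↦ by simpa using congrFun h 1), ?_⟩
    intro P hP
    obtain ⟨a, b, hv, hb, hc, hx⟩ := hT P hP.1
    have ha : a ≠ 0 := fun ha ↦ hP.2 (hx.2 ha)
    refine hc.trans (conj_mk_of_mulVec (g := !![b / a, 0; 0, 1]) (by simp [ha, hb])
      (b ^ 3 / a ^ 2) ?_)
    ext i
    simp only [Matrix.mulVec, dot_four]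
    fin_cases i <;> simp [sym3] <;> field_simp
  · refine ⟨Projectivization.mk F ![1, 0, 0, 1] (fun h ↦ by simpa using congrFun h 0), ?_⟩
    intro P hP
    obtain ⟨a, d, hv, ha, hd, hc⟩ := exists_conj_of_mem_realChordPts hP
    obtain ⟨s, hs⟩ := exists_cube_eq h3 (d / a)
    have hs0 : s ≠ 0 := by
      rintro rfl
      simp [ha, hd, eq_comm] at hs
    refine hc.symm.trans (conj_mk_of_mulVec (g := !![s, 0; 0, 1]) (by simp [hs0]) d ?_)
    ext i
    simp only [Matrix.mulVec, dot_four]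
    fin_cases i <;> simp [sym3, hs, ha]
  · exact absurd rfl hj

theorem Conj.mem_M_of_eq {P P' : Pt F} {j : Fin 5} (h : Conj (F := F) P P') (hP : P ∈ M F j) :
    P' ∈ M F j := by
  have hg (μ : ℕ) (hP : P ∈ gammaPts F μ) : P' ∈ gammaPts F μ :=
    ⟨mt h.symm.mem_cubic hP.1, by
      rw [ncard_developable_eq, ← h.numOsc_eq, ← ncard_developable_eq]; exact hP.2⟩
  rw [M, if_pos (three_eq_zero_iff.1 h3)] at hP ⊢
  fin_cases j
  · exact h.mem_cubic hP
  · exact hg _ hP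
  · exact ⟨h.mem_tangentPts hP.1, hg _ hP.2⟩
  · exact h.mem_realChordPts hP
  · exact h.mem_imaginaryChordPts hP

end CharThreeClasses

/-! ### Plane sections of the classes in characteristic three -/

section CharThreeCounting

variable {F : Type u} [Field F] [Finite F] (h3 : (3 : F) = 0)
include h3

omit [Finite F] in
theorem axis_subset_oscPlane (t : OnePoint F) : axis F ⊆ oscPlane t := by
  intro P hP
  cases t with
  | infty => exact mem_oscPlane_infty.2 hP.2
  | coe t => rw [mem_oscPlane_coe h3, hP.1, hP.2, mul_zero]

/-- In characteristic three the osculating planes are all the planes through the axis. -/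
theorem plane_mem_developable {c : Fin 4 → F} (hc : c ≠ 0) (h1 : c 1 = 0) (h2 : c 2 = 0) :
    plane c ∈ developable F := by
  by_cases h0 : c 0 = 0
  · refine ⟨OnePoint.infty, (plane_eq_of_smul (a := c 3) ?_ ?_).symm⟩
    · intro h
      apply hc
      ext i; fin_cases i <;> simp [h0, h1, h2, h]
    · ext i; fin_cases i <;> simp [h0, h1, h2]
  · obtain ⟨t, ht⟩ := exists_cube_eq h3 (-c 3 / c 0)
    refine ⟨(t : OnePoint F), (plane_eq_of_smul h0 ?_).symm⟩
    ext i; fin_cases i <;> simp [h1, h2, h3, ht]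
    field_simp

theorem ncard_inter_axis {i : Fin 5} {π : Set (Pt F)} (hπ : π ∈ N F i) :
    (π ∩ axis F).ncard = if i = 0 then Nat.card F + 1 else 1 := by
  split_ifs with hi
  · subst hi
    obtain ⟨t, rfl⟩ := hπ
    rw [Set.inter_eq_self_of_subset_right (axis_subset_oscPlane h3 t), ncard_axis]
  · obtain ⟨c, hc, rfl⟩ := isPlane_of_mem_N hπ
    rw [Set.inter_comm, axis_eq_join]
    refine ncard_join_inter_plane linearIndependent_axis ?_
    by_contra! h
    rw [dot_four, dot_four] at h
    exact hi (eq_of_mem_N hπ (plane_mem_developable h3 hc (by simpa using h.1)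
      (by simpa using h.2)))

/-- The sizes of the classes of points in characteristic three. -/
theorem card_M_of_eq (j : Fin 5) : (Nat.card (M F j) : ℚ) = sizeM (Nat.card F) 0 j := by
  have := Fintype.ofFinite (Pt F)
  have hsum := sum_eq_sum_classes (M F) (exists_mem_M_of_eq h3)
    (fun P i j ↦ eq_of_mem_M_of_eq h3) (fun _ ↦ 1) (fun _ ↦ 1) (fun _ _ _ ↦ rfl)
  rw [Finset.sum_const, Finset.card_univ, ← Nat.card_eq_fintype_card, card_pt,
    Fin.sum_univ_five] at hsum
  have e0 : (M F 0).ncard = Nat.card F + 1 := by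
    rw [M_of_three_eq_zero h3, ← card_onePoint, ← Nat.card_range_of_injective cubicPt_injective,
      Nat.card_coe_set_eq]
    rfl
  have e1 : (M F 1).ncard = Nat.card F + 1 := by
    rw [M_of_three_eq_zero h3]; exact ncard_axis
  have e2 : (M F 2).ncard + (M F 1).ncard = (Nat.card F + 1) * Nat.card F := by
    rw [M_of_three_eq_zero h3, ← ncard_tangentPts]
    exact Set.ncard_sdiff_add_ncard_of_subset (axis_subset_tangentPts h3)
  have e3 : (M F 3).ncard * 2 = (Nat.card F + 1) * Nat.card F * (Nat.card F - 1) := by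
    rw [M_of_three_eq_zero h3]
    refine ncard_realChordPts.trans ?_
    rw [show (Nat.card F + 1).descFactorial 2 = (Nat.card F + 1) * Nat.card F by
      simp [Nat.descFactorial]; ring]
  rw [Nat.card_coe_set_eq]
  obtain ⟨κ, hκ⟩ : ∃ κ : Fin 5 → ℕ, ∀ j, (M F j).ncard = κ j := ⟨_, fun _ ↦ rfl⟩
  obtain ⟨c, hc⟩ : ∃ c : Fin 5 → ℚ, ∀ j, (κ j : ℚ) = c j := ⟨_, fun _ ↦ rfl⟩
  simp only [hκ] at *
  have h0 : 1 ≤ Nat.card F := Nat.card_pos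
  qify [h0] at e0 e1 e2 e3 hsum
  simp only [hc] at e0 e1 e2 e3 hsum ⊢
  fin_cases j <;> simp [sizeM] <;> simp at hsum <;> linarith

/-- The intersections of a plane with the classes of points in characteristic three. -/
theorem ncard_inter_M_of_eq (hq5 : 5 ≤ Nat.card F) {i : Fin 5} {π : Set (Pt F)} (hπ : π ∈ N F i)
    (j : Fin 5) : ((π ∩ M F j).ncard : ℚ) = tableK (Nat.card F) 0 i j := by
  classical
  have := Fintype.ofFinite π
  have hpl := isPlane_of_mem_N hπ
  have e0 : (π ∩ M F 0).ncard = numN i := by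
    rw [← numCubic_of_mem_N hπ, numCubic, M_of_three_eq_zero h3]; rfl
  have e1 : (π ∩ M F 1).ncard = if i = 0 then Nat.card F + 1 else 1 := by
    rw [← ncard_inter_axis h3 hπ, M_of_three_eq_zero h3]; rfl
  have e2 : (π ∩ M F 2).ncard + (π ∩ M F 1).ncard =
      numTangentsN i * Nat.card F + (Nat.card F + 1 - numN i) := by
    rw [← numCubic_of_mem_N hπ, ← numTangents_of_mem_N hπ, ← ncard_inter_tangentPts hpl,
      M_of_three_eq_zero h3]
    have e : π ∩ (tangentPts F \ axis F) = (π ∩ tangentPts F) \ (π ∩ axis F) := by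
      ext P; simp only [Set.mem_inter_iff, Set.mem_sdiff]; tauto
    change (π ∩ (tangentPts F \ axis F)).ncard + (π ∩ axis F).ncard = _
    rw [e]
    exact Set.ncard_sdiff_add_ncard_of_subset
      (Set.inter_subset_inter_right π (axis_subset_tangentPts h3))
  have e3 := ncard_inter_realChordPts hpl
  rw [numCubic_of_mem_N hπ, show realChordPts F = M F 3 by rw [M_of_three_eq_zero h3]; rfl] at e3
  have esum := sum_coe_eq_sum_classes (M F) (exists_mem_M_of_eq h3)
    (fun P i j ↦ eq_of_mem_M_of_eq h3) π (fun _ ↦ 1) (fun _ ↦ 1) (fun _ _ _ ↦ rfl)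
  rw [Finset.sum_const, Finset.card_univ, ← Nat.card_eq_fintype_card, Nat.card_coe_set_eq,
    ncard_plane hpl, Fin.sum_univ_five] at esum
  -- the points on the cubic, on the axis, on the tangents and on the real chords and the total
  -- number of points give five linear equations; the substitution `|F| = p + 3` removes the
  -- truncated subtractions
  obtain ⟨p, hp⟩ : ∃ p, Nat.card F = p + 3 := ⟨Nat.card F - 3, by omega⟩
  rw [hp] at e1 e2 esum e3 ⊢
  obtain ⟨κ, hκ⟩ : ∃ κ : Fin 5 → ℕ, ∀ j, (π ∩ M F j).ncard = κ j := ⟨_, fun _ ↦ rfl⟩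
  obtain ⟨c, hc⟩ : ∃ c : Fin 5 → ℚ, ∀ j, (κ j : ℚ) = c j := ⟨_, fun _ ↦ rfl⟩
  simp only [hκ] at *
  clear hπ
  rw [hc]
  fin_cases i <;>
    simp [numN, numTangentsN, Nat.descFactorial] at e0 e1 e2 esum e3 <;>
    qify at e0 e1 e2 esum e3 <;>
    simp only [hc] at e0 e1 e2 esum e3 <;>
    fin_cases j <;> simp [tableK] <;> linarith

end CharThreeCounting

/-! ### Orbits -/

section Orbits

variable {F : Type u} [Field F] [Finite F]

theorem three_ne_zero_of_mod {F : Type*} [Field F] [Finite F] (h : Nat.card F % 3 ≠ 0) :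
    (3 : F) ≠ 0 := mt three_eq_zero_iff.1 h

theorem exists_mem_M (P : Pt F) : ∃ j, P ∈ M F j := by
  by_cases h : Nat.card F % 3 = 0
  · exact exists_mem_M_of_eq (three_eq_zero_iff.2 h) P
  · exact exists_mem_M_of_ne (three_ne_zero_of_mod h) h P

theorem eq_of_mem_M {P : Pt F} {i j : Fin 5} (hi : P ∈ M F i) (hj : P ∈ M F j) : i = j := by
  by_cases h : Nat.card F % 3 = 0
  · exact eq_of_mem_M_of_eq (three_eq_zero_iff.2 h) hi hj
  · exact eq_of_mem_M_of_ne (three_ne_zero_of_mod h) h hi hj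

theorem conj_of_mem_M {P P' : Pt F} {j : Fin 5} (h : P ∈ M F j) (h' : P' ∈ M F j) :
    Conj (F := F) P P' := by
  by_cases hq : Nat.card F % 3 = 0
  · exact conj_of_mem_M_of_eq (three_eq_zero_iff.2 hq) h h'
  · exact conj_of_mem_M_of_ne (three_ne_zero_of_mod hq) hq h h'

theorem Conj.mem_M {P P' : Pt F} {j : Fin 5} (h : Conj (F := F) P P') (hP : P ∈ M F j) :
    P' ∈ M F j := by
  by_cases hq : Nat.card F % 3 = 0
  · exact h.mem_M_of_eq (three_eq_zero_iff.2 hq) hP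
  · exact h.mem_M_of_ne (three_ne_zero_of_mod hq) hq hP

/-- For `q ≥ 5` the orbits of the group of the cubic are the classes of conjugacy under the
projectivities of the parameter line. -/
theorem mem_orbit_cubicGroup_iff {X : Type*} [MulAction (Matrix.ProjGenLinGroup (Fin 4) F) X]
    (hq : 5 ≤ Nat.card F) {x y : X} :
    y ∈ MulAction.orbit (cubicGroup F) x ↔ Conj (F := F) x y := by
  classical
  constructor
  · rintro ⟨⟨A, hA⟩, rfl⟩
    obtain ⟨g, rfl⟩ := exists_moebius_eq hq hA
    exact ⟨g, rfl⟩
  · rintro ⟨g, rfl⟩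
    exact ⟨⟨_, moebius_mem_cubicGroup g⟩, rfl⟩

theorem orbit_eq_N (hq : 5 ≤ Nat.card F) {i : Fin 5} {π : Set (Pt F)} (hπ : π ∈ N F i) :
    MulAction.orbit (cubicGroup F) π = N F i := by
  classical
  ext π'
  rw [mem_orbit_cubicGroup_iff hq]
  exact ⟨fun h ↦ h.mem_N hπ, fun h ↦ conj_of_mem_N hπ h⟩

theorem orbit_eq_M (hq : 5 ≤ Nat.card F) {j : Fin 5} {P : Pt F} (hP : P ∈ M F j) :
    MulAction.orbit (cubicGroup F) P = M F j := by
  ext P'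
  rw [mem_orbit_cubicGroup_iff hq]
  exact ⟨fun h ↦ h.mem_M hP, fun h ↦ conj_of_mem_M hP h⟩

theorem sizeN_pos {q : ℚ} (hq : 5 ≤ q) (i : Fin 5) : 0 < sizeN q i := by
  have h : 0 < q ^ 3 - q := by
    have : q ^ 3 - q = q * (q - 1) * (q + 1) := by ring
    rw [this]
    have : 0 < q - 1 := by linarith
    positivity
  fin_cases i <;> simp [sizeN] <;> first | positivity | linarith

theorem sizeM_pos {q : ℚ} (hq : 5 ≤ q) (ξ : ℤ) (i : Fin 5) : 0 < sizeM q ξ i := by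
  have h := sizeN_pos hq
  rw [sizeM]
  split_ifs
  · have h2 : (1 : ℚ) < q ^ 2 := by nlinarith
    fin_cases i
    · exact h 0
    · exact h 0
    · simpa using h2
    · exact h 3
    · exact h 3
  · exact h i

theorem card_M {ξ : ℤ} (hξ : ξ = -1 ∨ ξ = 0 ∨ ξ = 1) (hmod : (Nat.card F : ℤ) ≡ ξ [ZMOD 3])
    (j : Fin 5) : (Nat.card (M F j) : ℚ) = sizeM (Nat.card F) ξ j := by
  rcases residue_cases hξ hmod with ⟨rfl, h⟩ | ⟨rfl, h⟩ | ⟨rfl, h⟩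
  · have hq : Nat.card F % 3 ≠ 0 := by omega
    rw [Nat.card_coe_set_eq, card_M_eq (three_ne_zero_of_mod hq) hq, card_N]
    rfl
  · exact card_M_of_eq (three_eq_zero_iff.2 h) j
  · have hq : Nat.card F % 3 ≠ 0 := by omega
    rw [Nat.card_coe_set_eq, card_M_eq (three_ne_zero_of_mod hq) hq, card_N]
    rfl

theorem ncard_inter_M (hq5 : 5 ≤ Nat.card F) {ξ : ℤ} (hξ : ξ = -1 ∨ ξ = 0 ∨ ξ = 1)
    (hmod : (Nat.card F : ℤ) ≡ ξ [ZMOD 3]) {i : Fin 5} {π : Set (Pt F)} (hπ : π ∈ N F i)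
    (j : Fin 5) : ((π ∩ M F j).ncard : ℚ) = tableK (Nat.card F) ξ i j := by
  rcases residue_cases hξ hmod with ⟨rfl, h⟩ | ⟨rfl, h⟩ | ⟨rfl, h⟩
  · exact ncard_inter_M_of_ne hq5 (three_ne_zero_of_mod (by omega)) (Or.inl ⟨rfl, h⟩) hπ j
  · exact ncard_inter_M_of_eq (three_eq_zero_iff.2 h) hq5 hπ j
  · exact ncard_inter_M_of_ne hq5 (three_ne_zero_of_mod (by omega)) (Or.inr ⟨rfl, h⟩) hπ j

theorem exists_mem_N_index (hq : 5 ≤ Nat.card F) (i : Fin 5) : ∃ π, π ∈ N F i := by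
  have h := sizeN_pos (q := Nat.card F) (by exact_mod_cast hq) i
  rw [← card_N, Nat.cast_pos, Nat.card_coe_set_eq] at h
  exact Set.nonempty_of_ncard_ne_zero h.ne'

theorem exists_mem_M_index (hq : 5 ≤ Nat.card F) (j : Fin 5) : ∃ P, P ∈ M F j := by
  obtain ⟨ξ, hξ, hmod⟩ : ∃ ξ : ℤ, (ξ = -1 ∨ ξ = 0 ∨ ξ = 1) ∧ (Nat.card F : ℤ) ≡ ξ [ZMOD 3] := by
    unfold Int.ModEq
    have h : Nat.card F % 3 = 0 ∨ Nat.card F % 3 = 1 ∨ Nat.card F % 3 = 2 := by omega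
    rcases h with h | h | h
    exacts [⟨0, by omega, by omega⟩, ⟨1, by omega, by omega⟩, ⟨-1, by omega, by omega⟩]
  have h := sizeM_pos (q := Nat.card F) (by exact_mod_cast hq) ξ j
  rw [← card_M hξ hmod, Nat.cast_pos, Nat.card_coe_set_eq] at h
  exact Set.nonempty_of_ncard_ne_zero h.ne'

theorem injective_N (hq : 5 ≤ Nat.card F) : Function.Injective (N F) := fun i j h ↦ by
  obtain ⟨π, hπ⟩ := exists_mem_N_index hq i
  exact eq_of_mem_N hπ (h ▸ hπ)

theorem injective_M (hq : 5 ≤ Nat.card F) : Function.Injective (M F) := fun i j h ↦ by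
  obtain ⟨P, hP⟩ := exists_mem_M_index hq i
  exact eq_of_mem_M hP (h ▸ hP)

theorem range_N (hq : 5 ≤ Nat.card F) :
    Set.range (N F) = {O | ∃ π, IsPlane π ∧ O = MulAction.orbit (cubicGroup F) π} := by
  ext O
  constructor
  · rintro ⟨i, rfl⟩
    obtain ⟨π, hπ⟩ := exists_mem_N_index hq i
    exact ⟨π, isPlane_of_mem_N hπ, (orbit_eq_N hq hπ).symm⟩
  · rintro ⟨π, hπ, rfl⟩
    obtain ⟨i, hi⟩ := exists_mem_N hπ
    exact ⟨i, (orbit_eq_N hq hi).symm⟩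

theorem range_M (hq : 5 ≤ Nat.card F) :
    Set.range (M F) = {O | ∃ P, O = MulAction.orbit (cubicGroup F) P} := by
  ext O
  constructor
  · rintro ⟨j, rfl⟩
    obtain ⟨P, hP⟩ := exists_mem_M_index hq j
    exact ⟨P, (orbit_eq_M hq hP).symm⟩
  · rintro ⟨P, rfl⟩
    obtain ⟨j, hj⟩ := exists_mem_M P
    exact ⟨j, (orbit_eq_M hq hj).symm⟩

end Orbits

/-! ### The tactical configurations -/

section Tactical

variable {F : Type u} [Field F]

theorem block_eq_one_iff {i j : Fin 5} {π : N F i} {P : M F j} :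
    block F i j π P = 1 ↔ (P : Pt F) ∈ (π : Set (Pt F)) := by
  simp [block]

theorem block_eq_zero_or_one {i j : Fin 5} (π : N F i) (P : M F j) :
    block F i j π P = 0 ∨ block F i j π P = 1 := by
  by_cases h : (P : Pt F) ∈ (π : Set (Pt F)) <;> simp [block, h]

theorem rowOnes_block {i j : Fin 5} (π : N F i) :
    rowOnes (block F i j) π = ((π : Set (Pt F)) ∩ M F j).ncard := by
  rw [Set.inter_comm, ← ncard_coe_mem]
  simp only [rowOnes, block_eq_one_iff]

theorem colOnes_block {i j : Fin 5} (P : M F j) :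
    colOnes (block F i j) P = {π | π ∈ N F i ∧ (P : Pt F) ∈ π}.ncard := by
  have h := ncard_coe_mem (N F i) {π | (P : Pt F) ∈ π}
  simp only [colOnes, block_eq_one_iff]
  exact h

/-- The column sums of a block are equal because the group is transitive on the columns and
preserves the class of the rows. -/
theorem colOnes_block_eq [Finite F] {i j : Fin 5} (P P' : M F j) :
    colOnes (block F i j) P = colOnes (block F i j) P' := by
  classical
  obtain ⟨g, hg⟩ := conj_of_mem_M P.2 P'.2
  rw [colOnes_block, colOnes_block, ← Set.ncard_image_of_injective
    {π | π ∈ N F i ∧ (P : Pt F) ∈ π} (MulAction.injective (moebius g))]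
  congr 1
  ext π
  simp only [Set.mem_image, Set.mem_ofPred_eq]
  constructor
  · rintro ⟨π, ⟨h1, h2⟩, rfl⟩
    exact ⟨Conj.mem_N ⟨g, rfl⟩ h1, by rw [← hg]; exact Set.smul_mem_smul_set h2⟩
  · rintro ⟨h1, h2⟩
    refine ⟨(moebius g)⁻¹ • π, ⟨Conj.mem_N (Conj.symm ⟨g, by simp⟩) h1, ?_⟩, by simp⟩
    rwa [Set.mem_inv_smul_set_iff, hg]

/-- The ones of the matrix, counted by rows and by columns. -/
theorem IsTactical.mul_card_eq {m n : Type*} [Finite m] [Finite n] {A : Matrix m n ℕ} {k r : ℕ}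
    (h : IsTactical A k r) : Nat.card m * k = Nat.card n * r := by
  have := Fintype.ofFinite m
  have := Fintype.ofFinite n
  have e := sum_ncard_comm (fun a b ↦ A a b = 1)
  have h1 (a : m) : {b | A a b = 1}.ncard = k := h.2.1 a
  have h2 (b : n) : {a | A a b = 1}.ncard = r := h.2.2 b
  simpa [h1, h2] using e

theorem IsTactical.transpose {m n : Type*} {A : Matrix m n ℕ} {k r : ℕ} (h : IsTactical A k r) :
    IsTactical Aᵀ r k := ⟨fun a b ↦ h.1 b a, h.2.2, h.2.1⟩

theorem tableK_mul_sizeN (q : ℚ) (ξ : ℤ) (i j : Fin 5) :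
    sizeN q i * tableK q ξ i j = sizeM q ξ j * tableR q ξ i j := by
  rw [tableK, tableR, sizeM]
  split_ifs
  · fin_cases i <;> fin_cases j <;> simp [sizeN] <;> ring
  · fin_cases i <;> fin_cases j <;> simp [sizeN] <;> ring

/-- The row sums are the intersection numbers of a plane with the classes of points; the column sums
are constant by transitivity, and their value follows by double counting. -/
theorem exists_isTactical [Finite F] (hq5 : 5 ≤ Nat.card F) {ξ : ℤ}
    (hξ : ξ = -1 ∨ ξ = 0 ∨ ξ = 1) (hmod : (Nat.card F : ℤ) ≡ ξ [ZMOD 3]) (i j : Fin 5) :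
    ∃ k r : ℕ, IsTactical (block F i j) k r ∧ (k : ℚ) = tableK (Nat.card F) ξ i j ∧
      (r : ℚ) = tableR (Nat.card F) ξ i j := by
  obtain ⟨π, hπ⟩ := exists_mem_N_index hq5 i
  obtain ⟨P, hP⟩ := exists_mem_M_index hq5 j
  have hk := ncard_inter_M hq5 hξ hmod hπ j
  have ht : IsTactical (block F i j) (π ∩ M F j).ncard (colOnes (block F i j) ⟨P, hP⟩) := by
    refine ⟨block_eq_zero_or_one, fun π' ↦ ?_, fun P' ↦ colOnes_block_eq _ _⟩
    rw [rowOnes_block]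
    have := ncard_inter_M hq5 hξ hmod π'.2 j
    exact_mod_cast this.trans hk.symm
  refine ⟨_, _, ht, hk, ?_⟩
  have e := ht.mul_card_eq
  qify at e
  rw [card_N, hk, card_M hξ hmod, tableK_mul_sizeN] at e
  exact (mul_left_cancel₀ (sizeM_pos (by exact_mod_cast hq5) ξ j).ne' e).symm

end Tactical

/-! ### Transposed blocks -/

section Transposes

/-- A zero-one matrix with one entry in each column and with constant row sums `k` is the incidence
matrix of a projection `m × Fin k → m`. -/
theorem IsTactical.exists_equiv_prod {m n : Type*} [Finite n] {A : Matrix m n ℕ} {k : ℕ}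
    (hA : IsTactical A k 1) : ∃ E : n ≃ m × Fin k, ∀ a b, A a b = 1 ↔ (E b).1 = a := by
  have h1 (b : n) : ∃ a, {a | A a b = 1} = {a} := Set.ncard_eq_one.1 (hA.2.2 b)
  choose φ hφ using h1
  have hφ' (a : m) (b : n) : A a b = 1 ↔ φ b = a := by
    rw [eq_comm (a := φ b)]; exact Set.ext_iff.1 (hφ b) a
  have h2 (a : m) : Nat.card {b // φ b = a} = k := by
    have e : {b | A a b = 1}.ncard = k := hA.2.1 a
    simp only [hφ'] at e
    rw [← e, ← Nat.card_coe_set_eq]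
    rfl
  refine ⟨(Equiv.sigmaFiberEquiv φ).symm.trans ((Equiv.sigmaCongrRight fun a ↦
    Finite.equivFinOfCardEq (h2 a)).trans (Equiv.sigmaEquivProd m (Fin k))), fun a b ↦ ?_⟩
  rw [hφ']
  rfl

/-- Two zero-one matrices of the same size with one entry in each column and with constant row
sums agree up to rearrangement. -/
theorem sameUpToRearrangement_of_isTactical_one {m n m' n' : Type*} [Finite m] [Finite n]
    [Finite m'] [Finite n'] {A : Matrix m n ℕ} {B : Matrix m' n' ℕ} {k : ℕ}
    (hA : IsTactical A k 1) (hB : IsTactical B k 1) (h : Nat.card m = Nat.card m') :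
    SameUpToRearrangement A B := by
  obtain ⟨E, hE⟩ := hA.exists_equiv_prod
  obtain ⟨E', hE'⟩ := hB.exists_equiv_prod
  obtain ⟨e⟩ : Nonempty (m ≃ m') := Finite.card_eq.1 h
  refine ⟨e, E.trans ((e.prodCongr (Equiv.refl _)).trans E'.symm), ?_⟩
  ext a' b'
  obtain ⟨a, rfl⟩ := e.surjective a'
  obtain ⟨b, rfl⟩ := (E.trans ((e.prodCongr (Equiv.refl _)).trans E'.symm)).surjective b'
  rw [Matrix.reindex_apply, Matrix.submatrix_apply, Equiv.symm_apply_apply, Equiv.symm_apply_apply]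
  have h1 := hE a b
  have h2 := hE' (e a) (E'.symm ((E b).map e id))
  rw [Equiv.apply_symm_apply, Prod.map_fst, e.injective.eq_iff] at h2
  have h3 : A a b = 1 ↔ B (e a) (E'.symm ((E b).map e id)) = 1 := h1.trans h2.symm
  change A a b = B (e a) (E'.symm ((E b).map e id))
  have h4 := hA.1 a b
  have h5 := hB.1 (e a) (E'.symm ((E b).map e id))
  omega

/-- The polarity matches the points of each class with the planes of the same index, and it
preserves incidence by `mem_polarPlane_comm`. -/
theorem sameUpToRearrangement_block {F : Type u} [Field F] [Finite F]
    (hq : Nat.card F % 3 ≠ 0) (i j : Fin 5) :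
    SameUpToRearrangement (block F i j)ᵀ (block F j i) := by
  have h3 : (3 : F) ≠ 0 := three_ne_zero_of_mod hq
  let e (i : Fin 5) : M F i ≃ N F i := Equiv.ofBijective
    (fun P ↦ ⟨polarPlane P.1, (mem_M_iff h3 hq).1 P.2⟩) (by
      constructor
      · intro P Q h
        exact Subtype.ext (polarPlane_injective h3 (congrArg Subtype.val h))
      · rintro ⟨π, hπ⟩
        obtain ⟨P, rfl⟩ := exists_polarPlane_eq h3 (isPlane_of_mem_N hπ)
        exact ⟨⟨P, (mem_M_iff h3 hq).2 hπ⟩, rfl⟩)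
  refine ⟨e j, (e i).symm, ?_⟩
  ext π P
  obtain ⟨Q, rfl⟩ := (e j).surjective π
  have hs : (P : Pt F) ∈ polarPlane (Q : Pt F) ↔ (Q : Pt F) ∈ polarPlane (P : Pt F) :=
    mem_polarPlane_comm
  rw [Matrix.reindex_apply, Matrix.submatrix_apply, Equiv.symm_apply_apply, Equiv.symm_symm,
    Matrix.transpose_apply]
  classical exact if_congr hs.symm rfl rfl

end Transposes

/-! ### Designs -/

section Designs

variable {F : Type u} [Field F] [Finite F]

/-- Planes of a class may be counted by their coordinate vectors, up to scalars. -/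
theorem ncard_dualPlane_mem_N (i : Fin 5) (p : Set (Pt F) → Prop) :
    {π : N F i | p π}.ncard = {Q : Pt F | dualPlane Q ∈ N F i ∧ p (dualPlane Q)}.ncard := by
  refine (ncard_coe_mem (N F i) {π | p π}).trans ?_
  rw [← Set.ncard_image_of_injective _ dualPlane_injective]
  congr 1
  ext π
  constructor
  · rintro ⟨h, hp⟩
    obtain ⟨Q, rfl⟩ := exists_dualPlane_eq (isPlane_of_mem_N h)
    exact ⟨Q, ⟨h, hp⟩, rfl⟩
  · rintro ⟨Q, ⟨h, hp⟩, rfl⟩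
    exact ⟨h, hp⟩

/-- The embedding of `Fin 3` given by three distinct elements. -/
def tripleEmb {α : Type*} {r s t : α} (hrs : r ≠ s) (hrt : r ≠ t) (hst : s ≠ t) : Fin 3 ↪ α where
  toFun := ![r, s, t]
  inj' i j hij := by
    fin_cases i <;> fin_cases j <;> simp_all [hrs.symm, hrt.symm, hst.symm]

theorem three_le_numCubic {π : Set (Pt F)} {r s t : OnePoint F} (hrs : r ≠ s) (hrt : r ≠ t)
    (hst : s ≠ t) (hr : cubicPt r ∈ π) (hs : cubicPt s ∈ π) (ht : cubicPt t ∈ π) :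
    3 ≤ numCubic π := by
  rw [← Set.ncard_eq_three.2 ⟨r, s, t, hrs, hrt, hst, rfl⟩]
  exact ncard_le_numCubic (by simp [hr, hs, ht])

omit [Finite F] in
theorem mem_N_one_iff {π : Set (Pt F)} (hπ : IsPlane π) : π ∈ N F 1 ↔ numCubic π = 2 :=
  ⟨fun h ↦ h.2, fun h ↦ ⟨hπ, h⟩⟩

omit [Finite F] in
theorem mem_N_two_iff {π : Set (Pt F)} (hπ : IsPlane π) : π ∈ N F 2 ↔ numCubic π = 3 :=
  ⟨fun h ↦ h.2, fun h ↦ ⟨hπ, h⟩⟩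

theorem ncard_planes_through_three {r s t : OnePoint F} (hrs : r ≠ s) (hrt : r ≠ t)
    (hst : s ≠ t) : {Q : Pt F | cubicPt r ∈ dualPlane Q ∧ cubicPt s ∈ dualPlane Q ∧
      cubicPt t ∈ dualPlane Q}.ncard = 1 := by
  refine Eq.trans (congrArg Set.ncard ?_)
    ((ncard_planes_through (F := F) (by norm_num) (tripleEmb hrs hrt hst)).trans (by simp))
  ext Q
  simp only [Set.mem_ofPred_eq, Fin.forall_fin_succ, IsEmpty.forall_iff, and_true]
  rfl

theorem ncard_planes_through_two {r s : OnePoint F} (hrs : r ≠ s) :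
    {Q : Pt F | cubicPt r ∈ dualPlane Q ∧ cubicPt s ∈ dualPlane Q}.ncard = Nat.card F + 1 := by
  refine Eq.trans (congrArg Set.ncard ?_)
    ((ncard_planes_through (F := F) (by norm_num) (pairEmb hrs)).trans
      (by simp [Finset.sum_range_succ, add_comm]))
  ext Q
  simp only [Set.mem_ofPred_eq, Fin.forall_fin_succ, IsEmpty.forall_iff, and_true]
  rfl

theorem ncard_mem_N_two_through_three {r s t : OnePoint F} (hrs : r ≠ s) (hrt : r ≠ t)
    (hst : s ≠ t) : {π : N F 2 | cubicPt r ∈ (π : Set (Pt F)) ∧ cubicPt s ∈ (π : Set (Pt F)) ∧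
      cubicPt t ∈ (π : Set (Pt F))}.ncard = 1 := by
  rw [ncard_dualPlane_mem_N 2 fun π ↦ cubicPt r ∈ π ∧ cubicPt s ∈ π ∧ cubicPt t ∈ π,
    ← ncard_planes_through_three hrs hrt hst]
  congr 1
  ext Q
  refine ⟨fun h ↦ h.2, fun h ↦ ⟨(mem_N_two_iff (isPlane_dualPlane Q)).2 ?_, h⟩⟩
  exact le_antisymm (numCubic_le (isPlane_dualPlane Q))
    (three_le_numCubic hrs hrt hst h.1 h.2.1 h.2.2)

/-- The planes through two points of the cubic which contain a third one are counted by their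
third point. -/
theorem ncard_mem_N_two_through_two {r s : OnePoint F} (hrs : r ≠ s) :
    {π : N F 2 | cubicPt r ∈ (π : Set (Pt F)) ∧ cubicPt s ∈ (π : Set (Pt F))}.ncard =
      Nat.card F - 1 := by
  classical
  rw [ncard_dualPlane_mem_N 2 fun π ↦ cubicPt r ∈ π ∧ cubicPt s ∈ π]
  let α := {Q : Pt F // cubicPt r ∈ dualPlane Q ∧ cubicPt s ∈ dualPlane Q}
  let β := {t : OnePoint F // t ≠ r ∧ t ≠ s}
  have := Fintype.ofFinite α
  have := Fintype.ofFinite β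
  have e := sum_ncard_comm (fun (Q : α) (t : β) ↦ cubicPt t.1 ∈ dualPlane Q.1)
  have hβ (t : β) : {Q : α | cubicPt t.1 ∈ dualPlane Q.1}.ncard = 1 := by
    rw [← ncard_planes_through_three hrs t.2.1.symm t.2.2.symm]
    refine (ncard_coe_mem {Q : Pt F | cubicPt r ∈ dualPlane Q ∧ cubicPt s ∈ dualPlane Q}
      {Q : Pt F | cubicPt t.1 ∈ dualPlane Q}).trans ?_
    congr 1
    ext Q
    exact and_assoc
  have hα (Q : α) : {t : β | cubicPt t.1 ∈ dualPlane Q.1}.ncard =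
      if dualPlane Q.1 ∈ N F 2 then 1 else 0 := by
    have e1 : {t : β | cubicPt t.1 ∈ dualPlane Q.1}.ncard + 2 = numCubic (dualPlane Q.1) := by
      rw [numCubic_eq, ← Set.ncard_sdiff_add_ncard_of_subset (s := {r, s})
        (t := {t | cubicPt t ∈ dualPlane Q.1}) (by
          rintro t (rfl | rfl)
          exacts [Q.2.1, Q.2.2]), Set.ncard_pair hrs]
      congr 1
      refine (ncard_coe_mem {t : OnePoint F | t ≠ r ∧ t ≠ s}
        {t | cubicPt t ∈ dualPlane Q.1}).trans ?_
      congr 1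
      ext t
      simp only [Set.mem_inter_iff, Set.mem_ofPred_eq, Set.mem_sdiff, Set.mem_insert_iff,
        Set.mem_singleton_iff]
      tauto
    rw [mem_N_two_iff (isPlane_dualPlane Q.1)]
    have := numCubic_le (isPlane_dualPlane Q.1)
    split_ifs <;> omega
  simp only [hα, hβ] at e
  have e2 := ncard_eq_sum {Q : α | dualPlane Q.1 ∈ N F 2}
  simp only [Set.mem_ofPred_eq] at e2
  rw [← e2, Finset.sum_const, Finset.card_univ, ← Nat.card_eq_fintype_card] at e
  have e3 : Nat.card β = Nat.card F - 1 := by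
    have : Nat.card β = ({r, s}ᶜ : Set (OnePoint F)).ncard := by
      rw [← Nat.card_coe_set_eq]
      refine Nat.card_congr (Equiv.subtypeEquivRight fun t ↦ ?_)
      simp
    rw [this, Set.ncard_compl, Set.ncard_pair hrs, card_onePoint]
    omega
  rw [e3, smul_eq_mul, mul_one] at e
  rw [← e]
  refine Eq.trans ?_ (ncard_coe_mem {Q : Pt F | cubicPt r ∈ dualPlane Q ∧ cubicPt s ∈ dualPlane Q}
    {Q : Pt F | dualPlane Q ∈ N F 2}).symm
  congr 1
  ext Q
  exact and_comm

/-- The `q + 1` planes through two points of the cubic have two or three points on it, and `q - 1`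
of them have three. -/
theorem ncard_mem_N_one_through_two {r s : OnePoint F} (hrs : r ≠ s) :
    {π : N F 1 | cubicPt r ∈ (π : Set (Pt F)) ∧ cubicPt s ∈ (π : Set (Pt F))}.ncard = 2 := by
  have h2 := ncard_mem_N_two_through_two hrs
  rw [ncard_dualPlane_mem_N _ fun π ↦ cubicPt r ∈ π ∧ cubicPt s ∈ π] at h2 ⊢
  have h := ncard_planes_through_two hrs
  have e : {Q : Pt F | cubicPt r ∈ dualPlane Q ∧ cubicPt s ∈ dualPlane Q} =
      {Q | dualPlane Q ∈ N F 1 ∧ cubicPt r ∈ dualPlane Q ∧ cubicPt s ∈ dualPlane Q} ∪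
      {Q | dualPlane Q ∈ N F 2 ∧ cubicPt r ∈ dualPlane Q ∧ cubicPt s ∈ dualPlane Q} := by
    ext Q
    simp only [Set.mem_union, Set.mem_ofPred_eq]
    refine ⟨fun hQ ↦ ?_, fun hQ ↦ hQ.elim And.right And.right⟩
    have h1 := two_le_numCubic hrs hQ.1 hQ.2
    have h2 := numCubic_le (isPlane_dualPlane Q)
    rw [mem_N_one_iff (isPlane_dualPlane Q), mem_N_two_iff (isPlane_dualPlane Q)]
    have : numCubic (dualPlane Q) = 2 ∨ numCubic (dualPlane Q) = 3 := by omega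
    exact this.imp (⟨·, hQ⟩) (⟨·, hQ⟩)
  rw [e, Set.ncard_union_eq ?_ (Set.toFinite _) (Set.toFinite _), h2] at h
  · have : 1 < Nat.card F := Finite.one_lt_card
    omega
  · rw [Set.disjoint_left]
    rintro Q ⟨h1, -⟩ ⟨h2, -⟩
    exact absurd (eq_of_mem_N h1 h2) (by decide)

omit [Finite F] in
theorem M_zero : M F 0 = cubic F := by
  rw [M]; split_ifs <;> rfl

theorem card_M_zero : Nat.card (M F 0) = Nat.card F + 1 := by
  rw [M_zero, cubic, Nat.card_range_of_injective cubicPt_injective, card_onePoint]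

omit [Finite F] in
theorem rowOnes_block_zero {i : Fin 5} (π : N F i) : rowOnes (block F i 0) π = numN i := by
  rw [rowOnes_block, M_zero, ← numCubic_of_mem_N π.2, numCubic]

omit [Finite F] in
theorem exists_cubicPt_eq (P : M F 0) : ∃ t, (P : Pt F) = cubicPt t := by
  have h : (P : Pt F) ∈ cubic F := M_zero (F := F) ▸ P.2
  obtain ⟨t, ht⟩ := h
  exact ⟨t, ht.symm⟩

/-- It suffices to count the planes through two points of the cubic, because the columns of the
block are these points. -/
theorem isDesign_two {i : Fin 5} {l : ℕ} (h : ∀ {r s : OnePoint F}, r ≠ s →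
    {π : N F i | cubicPt r ∈ (π : Set (Pt F)) ∧ cubicPt s ∈ (π : Set (Pt F))}.ncard = l) :
    IsDesign (block F i 0) 2 (Nat.card F + 1) (numN i) l := by
  classical
  refine ⟨block_eq_zero_or_one, card_M_zero, rowOnes_block_zero, fun T hT ↦ ?_⟩
  obtain ⟨P, Q, hPQ, rfl⟩ := Finset.card_eq_two.1 hT
  obtain ⟨r, hr⟩ := exists_cubicPt_eq P
  obtain ⟨s, hs⟩ := exists_cubicPt_eq Q
  have hrs : r ≠ s := by
    rintro rfl
    exact hPQ (Subtype.ext (hr.trans hs.symm))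
  rw [← h hrs]
  congr 1
  ext π
  simp [block_eq_one_iff, hr, hs]

theorem isDesign_three :
    IsDesign (block F 2 0) 3 (Nat.card F + 1) 3 1 := by
  classical
  refine ⟨block_eq_zero_or_one, card_M_zero, rowOnes_block_zero, fun T hT ↦ ?_⟩
  obtain ⟨P, Q, R, hPQ, hPR, hQR, rfl⟩ := Finset.card_eq_three.1 hT
  obtain ⟨r, hr⟩ := exists_cubicPt_eq P
  obtain ⟨s, hs⟩ := exists_cubicPt_eq Q
  obtain ⟨t, ht⟩ := exists_cubicPt_eq R
  have hne {P Q : M F 0} {r s : OnePoint F} (hr : (P : Pt F) = cubicPt r)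
      (hs : (Q : Pt F) = cubicPt s) (hPQ : P ≠ Q) : r ≠ s := by
    rintro rfl
    exact hPQ (Subtype.ext (hr.trans hs.symm))
  refine Eq.trans (congrArg Set.ncard ?_)
    (ncard_mem_N_two_through_three (hne hr hs hPQ) (hne hr ht hPR) (hne hs ht hQR))
  ext π
  simp [block_eq_one_iff, hr, hs, ht]

end Designs

/-! ### Parameters as polynomials -/

section Polynomials

open Polynomial

/-- A block is described by polynomials as soon as its tabulated entries are given by them. -/
theorem hasPolyParameters_block {F : Type u} [Field F] [Finite F] (hq5 : 5 ≤ Nat.card F) {ξ : ℤ}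
    (hξ : ξ = -1 ∨ ξ = 0 ∨ ξ = 1) (hmod : (Nat.card F : ℤ) ≡ ξ [ZMOD 3]) {i j : Fin 5}
    {a b k r : ℚ[X]} (ha : ∀ q, sizeN q i = a.eval q) (hb : ∀ q, sizeM q ξ j = b.eval q)
    (hk : ∀ q, tableK q ξ i j = k.eval q) (hr : ∀ q, tableR q ξ i j = r.eval q) :
    HasPolyParameters (block F i j) (Nat.card F) a b k r := by
  obtain ⟨k₀, r₀, ht, hk₀, hr₀⟩ := exists_isTactical hq5 hξ hmod i j
  exact ⟨by rw [card_N, ha], by rw [card_M hξ hmod, hb], k₀, r₀, ht, by rw [hk₀, hk],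
    by rw [hr₀, hr]⟩

/-- The polynomials which describe the sizes of the classes of planes. -/
noncomputable def polyN : Fin 5 → ℚ[X] :=
  ![X + 1, X ^ 2 + X, C (1 / 6) * (X ^ 3 - X), C (1 / 2) * (X ^ 3 - X), C (1 / 3) * (X ^ 3 - X)]

theorem sizeN_eq_eval (q : ℚ) (i : Fin 5) : sizeN q i = (polyN i).eval q := by
  fin_cases i <;> simp [sizeN, polyN] <;> ring

theorem exists_poly_one_zero (i : Fin 5) : ∃ b k r : ℚ[X],
    (∀ q, sizeM q 1 3 = b.eval q ∧ tableK q 1 i 3 = k.eval q ∧ tableR q 1 i 3 = r.eval q) ∧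
    (∀ q, sizeM q 0 4 = b.eval q ∧ tableK q 0 i 4 = k.eval q ∧ tableR q 0 i 4 = r.eval q) := by
  refine ⟨polyN 3,
    ![C (1 / 2) * (X ^ 2 - X), C (1 / 2) * (X ^ 2 - X), C (1 / 2) * (X ^ 2 - X),
      C (1 / 2) * (X ^ 2 + X), C (1 / 2) * (X ^ 2 - X)] i,
    ![1, X, C (1 / 6) * (X ^ 2 - X), C (1 / 2) * (X ^ 2 + X), C (1 / 3) * (X ^ 2 - X)] i,
    fun q ↦ ⟨(sizeN_eq_eval q 3), ?_, ?_⟩, fun q ↦ ⟨(sizeN_eq_eval q 3), ?_, ?_⟩⟩ <;>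
  fin_cases i <;> simp [tableK, tableR] <;> ring

theorem exists_poly_neg_one_zero (i : Fin 5) : ∃ b k r : ℚ[X],
    (∀ q, sizeM q (-1) 3 = b.eval q ∧ tableK q (-1) i 3 = k.eval q ∧
      tableR q (-1) i 3 = r.eval q) ∧
    (∀ q, sizeM q 0 3 = b.eval q ∧ tableK q 0 i 3 = k.eval q ∧ tableR q 0 i 3 = r.eval q) := by
  refine ⟨polyN 3,
    ![C (1 / 2) * (X ^ 2 - X), C (1 / 2) * (X ^ 2 - X), C (1 / 2) * (X ^ 2 + X),
      C (1 / 2) * (X ^ 2 - X), C (1 / 2) * (X ^ 2 + X)] i,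
    ![1, X, C (1 / 6) * (X ^ 2 + X), C (1 / 2) * (X ^ 2 - X), C (1 / 3) * (X ^ 2 + X)] i,
    fun q ↦ ⟨(sizeN_eq_eval q 3), ?_, ?_⟩, fun q ↦ ⟨(sizeN_eq_eval q 3), ?_, ?_⟩⟩ <;>
  fin_cases i <;> simp [tableK, tableR] <;> ring

end Polynomials

theorem tableK_eq_tableR (q : ℚ) {ξ : ℤ} (hξ : ξ ≠ 0) (i j : Fin 5) :
    tableK q ξ i j = tableR q ξ j i := by
  rw [tableK, tableR, if_neg hξ, if_neg hξ]
  fin_cases i <;> fin_cases j <;> simp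

end TwistedCubic

theorem theorem3p1 :
    -- the assertions about a single field
    (∀ (F : Type u) [Field F] [Finite F] (ξ : ℤ), 5 ≤ Nat.card F →
      (ξ = -1 ∨ ξ = 0 ∨ ξ = 1) → (Nat.card F : ℤ) ≡ ξ [ZMOD 3] →
      -- the five classes of planes, and of points, are the orbits of the group of the cubic
      (Function.Injective (N F) ∧
        Set.range (N F) = {O | ∃ π, IsPlane π ∧ O = MulAction.orbit (cubicGroup F) π}) ∧
      (Function.Injective (M F) ∧
        Set.range (M F) = {O | ∃ P, O = MulAction.orbit (cubicGroup F) P}) ∧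
      -- their sizes
      (∀ i, (Nat.card (N F i) : ℚ) = sizeN (Nat.card F) i) ∧
      (∀ j, (Nat.card (M F j) : ℚ) = sizeM (Nat.card F) ξ j) ∧
      ∃ k r : Fin 5 → Fin 5 → ℕ,
        -- every block is a tactical configuration, with the tabulated parameters
        (∀ i j, IsTactical (block F i j) (k i j) (r i j)) ∧
        (∀ i j, (k i j : ℚ) = tableK (Nat.card F) ξ i j) ∧
        (∀ i j, (r i j : ℚ) = tableR (Nat.card F) ξ i j) ∧
        -- transposes
        (ξ ≠ 0 → ∀ i j, SameUpToRearrangement (block F i j)ᵀ (block F j i) ∧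
          k i j = r j i ∧ r i j = k j i) ∧
        (ξ = 0 →
          SameUpToRearrangement (block F 3 0)ᵀ (block F 0 3) ∧
          SameUpToRearrangement (block F 3 0)ᵀ (block F 0 4) ∧
          SameUpToRearrangement (block F 3 1)ᵀ (block F 0 3) ∧
          SameUpToRearrangement (block F 3 1)ᵀ (block F 0 4)) ∧
        -- designs
        IsDesign (block F 1 0) 2 (Nat.card F + 1) 2 2 ∧
        IsDesign (block F 2 0) 3 (Nat.card F + 1) 3 1 ∧
        IsDesign (block F 2 0) 2 (Nat.card F + 1) 3 (Nat.card F - 1)) ∧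
    -- `I_{i4}` for `q ≡ 1` is described by the same functions of `q` as `I_{i5}` for `q ≡ 0`
    (∀ i, ∃ a b k r : Polynomial ℚ,
      (∀ (F : Type u) [Field F] [Finite F], 5 ≤ Nat.card F → Nat.card F ≡ 1 [MOD 3] →
        HasPolyParameters (block F i 3) (Nat.card F) a b k r) ∧
      (∀ (F : Type u) [Field F] [Finite F], 5 ≤ Nat.card F → Nat.card F ≡ 0 [MOD 3] →
        HasPolyParameters (block F i 4) (Nat.card F) a b k r)) ∧
    -- `I_{i4}` is described by the same functions of `q` for `q ≡ -1` and for `q ≡ 0`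
    (∀ i, ∃ a b k r : Polynomial ℚ,
      (∀ (F : Type u) [Field F] [Finite F], 5 ≤ Nat.card F → Nat.card F ≡ 2 [MOD 3] →
        HasPolyParameters (block F i 3) (Nat.card F) a b k r) ∧
      (∀ (F : Type u) [Field F] [Finite F], 5 ≤ Nat.card F → Nat.card F ≡ 0 [MOD 3] →
        HasPolyParameters (block F i 3) (Nat.card F) a b k r)) := by
  refine ⟨?_, ?_, ?_⟩
  · intro F _ _ ξ hq hξ hmod
    refine ⟨⟨injective_N hq, range_N hq⟩, ⟨injective_M hq, range_M hq⟩, card_N,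
      card_M hξ hmod, ?_⟩
    choose k r ht hk hr using exists_isTactical hq hξ hmod
    refine ⟨k, r, ht, hk, hr, ?_, ?_, ?_, isDesign_three, ?_⟩
    · intro hξ0 i j
      have hmod3 : Nat.card F % 3 ≠ 0 := by
        rcases residue_cases hξ hmod with ⟨-, h⟩ | ⟨h, -⟩ | ⟨-, h⟩
        · omega
        · exact absurd h hξ0
        · omega
      have hkr (i j : Fin 5) : k i j = r j i := by
        exact_mod_cast (hk i j).trans ((tableK_eq_tableR _ hξ0 i j).trans (hr j i).symm)
      exact ⟨sameUpToRearrangement_block hmod3 i j, hkr i j, (hkr j i).symm⟩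
    · rintro rfl
      have hsame {i j l : Fin 5}
          (h1 : tableR (Nat.card F) 0 i j = (Nat.card F ^ 2 - Nat.card F) / 2)
          (h2 : tableK (Nat.card F) 0 i j = 1)
          (h3 : tableK (Nat.card F) 0 0 l = (Nat.card F ^ 2 - Nat.card F) / 2)
          (h4 : tableR (Nat.card F) 0 0 l = 1)
          (h5 : sizeM (Nat.card F) 0 j = sizeN (Nat.card F) 0) :
          SameUpToRearrangement (block F i j)ᵀ (block F 0 l) := by
        have e1 : k i j = 1 := by exact_mod_cast (hk i j).trans h2
        have e2 : r 0 l = 1 := by exact_mod_cast (hr 0 l).trans h4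
        have e3 : k 0 l = r i j := by
          exact_mod_cast ((hk 0 l).trans h3).trans ((hr i j).trans h1).symm
        refine sameUpToRearrangement_of_isTactical_one (k := r i j) ?_ ?_ ?_
        · exact e1 ▸ (ht i j).transpose
        · exact e3 ▸ e2 ▸ ht 0 l
        · have := (card_M hξ hmod j).trans (h5.trans (card_N (F := F) 0).symm)
          exact_mod_cast this
      refine ⟨hsame ?_ ?_ ?_ ?_ ?_, hsame ?_ ?_ ?_ ?_ ?_, hsame ?_ ?_ ?_ ?_ ?_,
        hsame ?_ ?_ ?_ ?_ ?_⟩ <;> simp [tableK, tableR, sizeM, sizeN]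
    · exact isDesign_two ncard_mem_N_one_through_two
    · exact isDesign_two ncard_mem_N_two_through_two
  · intro i
    obtain ⟨b, k, r, h1, h0⟩ := exists_poly_one_zero i
    refine ⟨polyN i, b, k, r, fun F _ _ hq hmod ↦ ?_, fun F _ _ hq hmod ↦ ?_⟩
    · exact hasPolyParameters_block (ξ := 1) hq (by simp) (by exact_mod_cast
        (Int.natCast_modEq_iff.2 hmod)) (sizeN_eq_eval · i) (fun q ↦ (h1 q).1) (fun q ↦ (h1 q).2.1)
        (fun q ↦ (h1 q).2.2)
    · exact hasPolyParameters_block (ξ := 0) hq (by simp) (by exact_mod_cast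
        (Int.natCast_modEq_iff.2 hmod)) (sizeN_eq_eval · i) (fun q ↦ (h0 q).1) (fun q ↦ (h0 q).2.1)
        (fun q ↦ (h0 q).2.2)
  · intro i
    obtain ⟨b, k, r, h1, h0⟩ := exists_poly_neg_one_zero i
    refine ⟨polyN i, b, k, r, fun F _ _ hq hmod ↦ ?_, fun F _ _ hq hmod ↦ ?_⟩
    · exact hasPolyParameters_block (ξ := -1) hq (by simp)
        ((Int.natCast_modEq_iff.2 hmod).trans (by decide)) (sizeN_eq_eval · i)
        (fun q ↦ (h1 q).1) (fun q ↦ (h1 q).2.1) (fun q ↦ (h1 q).2.2)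
    · exact hasPolyParameters_block (ξ := 0) hq (by simp) (by exact_mod_cast
        (Int.natCast_modEq_iff.2 hmod)) (sizeN_eq_eval · i) (fun q ↦ (h0 q).1) (fun q ↦ (h0 q).2.1)
        (fun q ↦ (h0 q).2.2)
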